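/- **Problem.** $n\ge 1$ agents solve $\min_{x\in\mathbb R^d}\Phi(x)=F(x)+\Psi(x)$, $F=\frac1n\sum_{i=1}^nF_i$, $F_i(x)=\mathbb E_{\xi\sim\mathcal D_i}[G_i(x,\xi)]$, where each $F_i$ is differentiable with $L$-Lipschitz gradient ($L=L_{\nabla F}>0$), $\Psi:\mathbb R^d\to\mathbb R\cup\{+\infty\}$ is closed, proper and convex, and $\Phi\ge\Phi_*>-\infty$. Let $\mathrm{prox}^\gamma_\Psi(x)=\arg\min_y\{\frac1{2\gamma}\|y-x\|^2+\Psi(y)\}$ and $\mathcal G(x,z,\gamma)=\frac1\gamma(x-\mathrm{prox}_\Psi^\gamma(x-\gamma z))$. **Network and samples.** The weight matrix $\mathbf W\in\mathbb R^{n\times n}$ is symmetric, entrywise nonnegative, with $\mathbf W\mathbf 1=\mathbf 1$, and its eigenvalues $1=\lambda_1\ge\lambda_2\ge\dots\ge\lambda_n$ satisfy $\rho=\max\{|\lambda_2|,|\lambda_n|\}<1$ ($\rho=0$ if $n=1$). For an integer $m\ge1$ put $\varrho(m)=\frac{(1+\rho^{2m})\rho^{2m}}{(1-\rho^{2m})^2}$.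 At time $k+1$ agent $i$ draws a sample $\xi_i^{k+1}\sim\mathcal D_i$; let $\mathcal F_k$ be generated by all $\xi_i^t$ with $1\le t\le k$ ($\mathcal F_0$ trivial). Each $\xi_i^{k+1}$ is independent of $\mathcal F_k$ and, for $j\ne i$, of $\mathcal F_k$ and $\xi_j^{k+1}$ jointly. For every $\mathcal F_k$-measurable random point $x$, $\mathbb E[\nabla G_i(x,\xi_i^{k+1})\mid\mathcal F_k]=\nabla F_i(x)$ (whenever $\nabla G_i(x,\xi_i^{k+1})$ is integrable) and $\mathbb E[\|\nabla G_i(x,\xi_i^{k+1})-\nabla F_i(x)\|^2\mid\mathcal F_k]\le\sigma_i^2$, and $\frac1n\sum_i\sigma_i^2\le\sigma^2$. **Algorithms.** Start from $x_i^0=z_i^0=u_i^0=v_i^0=0$. In iteration $k$ each agent computes $y_i^k=\mathrm{prox}^\gamma_\Psi(x_i^k-\gamma z_i^k)$, $\tilde x_i^{k+1}=(1-\alpha_k)x_i^k+\alpha_ky_i^k$, $v_i^{k+1}=\nabla G_i(x_i^k,\xi_i^{k+1})$. In Prox-DASA, $\tilde z_i^{k+1}=(1-\alpha_k)z_i^k+\alpha_kv_i^{k+1}$.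 In Prox-DASA-GT, $\tilde u_i^{k+1}=u_i^k+v_i^{k+1}-v_i^k$ and $\tilde z_i^{k+1}=(1-\alpha_k)z_i^k+\alpha_k\tilde u_i^{k+1}$. Then the matrices with columns $\tilde x_i^{k+1}$, $\tilde z_i^{k+1}$ (and $\tilde u_i^{k+1}$ in Prox-DASA-GT) are multiplied from the right by $\mathbf W^m$ to give $x_i^{k+1},z_i^{k+1}$ (and $u_i^{k+1}$). With parameter $K$, Prox-DASA runs $k=0,\dots,K-1$ and Prox-DASA-GT runs $k=0,\dots,K$; the output is $\mathbf X_R=[x_1^R,\dots,x_n^R]$ with $R$ uniform on $\{1,\dots,K\}$ and independent of the samples. $\mathbf X=[x_1,\dots,x_n]$ with average $\bar x$ is an $\epsilon$-stationary point if $\mathbb E\|\mathcal G(\bar x,\nabla F(\bar x),\gamma)\|^2\le\epsilon$ and $\mathbb E[\frac{L^2}{n}\sum_i\|x_i-\bar x\|^2]\le\epsilon$. **Statement.** Fix constants $0<c_1\le c_2$, $0<a_1\le a_2$, $b>0$. There is $K_0=K_0(n,L,\varrho(m),\gamma)$, depending besides on these constants only, such that for all $L>0$, $\sigma$, $\nu$,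 $C_0$ there is $C>0$, depending only on $L,\sigma,\nu,C_0$ and the fixed constants (not on $n,d,m,\mathbf W,\gamma,\epsilon$), with the following property. Consider any problem as above with $\Phi(0)-\Phi_*+\frac1n\sum_i\|\nabla F_i(0)\|^2\le C_0$ (in particular $0\in\mathrm{dom}\,\Psi$) and any $\gamma$ with $c_1/L\le\gamma\le c_2/L$, and let $K_T=\max\{K_0,n^3\varrho(m)\}$. For Prox-DASA assume in addition $\|\nabla F_i(x)-\nabla F(x)\|\le\nu$ for all $i,x$; for Prox-DASA-GT this is not needed. Then for every $\epsilon>0$ and for each of the two algorithms: 1. for every integer $K\ge K_0$ with $K\ge b\,n^3\varrho(m)$ and $K\ge C\,n^{-1}\epsilon^{-2}$, and all stepsizes with $a_1\sqrt{n/K}\le\alpha_k\le a_2\sqrt{n/K}$ ($0\le k<K$), the output $\mathbf X_R$ is an $\epsilon$-stationary point; each agent draws exactly one sample per iteration (batch size $1$), hence in total $K$ samples in Prox-DASA and $K+1$ in Prox-DASA-GT; 2. consequently the per-agent sample complexity is $\mathcal O(\max\{n^{-1}\epsilon^{-2},K_T\})$: there is an integer $K\ge K_0$ with $K\ge b\,n^3\varrho(m)$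 such that for all such stepsizes the run with parameter $K$ outputs an $\epsilon$-stationary point $\mathbf X_R$ and each agent draws at most $C\max\{n^{-1}\epsilon^{-2},K_T\}$ samples. -/

import Mathlib

open MeasureTheory ProbabilityTheory

namespace ProxDASA

noncomputable section

/-! ### The composite problem -/

/-- `ℝᵈ` with its Euclidean norm. -/
abbrev Vec (d : ℕ) : Type := EuclideanSpace ℝ (Fin d)

/-- Average of `n` vectors. -/
def avg {n d : ℕ} (X : Fin n → Vec d) : Vec d := (n : ℝ)⁻¹ • ∑ i, X i

/-- The data of the stochastic composite problem
`min_x (1/n) ∑ᵢ Fᵢ(x) + Ψ(x)` with `Fᵢ(x) = 𝔼_{s ∼ Dᵢ} [Gᵢ(x, s)]`. -/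
structure Problem (n d : ℕ) (S : Type*) [MeasurableSpace S] where
  /-- the sample losses -/
  G : Fin n → Vec d → S → ℝ
  /-- the distributions that generate the samples of the agents -/
  D : Fin n → Measure S
  /-- the regularizer, with values in `ℝ ∪ {+∞}` -/
  Ψ : Vec d → EReal

namespace Problem

variable {n d : ℕ} {S : Type*} [MeasurableSpace S] (P : Problem n d S)

/-- The local objective `Fᵢ(x) = 𝔼_{s ∼ Dᵢ} [Gᵢ(x, s)]`. -/
def locF (i : Fin n) (x : Vec d) : ℝ := ∫ s, P.G i x s ∂(P.D i)

/-- The smooth part `F = (1/n) ∑ᵢ Fᵢ`. -/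
def F (x : Vec d) : ℝ := (n : ℝ)⁻¹ * ∑ i, P.locF i x

/-- The full objective `Φ = F + Ψ`. -/
def Phi (x : Vec d) : EReal := ((P.F x : ℝ) : EReal) + P.Ψ x

/-- The stochastic gradient `∇Gᵢ(x, s)` (gradient in `x`). -/
def stochGrad (i : Fin n) (x : Vec d) (s : S) : Vec d := gradient (fun y => P.G i y s) x

/-- Standing regularity of the sample losses: the `Dᵢ` are probability distributions, the
expectations defining `Fᵢ` exist, the sample losses are differentiable in `x`, and the stochastic
gradients are measurable. -/
structure Regular : Prop where
  prob : ∀ i, IsProbabilityMeasure (P.D i)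
  integrable : ∀ i x, Integrable (fun s => P.G i x s) (P.D i)
  differentiable : ∀ i s, Differentiable ℝ (fun x => P.G i x s)
  measurable : ∀ i, Measurable (fun p : Vec d × S => P.stochGrad i p.1 p.2)

/-- Every `Fᵢ` is differentiable with `L`-Lipschitz gradient; `L` plays the role of
`L_{∇F} = maxᵢ L_{∇Fᵢ}`. -/
structure Smooth (L : NNReal) : Prop where
  differentiable : ∀ i, Differentiable ℝ (P.locF i)
  lipschitz : ∀ i, LipschitzWith L (gradient (P.locF i))

/-- Bounded gradient heterogeneity: `‖∇Fᵢ(x) - ∇F(x)‖ ≤ ν`. -/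
def BoundedHeterogeneity (ν : ℝ) : Prop :=
  ∀ i x, ‖gradient (P.locF i) x - gradient P.F x‖ ≤ ν

/-- The quantity measuring the initialization at the origin, for a lower bound `Φinf` of `Φ`:
`Φ(0) - Φinf + (1/n) ∑ᵢ ‖∇Fᵢ(0)‖²`. It is finite exactly if `0` is in the domain of `Ψ`. -/
def initGap (Φinf : ℝ) : EReal :=
  P.Phi 0 - (Φinf : EReal) + (((n : ℝ)⁻¹ * ∑ i, ‖gradient (P.locF i) 0‖ ^ 2 : ℝ) : EReal)

end Problem

/-! ### Closed proper convex functions and the proximal operator -/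

/-- Closed proper convex functions `ℝᵈ → ℝ ∪ {+∞}`. -/
structure ClosedProperConvex {d : ℕ} (Ψ : Vec d → EReal) : Prop where
  ne_bot : ∀ x, Ψ x ≠ ⊥
  proper : ∃ x, Ψ x ≠ ⊤
  closed : LowerSemicontinuous Ψ
  convex : Convex ℝ {p : Vec d × ℝ | Ψ p.1 ≤ ((p.2 : ℝ) : EReal)}

/-- The objective `(1 / (2γ)) ‖y - x‖² + Ψ(y)` of the proximal problem at `x`. -/
def proxObj {d : ℕ} (Ψ : Vec d → EReal) (γ : ℝ) (x y : Vec d) : EReal :=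
  ((1 / (2 * γ) * ‖y - x‖ ^ 2 : ℝ) : EReal) + Ψ y

/-- The proximal operator: a minimizer of `proxObj Ψ γ x` (there is exactly one if `Ψ` is closed
proper convex and `γ > 0`). -/
def prox {d : ℕ} (Ψ : Vec d → EReal) (γ : ℝ) (x : Vec d) : Vec d :=
  Classical.epsilon fun y => ∀ w, proxObj Ψ γ x y ≤ proxObj Ψ γ x w

/-- The proximal gradient mapping `𝒢(x, z, γ) = (x - prox(x - γ z)) / γ`. -/
def gradMap {d : ℕ} (Ψ : Vec d → EReal) (x z : Vec d) (γ : ℝ) : Vec d :=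
  (1 / γ) • (x - prox Ψ γ (x - γ • z))

/-! ### The communication network -/

/-- `ρ = max {|λ₂|, |λₙ|}` for a symmetric matrix with eigenvalues `λ₁ ≥ λ₂ ≥ … ≥ λₙ`
(`eigenvalues₀` lists them in this order, from index `0`), and `ρ = 0` for a single agent. -/
def rho {n : ℕ} (W : Matrix (Fin n) (Fin n) ℝ) : ℝ :=
  open Classical in
  if h : W.IsHermitian ∧ 2 ≤ n then
    max |h.1.eigenvalues₀ ⟨1, by have := h.2; simp; omega⟩|
      |h.1.eigenvalues₀ ⟨n - 1, by have := h.2; simp; omega⟩|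
  else 0

/-- Symmetric doubly stochastic weight matrices with `ρ < 1` (that `λ₁ = 1` and `λ₂ < 1` is then
automatic). -/
structure IsGossip {n : ℕ} (W : Matrix (Fin n) (Fin n) ℝ) : Prop where
  symm : W.IsSymm
  row_sum : ∀ i, ∑ j, W i j = 1
  nonneg : ∀ i j, 0 ≤ W i j
  rho_lt_one : rho W < 1

/-- `ϱ(m) = (1 + ρ²ᵐ) ρ²ᵐ / (1 - ρ²ᵐ)²`. -/
def varrho (ρ : ℝ) (m : ℕ) : ℝ :=
  (1 + ρ ^ (2 * m)) * ρ ^ (2 * m) / (1 - ρ ^ (2 * m)) ^ 2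

/-- The product `[x₁, …, xₙ] A` of the matrix with columns `xᵢ` with `A`. -/
def mix {n d : ℕ} (A : Matrix (Fin n) (Fin n) ℝ) (X : Fin n → Vec d) : Fin n → Vec d :=
  fun i => ∑ j, A j i • X j

/-! ### The algorithms -/

/-- State after some iterations: primal variables, dual variables, and for each agent the number of
samples drawn (stochastic gradients evaluated) so far. -/
structure State (n d : ℕ) where
  x : Fin n → Vec d
  z : Fin n → Vec d
  samples : Fin n → ℕ

/-- State of the gradient tracking variant: also the tracking variables `uᵢ` and the last
stochastic gradients `vᵢ`. -/
structure GTState (n d : ℕ) extends State n d where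
  u : Fin n → Vec d
  v : Fin n → Vec d

section Algorithms

variable {n d : ℕ} {S : Type*} [MeasurableSpace S] (P : Problem n d S)
  (W : Matrix (Fin n) (Fin n) ℝ) (m : ℕ) (γ : ℝ)

/-- The iterates of Prox-DASA with stepsizes `α`, run on the sample sequence `ξ`; the sample
`ξ (k + 1) i` is used by agent `i` in iteration `k`. -/
def dasa (α : ℕ → ℝ) (ξ : ℕ → Fin n → S) : ℕ → State n d
  | 0 => { x := 0, z := 0, samples := 0 }
  | k + 1 =>
    let s := dasa α ξ k
    let y : Fin n → Vec d := fun i => prox P.Ψ γ (s.x i - γ • s.z i)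
    let xt : Fin n → Vec d := fun i => (1 - α k) • s.x i + α k • y i
    let v : Fin n → Vec d := fun i => P.stochGrad i (s.x i) (ξ (k + 1) i)
    let zt : Fin n → Vec d := fun i => (1 - α k) • s.z i + α k • v i
    { x := mix (W ^ m) xt
      z := mix (W ^ m) zt
      samples := fun i => s.samples i + 1 }

/-- The iterates of Prox-DASA-GT, with all variables (`v⁰ = u⁰ = 0`). -/
def dasaGTFull (α : ℕ → ℝ) (ξ : ℕ → Fin n → S) : ℕ → GTState n d
  | 0 => { x := 0, z := 0, samples := 0, u := 0, v := 0 }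
  | k + 1 =>
    let s := dasaGTFull α ξ k
    let y : Fin n → Vec d := fun i => prox P.Ψ γ (s.x i - γ • s.z i)
    let xt : Fin n → Vec d := fun i => (1 - α k) • s.x i + α k • y i
    let v : Fin n → Vec d := fun i => P.stochGrad i (s.x i) (ξ (k + 1) i)
    let ut : Fin n → Vec d := fun i => s.u i + v i - s.v i
    let zt : Fin n → Vec d := fun i => (1 - α k) • s.z i + α k • ut i
    { x := mix (W ^ m) xt
      z := mix (W ^ m) zt
      samples := fun i => s.samples i + 1
      u := mix (W ^ m) ut
      v := v }

/-- The iterates of Prox-DASA-GT. -/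
def dasaGT (α : ℕ → ℝ) (ξ : ℕ → Fin n → S) (k : ℕ) : State n d :=
  (dasaGTFull P W m γ α ξ k).toState

end Algorithms

/-! ### The stochastic oracle -/

section Oracle

variable {n d : ℕ} {S : Type*} [MeasurableSpace S] {Ω : Type*} [MeasurableSpace Ω]

/-- The `σ`-algebra generated by the sample of agent `i` at time `k`. -/
abbrev sampleAlg (ξ : ℕ → Fin n → Ω → S) (k : ℕ) (i : Fin n) : MeasurableSpace Ω :=
  MeasurableSpace.comap (ξ k i) inferInstance

/-- `ℱ_k = σ(ξᵢᵗ | 1 ≤ i ≤ n, 1 ≤ t ≤ k)`; in particular `ℱ_0` is trivial. -/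
abbrev sampleFiltration (ξ : ℕ → Fin n → Ω → S) (k : ℕ) : MeasurableSpace Ω :=
  ⨆ t ∈ Finset.Icc 1 k, ⨆ i, sampleAlg ξ t i

/-- The stochastic oracle: the samples of agent `i` are distributed as `Dᵢ`, the samples drawn at
time `k + 1` are independent of the past and of each other, and the stochastic gradients are
conditionally unbiased with conditional variance at most `(σs i)²`, at every `ℱ_k`-measurable
random point `x`. -/
structure Oracle (P : Problem n d S) (σs : Fin n → ℝ) (μ : Measure Ω)
    (ξ : ℕ → Fin n → Ω → S) : Prop where
  measurable : ∀ k i, Measurable (ξ k i)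
  law : ∀ k i, μ.map (ξ (k + 1) i) = P.D i
  indep_past : ∀ k i, Indep (sampleAlg ξ (k + 1) i) (sampleFiltration ξ k) μ
  indep_agents : ∀ k i j, i ≠ j →
    Indep (sampleAlg ξ (k + 1) i) (sampleFiltration ξ k ⊔ sampleAlg ξ (k + 1) j) μ
  unbiased : ∀ k i (x : Ω → Vec d), Measurable[sampleFiltration ξ k] x →
    Integrable (fun ω => P.stochGrad i (x ω) (ξ (k + 1) i ω)) μ →
    μ[fun ω => P.stochGrad i (x ω) (ξ (k + 1) i ω) | sampleFiltration ξ k]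
      =ᵐ[μ] fun ω => gradient (P.locF i) (x ω)
  variance : ∀ k i (x : Ω → Vec d), Measurable[sampleFiltration ξ k] x →
    Integrable (fun ω =>
      ‖P.stochGrad i (x ω) (ξ (k + 1) i ω) - gradient (P.locF i) (x ω)‖ ^ 2) μ ∧
    μ[fun ω => ‖P.stochGrad i (x ω) (ξ (k + 1) i ω) - gradient (P.locF i) (x ω)‖ ^ 2
        | sampleFiltration ξ k] ≤ᵐ[μ] fun _ => σs i ^ 2

/-- `R` is uniformly distributed on `{1, …, K}` and independent of all the samples. -/
structure IsUniformIndex (μ : Measure Ω) (ξ : ℕ → Fin n → Ω → S) (K : ℕ) (R : Ω → ℕ) : Prop where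
  measurable : Measurable R
  law : μ.map R = uniformOn (Set.Icc 1 K)
  indep : Indep (MeasurableSpace.comap R inferInstance) (⨆ k, sampleFiltration ξ k) μ

/-! ### Stationary points and sample complexity -/

/-- `ε`-stationary points: the random vectors `X = [x₁, …, xₙ]` have stationarity violation
`𝔼 ‖𝒢(x̄, ∇F(x̄), γ)‖²` and consensus error `𝔼 (L²/n) ‖X - X̄‖²` at most `ε`. -/
structure IsStationaryPoint (P : Problem n d S) (L γ : ℝ) (μ : Measure Ω) (ε : ℝ)
    (X : Ω → Fin n → Vec d) : Prop where
  integrable_violation :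
    Integrable (fun ω => ‖gradMap P.Ψ (avg (X ω)) (gradient P.F (avg (X ω))) γ‖ ^ 2) μ
  violation_le : ∫ ω, ‖gradMap P.Ψ (avg (X ω)) (gradient P.F (avg (X ω))) γ‖ ^ 2 ∂μ ≤ ε
  integrable_consensus :
    Integrable (fun ω => L ^ 2 / n * ∑ i, ‖X ω i - avg (X ω)‖ ^ 2) μ
  consensus_le : ∫ ω, L ^ 2 / n * ∑ i, ‖X ω i - avg (X ω)‖ ^ 2 ∂μ ≤ ε

/-- Stepsizes `α_k ≍ √(n/K)` for a run with `K` iterations, with constants `a₁ ≤ a₂`. -/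
def IsStepsize (a₁ a₂ : ℝ) (n K : ℕ) (α : ℕ → ℝ) : Prop :=
  ∀ k < K, a₁ * √((n : ℝ) / K) ≤ α k ∧ α k ≤ a₂ * √((n : ℝ) / K)

/-- Run the algorithm with parameter `K`, the loop being executed `passes` times. For all admissible
stepsizes, each agent draws one sample in every pass (batch size one) and at most `N` samples in
total, and the output `X_R` at the random index `R` is an `ε`-stationary point. -/
structure FindsStationary (alg : (ℕ → ℝ) → (ℕ → Fin n → S) → ℕ → State n d) (passes : ℕ)
    (P : Problem n d S) (L γ a₁ a₂ : ℝ) (μ : Measure Ω) (ξ : ℕ → Fin n → Ω → S)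
    (ε : ℝ) (K : ℕ) (N : ℝ) : Prop where
  batch_size : ∀ α, IsStepsize a₁ a₂ n K α → ∀ ω i k,
    (alg α (fun t j => ξ t j ω) (k + 1)).samples i = (alg α (fun t j => ξ t j ω) k).samples i + 1
  samples_le : ∀ α, IsStepsize a₁ a₂ n K α → ∀ ω i,
    ((alg α (fun t j => ξ t j ω) passes).samples i : ℝ) ≤ N
  stationary : ∀ α, IsStepsize a₁ a₂ n K α → ∀ R : Ω → ℕ, IsUniformIndex μ ξ K R →
    IsStationaryPoint P L γ μ ε (fun ω => (alg α (fun t j => ξ t j ω) (R ω)).x)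

end Oracle

end

end ProxDASA

/-! Powers of `W` preserve averages, so both algorithms are perturbations of one averaged iteration.
Let x, z be the averages, p = prox(x - γz) - x and e = z - ∇F(x). Then x moves by α(p + q) and z by
α(b - e + δ). Here q (from averaging proximal points) and b (from evaluating ∇Fᵢ at local points)
are bounded by the consensus errors, and δ is the averaged gradient noise. Gradient tracking fits
the same pattern because its directions have the same average as the stochastic gradients. `IsRun`
records exactly this.

The Lyapunov function is F + 2Ψ - η + λ‖e‖², where η(x, z) = min_y ⟨z, y - x⟩ + ‖y - x‖²/(2γ) +
Ψ(y). It is at least Φinf because η ≤ Ψ. The weights 1, 2, -1 make the terms linear in z cancel, and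
also the cross term ⟨e, p⟩. What is left (`lyapunov_step`) is a decrease of α(‖p‖²/(2γ) + λ‖e‖²/2),
up to consensus errors, a term α²‖δ‖² and a term linear in δ with predictable coefficient. This
decrease controls the stationarity measure, since ‖𝒢‖² ≤ 2γ⁻²‖p‖² + 2‖e‖². By independence across
agents 𝔼‖δ‖² ≤ σ²/n, so with α² of order n/K the noise costs O(1) over the whole run. This is the
linear speedup.

The dispersions of x and z contract by the spectral gap and are forced at order β², where β =
a₂√(n/K) bounds the stepsizes. The forcing comes from the dispersion U of the directions. With
bounded heterogeneity U is bounded directly; with tracking it obeys its own contracting recursion.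
`DirectionBound` is a recursion valid in both cases. A potential AβT + Bβ³U, with T the dispersion
of x and z together (`sum_coupled_le`), shows that every network-dependent constant reaches the
final estimate multiplied by a positive power of β. For K ≥ K₀ these contributions are below fixed
bounds. Hence the network enters K₀ but not C.

The result is a bound D, independent of the network, for β times the sum of both error measures, up
to constants. Dividing by βK, of order √(nK), and using that R is uniform and independent of the
samples gives errors at most Q/√(nK), which is at most ε once K ≥ Q²/(nε²). -/

namespace ProxDASA

/-! ### Closed proper convex functions and the proximal operator -/

namespace ClosedProperConvex

variable {d : ℕ} {Ψ : Vec d → EReal}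

theorem coe_toReal (h : ClosedProperConvex Ψ) {x : Vec d} (hx : Ψ x ≠ ⊤) :
    (((Ψ x).toReal : ℝ) : EReal) = Ψ x := EReal.coe_toReal hx (h.ne_bot x)

/-- Convexity of the epigraph is applied to the boundary points (x, Ψ(x)) over the effective domain.
-/
theorem convexOn (h : ClosedProperConvex Ψ) :
    ConvexOn ℝ {x | Ψ x ≠ ⊤} (fun x => (Ψ x).toReal) := by
  have key : ∀ x, Ψ x ≠ ⊤ → ∀ y, Ψ y ≠ ⊤ → ∀ a b : ℝ, 0 ≤ a → 0 ≤ b → a + b = 1 →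
      Ψ (a • x + b • y) ≤ ((a * (Ψ x).toReal + b * (Ψ y).toReal : ℝ) : EReal) := by
    intro x hx y hy a b ha hb hab
    have := h.convex (x := (x, (Ψ x).toReal)) (h.coe_toReal hx).ge
      (y := (y, (Ψ y).toReal)) (h.coe_toReal hy).ge ha hb hab
    simpa using this
  refine ⟨?_, ?_⟩
  · intro x hx y hy a b ha hb hab
    exact ne_top_of_le_ne_top (EReal.coe_ne_top _) (key x hx y hy a b ha hb hab)
  · intro x hx y hy a b ha hb hab
    have h1 := key x hx y hy a b ha hb hab
    have h2 : Ψ (a • x + b • y) ≠ ⊤ := ne_top_of_le_ne_top (EReal.coe_ne_top _) h1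
    rw [← h.coe_toReal h2] at h1
    simpa using EReal.coe_le_coe_iff.1 h1

/-- On the unit ball around a domain point Ψ attains its minimum. A farther point w is joined to x₀,
and convexity at the point of the segment at distance 1 from x₀ transfers the bound to w with a loss
linear in the distance. This takes the place of an affine minorant. -/
theorem exists_lower_bound (h : ClosedProperConvex Ψ) :
    ∃ x₀, Ψ x₀ ≠ ⊤ ∧ ∃ c : ℝ, 0 ≤ c ∧
      ∀ w, Ψ w ≠ ⊤ → (Ψ x₀).toReal - c - c * ‖w - x₀‖ ≤ (Ψ w).toReal := by
  obtain ⟨x₀, hx₀⟩ := h.proper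
  refine ⟨x₀, hx₀, ?_⟩
  obtain ⟨z, hz, hmin⟩ := LowerSemicontinuousOn.exists_isMinOn (s := Metric.closedBall x₀ 1)
    ⟨x₀, by simp⟩ (isCompact_closedBall x₀ 1) (h.closed.lowerSemicontinuousOn _)
  have hzx : Ψ z ≤ Ψ x₀ := hmin (by simp)
  have hzt : Ψ z ≠ ⊤ := ne_top_of_le_ne_top hx₀ hzx
  have hle : ∀ w, ‖w - x₀‖ ≤ 1 → Ψ w ≠ ⊤ → (Ψ z).toReal ≤ (Ψ w).toReal := by
    intro w hw hwt
    have : Ψ z ≤ Ψ w := hmin (by simpa [dist_eq_norm] using hw)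
    exact EReal.toReal_le_toReal this (h.ne_bot z) hwt
  have hc : 0 ≤ (Ψ x₀).toReal - (Ψ z).toReal := by
    have := hle x₀ (by simp) hx₀
    linarith
  refine ⟨(Ψ x₀).toReal - (Ψ z).toReal, hc, fun w hw => ?_⟩
  by_cases hN : ‖w - x₀‖ ≤ 1
  · have := hle w hN hw
    have := mul_nonneg hc (norm_nonneg (w - x₀))
    linarith
  · push Not at hN
    set N := ‖w - x₀‖ with hNdef
    have hN0 : 0 < N := by linarith
    have hN1 : N⁻¹ ≤ 1 := inv_le_one_of_one_le₀ hN.le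
    have hcv := h.convexOn.2 hx₀ hw (sub_nonneg.2 hN1) (inv_nonneg.2 hN0.le) (by ring)
    have hmem := h.convexOn.1 hx₀ hw (sub_nonneg.2 hN1) (inv_nonneg.2 hN0.le) (by ring)
    have hdist : ‖(1 - N⁻¹) • x₀ + N⁻¹ • w - x₀‖ ≤ 1 := by
      have : (1 - N⁻¹) • x₀ + N⁻¹ • w - x₀ = N⁻¹ • (w - x₀) := by module
      rw [this, norm_smul, Real.norm_of_nonneg (inv_nonneg.2 hN0.le), ← hNdef,
        inv_mul_cancel₀ hN0.ne']
    have h3 := (hle _ hdist hmem).trans hcv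
    simp only [smul_eq_mul] at h3
    have h4 := mul_le_mul_of_nonneg_left h3 hN0.le
    have h5 : N * ((1 - N⁻¹) * (Ψ x₀).toReal + N⁻¹ * (Ψ w).toReal)
        = (N - 1) * (Ψ x₀).toReal + (Ψ w).toReal := by
      field_simp
    rw [h5] at h4
    linarith

theorem lowerSemicontinuous_proxObj (h : ClosedProperConvex Ψ) (γ : ℝ) (x : Vec d) :
    LowerSemicontinuous (proxObj Ψ γ x) := by
  have h1 : Continuous fun y : Vec d => ((1 / (2 * γ) * ‖y - x‖ ^ 2 : ℝ) : EReal) :=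
    continuous_coe_real_ereal.comp (by fun_prop)
  refine h1.lowerSemicontinuous.add' h.closed fun y => ?_
  exact EReal.continuousAt_add (Or.inl (EReal.coe_ne_top _)) (Or.inl (EReal.coe_ne_bot _))

/-- Outside a large ball the quadratic term dominates the linear lower bound on Ψ, so a minimizer
over that compact ball is a global one. -/
theorem exists_isMin_proxObj (h : ClosedProperConvex Ψ) {γ : ℝ} (hγ : 0 < γ) (x : Vec d) :
    ∃ y, ∀ w, proxObj Ψ γ x y ≤ proxObj Ψ γ x w := by
  obtain ⟨x₀, hx₀, c, hc, hlow⟩ := h.exists_lower_bound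
  set g := 1 / (2 * γ) with hg
  have hg0 : 0 < g := by positivity
  set k := ‖x₀ - x‖ with hk
  -- The radius is such that N ≥ R gives N ≥ 1 and g/2 * N ≥ 2c + 2gk². Then (g/2 * N - c) * N ≥ c +
  -- 2gk², which is the comparison of w with x₀.
  set R := 1 + 2 * (2 * c + 2 * g * k ^ 2) / g with hR
  have hR0 : 1 ≤ R := by
    have : 0 ≤ 2 * (2 * c + 2 * g * k ^ 2) / g := by positivity
    linarith
  obtain ⟨y, -, hy⟩ := LowerSemicontinuousOn.exists_isMinOn (s := Metric.closedBall x₀ R)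
    ⟨x₀, by simp; linarith⟩ (isCompact_closedBall x₀ R)
    ((h.lowerSemicontinuous_proxObj γ x).lowerSemicontinuousOn _)
  refine ⟨y, fun w => ?_⟩
  by_cases hw : ‖w - x₀‖ ≤ R
  · exact hy (by simpa [dist_eq_norm] using hw)
  push Not at hw
  refine (hy (show x₀ ∈ Metric.closedBall x₀ R by simp; linarith)).trans ?_
  show ((g * ‖x₀ - x‖ ^ 2 : ℝ) : EReal) + Ψ x₀ ≤ ((g * ‖w - x‖ ^ 2 : ℝ) : EReal) + Ψ w
  by_cases hwt : Ψ w = ⊤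
  · rw [hwt, EReal.coe_add_top]; exact le_top
  rw [← h.coe_toReal hx₀, ← h.coe_toReal hwt, ← EReal.coe_add, ← EReal.coe_add,
    EReal.coe_le_coe_iff, ← hk]
  have h1 := hlow w hwt
  set N := ‖w - x₀‖ with hN
  have h2 : N ≤ ‖w - x‖ + k := by
    have : w - x₀ = (w - x) - (x₀ - x) := by abel
    rw [hN, this]; exact norm_sub_le _ _
  have h3 : N ^ 2 / 2 - k ^ 2 ≤ ‖w - x‖ ^ 2 := by
    nlinarith [sq_nonneg (‖w - x‖ - k), norm_nonneg (x₀ - x), norm_nonneg (w - x₀),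
      norm_nonneg (w - x)]
  have h4 : g * (N ^ 2 / 2 - k ^ 2) ≤ g * ‖w - x‖ ^ 2 := by gcongr
  have h5 : 2 * c + 2 * g * k ^ 2 ≤ g / 2 * N := by
    have : g / 2 * R = g / 2 + (2 * c + 2 * g * k ^ 2) := by rw [hR]; field_simp
    have : g / 2 * R ≤ g / 2 * N := by gcongr
    linarith
  have h6 : (c + 2 * g * k ^ 2) * 1 ≤ (g / 2 * N - c) * N := by
    apply mul_le_mul <;> nlinarith [mul_nonneg hg0.le (sq_nonneg k)]
  nlinarith

theorem prox_spec (h : ClosedProperConvex Ψ) {γ : ℝ} (hγ : 0 < γ) (x w : Vec d) :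
    proxObj Ψ γ x (prox Ψ γ x) ≤ proxObj Ψ γ x w :=
  Classical.epsilon_spec (h.exists_isMin_proxObj hγ x) w

theorem prox_ne_top (h : ClosedProperConvex Ψ) {γ : ℝ} (hγ : 0 < γ) (x : Vec d) :
    Ψ (prox Ψ γ x) ≠ ⊤ := by
  obtain ⟨x₀, hx₀⟩ := h.proper
  intro htop
  have h1 := h.prox_spec hγ x x₀
  rw [proxObj, proxObj, htop, EReal.coe_add_top, ← h.coe_toReal hx₀, ← EReal.coe_add] at h1
  exact EReal.coe_ne_top _ (top_le_iff.1 h1)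

theorem prox_spec_real (h : ClosedProperConvex Ψ) {γ : ℝ} (hγ : 0 < γ) (x : Vec d) {w : Vec d}
    (hw : Ψ w ≠ ⊤) :
    1 / (2 * γ) * ‖prox Ψ γ x - x‖ ^ 2 + (Ψ (prox Ψ γ x)).toReal
      ≤ 1 / (2 * γ) * ‖w - x‖ ^ 2 + (Ψ w).toReal := by
  have h1 := h.prox_spec hγ x w
  rwa [proxObj, proxObj, ← h.coe_toReal hw, ← h.coe_toReal (h.prox_ne_top hγ x),
    ← EReal.coe_add, ← EReal.coe_add, EReal.coe_le_coe_iff] at h1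

/-- The variational inequality that characterizes the proximal point. -/
theorem prox_variational (h : ClosedProperConvex Ψ) {γ : ℝ} (hγ : 0 < γ) (x : Vec d) {w : Vec d}
    (hw : Ψ w ≠ ⊤) :
    (Ψ (prox Ψ γ x)).toReal + γ⁻¹ * inner ℝ (x - prox Ψ γ x) (w - prox Ψ γ x)
      ≤ (Ψ w).toReal := by
  set y := prox Ψ γ x with hy
  have hyt : Ψ y ≠ ⊤ := h.prox_ne_top hγ x
  set A := (Ψ w).toReal - (Ψ y).toReal - γ⁻¹ * inner ℝ (x - y) (w - y) with hA
  set B := 1 / (2 * γ) * ‖w - y‖ ^ 2 with hB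
  have hB0 : 0 ≤ B := by positivity
  -- Minimality of y against the point (1 - t)y + tw of the segment, divided by t. The claim 0 ≤ A
  -- is the limit t → 0.
  have key : ∀ t : ℝ, 0 < t → t ≤ 1 → 0 ≤ A + t * B := by
    intro t ht ht1
    have h1 := h.prox_spec_real hγ x (h.convexOn.1 hyt hw (sub_nonneg.2 ht1) ht.le (by ring))
    have h2 := h.convexOn.2 hyt hw (sub_nonneg.2 ht1) ht.le (by ring)
    rw [← hy] at h1
    have h3 : (1 - t) • y + t • w - x = (y - x) + t • (w - y) := by module
    have h4 : inner ℝ (y - x) (w - y) = - inner ℝ (x - y) (w - y) := by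
      rw [← inner_neg_left]; congr 1; abel
    have h5 : ‖(1 - t) • y + t • w - x‖ ^ 2
        = ‖y - x‖ ^ 2 - 2 * t * inner ℝ (x - y) (w - y) + t ^ 2 * ‖w - y‖ ^ 2 := by
      rw [h3, norm_add_sq_real, inner_smul_right, norm_smul, h4, mul_pow, Real.norm_eq_abs, sq_abs]
      ring
    rw [h5] at h1
    simp only [smul_eq_mul] at h2
    have h6 : 0 ≤ t * (A + t * B) := by
      have : t * (A + t * B) = (1 / (2 * γ) * (‖y - x‖ ^ 2 - 2 * t * inner ℝ (x - y) (w - y)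
          + t ^ 2 * ‖w - y‖ ^ 2) + ((1 - t) * (Ψ y).toReal + t * (Ψ w).toReal))
          - (1 / (2 * γ) * ‖y - x‖ ^ 2 + (Ψ y).toReal) := by
        rw [hA, hB]; field_simp; ring
      rw [this]; linarith
    exact nonneg_of_mul_nonneg_right h6 ht
  have hA0 : 0 ≤ A := by
    by_contra hneg
    push Not at hneg
    -- For A < 0 this t makes tB ≤ -A/2, hence A + tB ≤ A/2 < 0.
    have h1 := key (min 1 (-A / (2 * (B + 1)))) (lt_min one_pos (by apply div_pos <;> linarith))
      (min_le_left _ _)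
    have h2 : min 1 (-A / (2 * (B + 1))) * B ≤ (-A / (2 * (B + 1))) * B :=
      mul_le_mul_of_nonneg_right (min_le_right _ _) hB0
    have h3 : (-A / (2 * (B + 1))) * B ≤ -A / 2 := by
      rw [div_mul_eq_mul_div, div_le_div_iff₀ (by linarith) (by norm_num)]
      nlinarith
    linarith
  rw [hA] at hA0
  linarith

/-- The two variational inequalities, each tested at the other proximal point, add up to ‖y - y'‖² ≤
⟨x - x', y - y'⟩. Cauchy–Schwarz finishes. -/
theorem norm_prox_sub_prox_le (h : ClosedProperConvex Ψ) {γ : ℝ} (hγ : 0 < γ) (x x' : Vec d) :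
    ‖prox Ψ γ x - prox Ψ γ x'‖ ≤ ‖x - x'‖ := by
  have h1 := h.prox_variational hγ x (h.prox_ne_top hγ x')
  have h2 := h.prox_variational hγ x' (h.prox_ne_top hγ x)
  set y := prox Ψ γ x
  set y' := prox Ψ γ x'
  have h3 : γ⁻¹ * (inner ℝ (x - y) (y' - y) + inner ℝ (x' - y') (y - y')) ≤ 0 := by linarith
  have h4 : inner ℝ (x - y) (y' - y) + inner ℝ (x' - y') (y - y')
      = ‖y - y'‖ ^ 2 - inner ℝ (x - x') (y - y') := by
    rw [← real_inner_self_eq_norm_sq]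
    simp only [inner_sub_left, inner_sub_right, real_inner_comm]
    ring
  have h5 : ‖y - y'‖ ^ 2 - inner ℝ (x - x') (y - y') ≤ 0 := by
    rw [← h4]
    have := inv_pos.2 hγ
    by_contra hcon
    push Not at hcon
    have := mul_pos this hcon
    linarith
  have h6 := real_inner_le_norm (x - x') (y - y')
  by_contra hcon
  push Not at hcon
  nlinarith [norm_nonneg (x - x'), norm_nonneg (y - y')]

theorem lipschitz_prox (h : ClosedProperConvex Ψ) {γ : ℝ} (hγ : 0 < γ) :
    LipschitzWith 1 (prox Ψ γ) :=
  LipschitzWith.of_dist_le_mul fun x x' => by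
    simpa [dist_eq_norm] using h.norm_prox_sub_prox_le hγ x x'

end ClosedProperConvex

/-! ### The descent lemma -/

/-- Along the segment from x to y, the difference between f and its quadratic upper model has
nonpositive derivative. -/
theorem le_of_lipschitzWith_gradient {E : Type*} [NormedAddCommGroup E] [InnerProductSpace ℝ E]
    [CompleteSpace E] {f : E → ℝ} {L : NNReal} (hf : Differentiable ℝ f)
    (hL : LipschitzWith L (gradient f)) (x y : E) :
    f y ≤ f x + inner ℝ (gradient f x) (y - x) + L / 2 * ‖y - x‖ ^ 2 := by
  set v := y - x with hv
  let φ : ℝ → ℝ := fun t => f (x + t • v) - t * inner ℝ (gradient f x) v - L / 2 * t ^ 2 * ‖v‖ ^ 2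
  have hφ : ∀ t : ℝ, HasDerivAt φ (inner ℝ (gradient f (x + t • v)) v
      - inner ℝ (gradient f x) v - L * t * ‖v‖ ^ 2) t := by
    intro t
    have h1 : HasDerivAt (fun t : ℝ => x + t • v) v t := by
      simpa using ((hasDerivAt_id t).smul_const v).const_add x
    have h2 : HasDerivAt (fun t : ℝ => f (x + t • v)) (inner ℝ (gradient f (x + t • v)) v) t := by
      refine ((hf (x + t • v)).hasGradientAt.hasFDerivAt.comp_hasDerivAt t h1).congr_deriv ?_
      simp
    have h3 := (hasDerivAt_id t).mul_const (inner ℝ (gradient f x) v)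
    have h4 := (((hasDerivAt_id t).pow 2).const_mul ((L : ℝ) / 2)).mul_const (‖v‖ ^ 2)
    refine ((h2.sub h3).sub h4).congr_deriv ?_
    simp only [id, one_mul, mul_one, Nat.cast_ofNat, Nat.add_one_sub_one, pow_one]
    ring
  have hanti : AntitoneOn φ (Set.Icc 0 1) := by
    refine antitoneOn_of_deriv_nonpos (convex_Icc 0 1)
      (fun t _ => (hφ t).continuousAt.continuousWithinAt)
      (fun t _ => (hφ t).differentiableAt.differentiableWithinAt) ?_
    intro t ht
    rw [interior_Icc] at ht
    rw [(hφ t).deriv, ← inner_sub_left]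
    have h1 := real_inner_le_norm (gradient f (x + t • v) - gradient f x) v
    have h2 := hL.dist_le_mul (x + t • v) x
    rw [dist_eq_norm, dist_eq_norm, add_sub_cancel_left, norm_smul, Real.norm_of_nonneg ht.1.le]
      at h2
    have h3 := mul_le_mul_of_nonneg_right h2 (norm_nonneg v)
    nlinarith
  have h01 := hanti (Set.left_mem_Icc.2 zero_le_one) (Set.right_mem_Icc.2 zero_le_one) zero_le_one
  simp only [φ, hv] at h01
  simp only [one_smul, zero_smul, add_zero, add_sub_cancel] at h01
  rw [← hv] at h01
  linarith

/-! ### Averages and deviations from the average -/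

section Deviation

variable {n d : ℕ}

/-- The squared distance of `X` from the consensus subspace. -/
noncomputable def dev (X : Fin n → Vec d) : ℝ := ∑ i, ‖X i - avg X‖ ^ 2

theorem dev_nonneg (X : Fin n → Vec d) : 0 ≤ dev X := Finset.sum_nonneg fun _ _ => sq_nonneg _

theorem card_smul_avg (hn : 1 ≤ n) (X : Fin n → Vec d) : (n : ℝ) • avg X = ∑ i, X i := by
  have : (n : ℝ) ≠ 0 := by positivity
  rw [avg, smul_smul, mul_inv_cancel₀ this, one_smul]

theorem avg_add (X Y : Fin n → Vec d) : avg (X + Y) = avg X + avg Y := by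
  simp [avg, Finset.sum_add_distrib]

theorem avg_sub (X Y : Fin n → Vec d) : avg (X - Y) = avg X - avg Y := by
  simp [avg, Finset.sum_sub_distrib, smul_sub]

theorem avg_smul (c : ℝ) (X : Fin n → Vec d) : avg (c • X) = c • avg X := by
  simp only [avg, Pi.smul_apply, ← Finset.smul_sum]
  rw [smul_comm]

theorem avg_const (hn : 1 ≤ n) (c : Vec d) : avg (fun _ : Fin n => c) = c := by
  have : (n : ℝ) ≠ 0 := by positivity
  simp only [avg, Finset.sum_const, Finset.card_univ, Fintype.card_fin]
  rw [← Nat.cast_smul_eq_nsmul ℝ, smul_smul, inv_mul_cancel₀ this, one_smul]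

theorem sum_sub_avg (hn : 1 ≤ n) (X : Fin n → Vec d) : ∑ i, (X i - avg X) = 0 := by
  rw [Finset.sum_sub_distrib, ← card_smul_avg hn]
  simp only [Finset.sum_const, Finset.card_univ, Fintype.card_fin]
  rw [← Nat.cast_smul_eq_nsmul ℝ, sub_self]

theorem inner_avg (c : Vec d) (X : Fin n → Vec d) :
    inner ℝ c (avg X) = (n : ℝ)⁻¹ * ∑ i, inner ℝ c (X i) := by
  rw [avg, inner_smul_right, inner_sum]

/-- The average minimizes the sum of squared distances, so any convenient centre c may be used to
bound `dev`. -/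
theorem dev_le_sum (hn : 1 ≤ n) (X : Fin n → Vec d) (c : Vec d) :
    dev X ≤ ∑ i, ‖X i - c‖ ^ 2 := by
  have h : ∀ i, ‖X i - c‖ ^ 2
      = ‖X i - avg X‖ ^ 2 + 2 * inner ℝ (avg X - c) (X i - avg X) + ‖avg X - c‖ ^ 2 := by
    intro i
    have : X i - c = (X i - avg X) + (avg X - c) := by abel
    rw [this, norm_add_sq_real, real_inner_comm]
  simp only [h, Finset.sum_add_distrib, ← Finset.mul_sum, ← inner_sum, sum_sub_avg hn,
    inner_zero_right]
  have : 0 ≤ ∑ _i : Fin n, ‖avg X - c‖ ^ 2 := Finset.sum_nonneg fun _ _ => sq_nonneg _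
  simp only [dev]
  linarith

theorem norm_avg_sq_le (X : Fin n → Vec d) :
    ‖avg X‖ ^ 2 ≤ (n : ℝ)⁻¹ * ∑ i, ‖X i‖ ^ 2 := by
  rcases Nat.eq_zero_or_pos n with rfl | hn
  · simp [avg]
  have hn' : (0 : ℝ) < n := by positivity
  have h1 : ‖∑ i, X i‖ ^ 2 ≤ (n : ℝ) * ∑ i, ‖X i‖ ^ 2 := by
    have h2 : ‖∑ i, X i‖ ^ 2 ≤ (∑ i, ‖X i‖) ^ 2 := by
      gcongr; exact norm_sum_le _ _
    have h3 := sq_sum_le_card_mul_sum_sq (s := (Finset.univ : Finset (Fin n)))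
      (f := fun i => ‖X i‖)
    simp only [Finset.card_univ, Fintype.card_fin] at h3
    exact h2.trans h3
  rw [avg, norm_smul, mul_pow, norm_inv, Real.norm_natCast]
  calc ((n : ℝ)⁻¹) ^ 2 * ‖∑ i, X i‖ ^ 2 ≤ ((n : ℝ)⁻¹) ^ 2 * ((n : ℝ) * ∑ i, ‖X i‖ ^ 2) := by gcongr
    _ = _ := by field_simp

/-- Young's inequality with a free weight. The choice t = 1 - δ/2 later spends half of a spectral
gap δ on absorbing a perturbation. -/
theorem norm_add_sq_le_div {E : Type*} [NormedAddCommGroup E] [InnerProductSpace ℝ E] (a b : E)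
    {t : ℝ} (h0 : 0 < t) (h1 : t < 1) :
    ‖a + b‖ ^ 2 ≤ ‖a‖ ^ 2 / t + ‖b‖ ^ 2 / (1 - t) := by
  have h2 : 0 < 1 - t := by linarith
  have h3 : ‖a + b‖ ^ 2 ≤ (‖a‖ + ‖b‖) ^ 2 := by
    gcongr; exact norm_add_le a b
  refine h3.trans ?_
  rw [div_add_div _ _ h0.ne' h2.ne', le_div_iff₀ (mul_pos h0 h2)]
  nlinarith [sq_nonneg ((1 - t) * ‖a‖ - t * ‖b‖)]

theorem norm_add_sq_le_two {E : Type*} [NormedAddCommGroup E] [InnerProductSpace ℝ E] (a b : E) :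
    ‖a + b‖ ^ 2 ≤ 2 * ‖a‖ ^ 2 + 2 * ‖b‖ ^ 2 := by
  have := norm_add_sq_le_div a b (t := 1 / 2) (by norm_num) (by norm_num)
  norm_num at this
  linarith

theorem norm_sub_sq_le_two {E : Type*} [NormedAddCommGroup E] [InnerProductSpace ℝ E] (a b : E) :
    ‖a - b‖ ^ 2 ≤ 2 * ‖a‖ ^ 2 + 2 * ‖b‖ ^ 2 := by
  have := norm_add_sq_le_two a (-b)
  rwa [norm_neg, ← sub_eq_add_neg] at this

theorem norm_add_sq_le_three {E : Type*} [NormedAddCommGroup E] [InnerProductSpace ℝ E]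
    (a b c : E) : ‖a + b + c‖ ^ 2 ≤ 3 * ‖a‖ ^ 2 + 3 * ‖b‖ ^ 2 + 3 * ‖c‖ ^ 2 := by
  have h3 : ‖a + b + c‖ ^ 2 ≤ (‖a‖ + ‖b‖ + ‖c‖) ^ 2 := by
    gcongr; exact norm_add₃_le
  nlinarith [sq_nonneg (‖a‖ - ‖b‖), sq_nonneg (‖a‖ - ‖c‖), sq_nonneg (‖b‖ - ‖c‖)]

theorem dev_add_le (X Y : Fin n → Vec d) {t : ℝ} (h0 : 0 < t) (h1 : t < 1) :
    dev (X + Y) ≤ dev X / t + dev Y / (1 - t) := by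
  simp only [dev, Finset.sum_div, ← Finset.sum_add_distrib]
  refine Finset.sum_le_sum fun i _ => ?_
  have : (X + Y) i - avg (X + Y) = (X i - avg X) + (Y i - avg Y) := by
    rw [avg_add, Pi.add_apply]; abel
  rw [this]
  exact norm_add_sq_le_div _ _ h0 h1

theorem dev_sub_le_two (X Y : Fin n → Vec d) : dev (X - Y) ≤ 2 * dev X + 2 * dev Y := by
  simp only [dev, Finset.mul_sum, ← Finset.sum_add_distrib]
  refine Finset.sum_le_sum fun i _ => ?_
  have : (X - Y) i - avg (X - Y) = (X i - avg X) - (Y i - avg Y) := by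
    rw [avg_sub, Pi.sub_apply]; abel
  rw [this]
  exact norm_sub_sq_le_two _ _

theorem dev_smul (c : ℝ) (X : Fin n → Vec d) : dev (c • X) = c ^ 2 * dev X := by
  simp only [dev, Finset.mul_sum]
  refine Finset.sum_congr rfl fun i _ => ?_
  rw [avg_smul, Pi.smul_apply, ← smul_sub, norm_smul, mul_pow, Real.norm_eq_abs, sq_abs]

theorem dev_zero : dev (0 : Fin n → Vec d) = 0 := by simp [dev, avg]

end Deviation

/-! ### Mixing -/

section Mixing

variable {n d : ℕ} {W : Matrix (Fin n) (Fin n) ℝ}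

theorem mix_one (X : Fin n → Vec d) : mix 1 X = X := by
  ext1 i
  simp [mix, Matrix.one_apply]

theorem mix_mul (A B : Matrix (Fin n) (Fin n) ℝ) (X : Fin n → Vec d) :
    mix (A * B) X = mix B (mix A X) := by
  ext1 i
  simp only [mix, Matrix.mul_apply, Finset.sum_smul, Finset.smul_sum, smul_smul]
  rw [Finset.sum_comm]
  simp only [mul_comm]

namespace IsGossip

theorem rho_nonneg (W : Matrix (Fin n) (Fin n) ℝ) : 0 ≤ rho W := by
  unfold rho
  split_ifs
  · exact le_max_of_le_left (abs_nonneg _)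
  · exact le_rfl

theorem apply_comm (h : IsGossip W) (i j : Fin n) : W i j = W j i := h.symm.apply j i

theorem isHermitian (h : IsGossip W) : W.IsHermitian := by
  rw [Matrix.IsHermitian, Matrix.conjTranspose_eq_transpose_of_trivial]
  exact h.symm

/-- `W` contracts the orthogonal complement of the constant vectors by the factor `ρ`. -/
theorem norm_le_rho_mul (h : IsGossip W) (f : EuclideanSpace ℝ (Fin n)) (hf : ∑ i, f i = 0) :
    ‖Matrix.toEuclideanLin W f‖ ^ 2 ≤ rho W ^ 2 * ‖f‖ ^ 2 := by
  have hA := h.isHermitian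
  set T := Matrix.toEuclideanLin W with hT
  have hsymm : T.IsSymmetric := Matrix.isSymmetric_toEuclideanLin_iff.mpr hA
  set b := hA.eigenvectorBasis with hb
  have hTb : ∀ j, T (b j) = hA.eigenvalues j • b j := by
    intro j
    have := hA.mulVec_eigenvectorBasis j
    ext i
    simpa [hT, Matrix.toLpLin_apply] using congrFun this i
  have hinner : ∀ j g, inner ℝ (b j) (T g) = hA.eigenvalues j * inner ℝ (b j) g := by
    intro j g
    rw [← hsymm, hTb, inner_smul_left]; simp
  -- In the eigenbasis it suffices that each direction either has an eigenvalue of modulus at most ρ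
  -- or is orthogonal to f. An exceptional j must be the top index 0 of the sorted eigenvalues.
  have hterm : ∀ j, (hA.eigenvalues j) ^ 2 ≤ rho W ^ 2 ∨ inner ℝ (b j) f = 0 := by
    intro j
    by_cases hj : |hA.eigenvalues j| ≤ rho W
    · left; exact sq_le_sq' (by linarith [neg_abs_le (hA.eigenvalues j)])
        ((le_abs_self _).trans hj)
    right
    by_cases hn : 2 ≤ n
    · have hle : ∀ k : Fin (Fintype.card (Fin n)), 1 ≤ k.val →
          |hA.eigenvalues₀ k| ≤ rho W := by
        intro k hk
        have hk2 : k.val < n := by have := k.2; simpa using this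
        rw [rho, dif_pos ⟨hA, hn⟩]
        have h1 : hA.eigenvalues₀ k ≤ hA.eigenvalues₀ ⟨1, by simp; omega⟩ :=
          hA.eigenvalues₀_antitone (by rw [Fin.le_def]; exact hk)
        have h2 : hA.eigenvalues₀ ⟨n - 1, by simp; omega⟩ ≤ hA.eigenvalues₀ k :=
          hA.eigenvalues₀_antitone (by rw [Fin.le_def]; simp; omega)
        rw [abs_le]
        constructor
        · have := (neg_abs_le (hA.eigenvalues₀ ⟨n - 1, by simp; omega⟩))
          have h3 := le_max_right |hA.eigenvalues₀ ⟨1, by simp; omega⟩|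
            |hA.eigenvalues₀ ⟨n - 1, by simp; omega⟩|
          linarith
        · have := (le_abs_self (hA.eigenvalues₀ ⟨1, by simp; omega⟩))
          have h3 := le_max_left |hA.eigenvalues₀ ⟨1, by simp; omega⟩|
            |hA.eigenvalues₀ ⟨n - 1, by simp; omega⟩|
          linarith
      set e := (Fintype.equivOfCardEq (Fintype.card_fin (Fintype.card (Fin n)))).symm with he
      have hj0 : (e j).val = 0 := by
        by_contra hne
        exact hj (hle (e j) (by omega))
      -- The remaining eigenvalues have modulus at most ρ < 1. The vector of ones is fixed by W,
      -- hence orthogonal to their eigenvectors and a multiple of `b j`. Since f has zero sum, it is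
      -- orthogonal to `b j`.
      have hother : ∀ i, i ≠ j → hA.eigenvalues i ≠ 1 := by
        intro i hij h1
        have hi : 1 ≤ (e i).val := by
          by_contra hlt
          apply hij
          apply e.injective
          rw [Fin.ext_iff, hj0]; omega
        have h2 := hle (e i) hi
        have h3 : hA.eigenvalues₀ (e i) = 1 := h1
        rw [h3, abs_one] at h2
        linarith [h.rho_lt_one]
      set o : EuclideanSpace ℝ (Fin n) := WithLp.toLp 2 (fun _ => 1) with ho
      have hTo : T o = o := by
        ext i
        simp [hT, ho, Matrix.toLpLin_apply, Matrix.mulVec, dotProduct, h.row_sum]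
      have hbo : ∀ i, i ≠ j → inner ℝ (b i) o = 0 := by
        intro i hij
        have h1 := hinner i o
        rw [hTo] at h1
        have h2 : (hA.eigenvalues i - 1) * inner ℝ (b i) o = 0 := by linarith
        rcases mul_eq_zero.1 h2 with h3 | h3
        · exact absurd (by linarith) (hother i hij)
        · exact h3
      have hoj : o = inner ℝ (b j) o • b j := by
        conv_lhs => rw [← b.sum_repr' o]
        rw [Finset.sum_eq_single j]
        · intro i _ hij
          rw [hbo i hij, zero_smul]
        · simp
      have hof : inner ℝ o f = 0 := by
        simp [ho, PiLp.inner_apply, hf]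
      rw [hoj, inner_smul_left] at hof
      rcases mul_eq_zero.1 hof with h3 | h3
      · exfalso
        have h4 : inner ℝ (b j) o = 0 := by simpa using h3
        rw [h4, zero_smul] at hoj
        have := congrFun (congrArg WithLp.ofLp hoj) j
        simp [ho] at this
      · exact h3
    · have hsub : Subsingleton (Fin n) := by
        rw [Fin.subsingleton_iff_le_one]; omega
      have : f = 0 := by
        ext i
        have h1 : ∑ k, f k = f i := Finset.sum_eq_single i
          (fun k _ hk => absurd (Subsingleton.elim k i) hk) (by simp)
        rw [hf] at h1
        simpa using h1.symm
      rw [this, inner_zero_right]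
  rw [← b.sum_sq_norm_inner_right (T f), ← b.sum_sq_norm_inner_right f, Finset.mul_sum]
  refine Finset.sum_le_sum fun j _ => ?_
  rw [hinner, norm_mul, mul_pow, Real.norm_eq_abs, sq_abs]
  rcases hterm j with h1 | h1
  · gcongr
  · simp [h1]

theorem avg_mix (h : IsGossip W) (X : Fin n → Vec d) : avg (mix W X) = avg X := by
  simp only [avg, mix]
  rw [Finset.sum_comm]
  simp only [← Finset.sum_smul, h.row_sum, one_smul]

/-- The scalar contraction is applied to each of the d coordinates of the centred family, which has
zero sum. -/
theorem dev_mix_le_one (h : IsGossip W) (hn : 1 ≤ n) (X : Fin n → Vec d) :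
    dev (mix W X) ≤ rho W ^ 2 * dev X := by
  let Y : Fin n → Vec d := fun i => X i - avg X
  have h1 : ∀ i, mix W X i - avg (mix W X) = mix W Y i := by
    intro i
    rw [h.avg_mix]
    simp only [mix, Y, smul_sub, Finset.sum_sub_distrib, ← Finset.sum_smul]
    congr 1
    simp only [h.apply_comm _ i, h.row_sum, one_smul]
  have h2 : ∀ i c, (mix W Y i) c = (Matrix.toEuclideanLin W (WithLp.toLp 2 fun j => Y j c)) i := by
    intro i c
    simp [mix, Matrix.toLpLin_apply, Matrix.mulVec, dotProduct, h.apply_comm i]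
  have h3 : ∀ c, ∑ i, (mix W Y i c) ^ 2 ≤ rho W ^ 2 * ∑ i, (Y i c) ^ 2 := by
    intro c
    have h4 := h.norm_le_rho_mul (WithLp.toLp 2 fun j => Y j c) (by
      have := congrArg (fun v : Vec d => v c) (sum_sub_avg hn X)
      simpa [Y] using this)
    rw [EuclideanSpace.norm_sq_eq, EuclideanSpace.norm_sq_eq] at h4
    simp only [Real.norm_eq_abs, sq_abs, ← h2] at h4
    exact h4
  simp only [dev, h1]
  change ∑ i, ‖mix W Y i‖ ^ 2 ≤ rho W ^ 2 * ∑ i, ‖Y i‖ ^ 2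
  simp only [EuclideanSpace.norm_sq_eq, Real.norm_eq_abs, sq_abs]
  rw [Finset.sum_comm, Finset.sum_comm (γ := Fin n) (f := fun i c => (Y i c) ^ 2), Finset.mul_sum]
  exact Finset.sum_le_sum fun c _ => h3 c

theorem avg_mix_pow (h : IsGossip W) (m : ℕ) (X : Fin n → Vec d) : avg (mix (W ^ m) X) = avg X := by
  induction m with
  | zero => rw [pow_zero, mix_one]
  | succ k ih => rw [pow_succ, mix_mul, h.avg_mix, ih]

theorem dev_mix_pow_le (h : IsGossip W) (hn : 1 ≤ n) (m : ℕ) (X : Fin n → Vec d) :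
    dev (mix (W ^ m) X) ≤ rho W ^ (2 * m) * dev X := by
  induction m with
  | zero => simp [mix_one]
  | succ k ih =>
    rw [pow_succ, mix_mul]
    refine (h.dev_mix_le_one hn _).trans ?_
    calc rho W ^ 2 * dev (mix (W ^ k) X) ≤ rho W ^ 2 * (rho W ^ (2 * k) * dev X) := by gcongr
      _ = _ := by ring

/-- The spectral gap in terms of `ϱ(m)`. -/
theorem rho_pow_le (h : IsGossip W) {m : ℕ} (hm : 1 ≤ m) :
    0 ≤ varrho (rho W) m ∧
      rho W ^ (2 * m) ≤ 1 - 1 / (2 * (1 + varrho (rho W) m)) := by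
  have h0 := rho_nonneg W
  have h1 : rho W ^ (2 * m) < 1 := pow_lt_one₀ h0 h.rho_lt_one (by omega)
  have h2 : 0 ≤ rho W ^ (2 * m) := by positivity
  rw [varrho]
  set r := rho W ^ (2 * m)
  have h3 : 0 < 1 - r := by linarith
  have h4 : 0 ≤ (1 + r) * r / (1 - r) ^ 2 := by positivity
  refine ⟨h4, ?_⟩
  -- After clearing denominators this is 1 - r ≤ 2(1 - r + 2r²), that is, 0 ≤ 1 - r + 4r².
  have h5 : 1 / (2 * (1 + (1 + r) * r / (1 - r) ^ 2)) ≤ 1 - r := by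
    rw [div_le_iff₀ (by positivity)]
    have h6 : (1 - r) * (2 * (1 + (1 + r) * r / (1 - r) ^ 2))
        = 2 * ((1 - r) ^ 2 + (1 + r) * r) / (1 - r) := by field_simp
    rw [h6, le_div_iff₀ h3]
    nlinarith
  linarith

end IsGossip

end Mixing

/-! ### The stochastic gradient noise -/

section Noise

theorem integrable_inner_of_memLp {Ω : Type*} [MeasurableSpace Ω] {μ : Measure Ω} {E : Type*}
    [NormedAddCommGroup E] [InnerProductSpace ℝ E] {f g : Ω → E} (hf : MemLp f 2 μ)
    (hg : MemLp g 2 μ) : Integrable (fun ω => inner ℝ (f ω) (g ω)) μ := by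
  have h1 := hf.norm.integrable_sq.add hg.norm.integrable_sq
  refine h1.mono' (hf.1.inner hg.1) (Filter.Eventually.of_forall fun ω => ?_)
  have h2 := norm_inner_le_norm (𝕜 := ℝ) (f ω) (g ω)
  simp only [Pi.add_apply]
  nlinarith [sq_nonneg (‖f ω‖ - ‖g ω‖), norm_nonneg (f ω), norm_nonneg (g ω)]

variable {n d : ℕ} {S : Type*} [MeasurableSpace S] {Ω : Type*} [mΩ : MeasurableSpace Ω]

/-- The error of the stochastic gradient of agent `i`. -/
@[irreducible] noncomputable def Problem.noise (P : Problem n d S) (i : Fin n) (x : Vec d) (s : S) : Vec d :=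
  P.stochGrad i x s - gradient (P.locF i) x

theorem Problem.noise_eq (P : Problem n d S) (i : Fin n) (x : Vec d) (s : S) :
    P.noise i x s = P.stochGrad i x s - gradient (P.locF i) x := by
  rw [Problem.noise]

variable {P : Problem n d S} {L : NNReal} {σs : Fin n → ℝ} {μ : Measure Ω} {ξ : ℕ → Fin n → Ω → S}

theorem Problem.Smooth.continuous_gradient (hS : P.Smooth L) (i : Fin n) :
    Continuous (gradient (P.locF i)) := (hS.lipschitz i).continuous

omit mΩ in
theorem Problem.Smooth.measurable_noise (hS : P.Smooth L) (hR : P.Regular) (i : Fin n)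
    {_ : MeasurableSpace Ω} {x : Ω → Vec d} {s : Ω → S} (hx : Measurable x) (hs : Measurable s) :
    Measurable (fun ω => P.noise i (x ω) (s ω)) := by
  simp only [Problem.noise_eq]
  exact ((hR.measurable i).comp (hx.prodMk hs)).sub ((hS.continuous_gradient i).measurable.comp hx)

omit mΩ in
theorem sampleFiltration_mono (ξ : ℕ → Fin n → Ω → S) {k l : ℕ} (h : k ≤ l) :
    sampleFiltration ξ k ≤ sampleFiltration ξ l := by
  refine iSup₂_le fun t ht => ?_
  rw [Finset.mem_Icc] at ht
  exact le_iSup₂_of_le t (Finset.mem_Icc.2 ⟨ht.1, ht.2.trans h⟩) le_rfl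

omit mΩ in
theorem measurable_sample (ξ : ℕ → Fin n → Ω → S) (k : ℕ) (i : Fin n) :
    Measurable[sampleFiltration ξ (k + 1)] (ξ (k + 1) i) := by
  rw [measurable_iff_comap_le]
  exact le_iSup₂_of_le (k + 1) (Finset.mem_Icc.2 ⟨by omega, le_rfl⟩)
    (le_iSup (fun i => sampleAlg ξ (k + 1) i) i)

namespace Oracle

theorem sampleFiltration_le (h : Oracle P σs μ ξ) (k : ℕ) : sampleFiltration ξ k ≤ mΩ :=
  iSup₂_le fun t _ => iSup_le fun i => (h.measurable t i).comap_le

theorem sampleAlg_le (h : Oracle P σs μ ξ) (k : ℕ) (i : Fin n) : sampleAlg ξ k i ≤ mΩ :=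
  (h.measurable k i).comap_le

theorem memLp_noise (h : Oracle P σs μ ξ) (hS : P.Smooth L) (hR : P.Regular) (k : ℕ) (i : Fin n)
    {x : Ω → Vec d} (hx : Measurable[sampleFiltration ξ k] x) :
    MemLp (fun ω => P.noise i (x ω) (ξ (k + 1) i ω)) 2 μ := by
  have hx' : Measurable x := hx.mono (h.sampleFiltration_le k) le_rfl
  refine (memLp_two_iff_integrable_sq_norm ?_).2
    (by simpa only [Problem.noise_eq] using (h.variance k i x hx).1)
  exact (hS.measurable_noise hR i hx' (h.measurable (k + 1) i)).aestronglyMeasurable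

theorem integral_noise_sq_le [IsProbabilityMeasure μ] (h : Oracle P σs μ ξ) (k : ℕ) (i : Fin n)
    {x : Ω → Vec d} (hx : Measurable[sampleFiltration ξ k] x) :
    ∫ ω, ‖P.noise i (x ω) (ξ (k + 1) i ω)‖ ^ 2 ∂μ ≤ σs i ^ 2 := by
  have h1 := (h.variance k i x hx).2
  have h2 := integral_condExp (h.sampleFiltration_le k) (μ := μ) (f := fun ω =>
    ‖P.stochGrad i (x ω) (ξ (k + 1) i ω) - gradient (P.locF i) (x ω)‖ ^ 2)
  simp only [Problem.noise_eq]
  rw [← h2]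
  refine (integral_mono_ae integrable_condExp (integrable_const _) h1).trans ?_
  simp

theorem integrable_noise [IsProbabilityMeasure μ] (h : Oracle P σs μ ξ) (hS : P.Smooth L) (hR : P.Regular) (i : Fin n)
    (x : Vec d) : Integrable (fun s => P.noise i x s) (P.D i) := by
  have h1 := (h.memLp_noise hS hR 0 i (x := fun _ => x) measurable_const).integrable one_le_two
  rw [← h.law 0 i]
  refine (integrable_map_measure ?_ (h.measurable 1 i).aemeasurable).2 h1
  exact (hS.measurable_noise hR i measurable_const measurable_id).aestronglyMeasurable

/-- Conditional unbiasedness at a deterministic point at time 0 is integrated, and the law of the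
sample carries it over to `P.D i`. -/
theorem integral_noise [IsProbabilityMeasure μ] (h : Oracle P σs μ ξ) (hS : P.Smooth L) (hR : P.Regular) (i : Fin n)
    (x : Vec d) : ∫ s, P.noise i x s ∂(P.D i) = 0 := by
  have h1 := (h.memLp_noise hS hR 0 i (x := fun _ => x) measurable_const).integrable one_le_two
  have h2 : Integrable (fun ω => P.stochGrad i x (ξ 1 i ω)) μ := by
    have := h1.add (integrable_const (gradient (P.locF i) x))
    refine this.congr (Filter.Eventually.of_forall fun ω => ?_)
    simp [Problem.noise_eq]
  have h3 := h.unbiased 0 i (fun _ => x) measurable_const h2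
  have h4 := integral_condExp (h.sampleFiltration_le 0) (μ := μ)
    (f := fun ω => P.stochGrad i x (ξ 1 i ω))
  have h5 := integral_congr_ae h3
  rw [zero_add, h4] at h5
  have hmeas : Measurable fun s => P.noise i x s :=
    hS.measurable_noise hR i measurable_const measurable_id
  rw [← h.law 0 i, zero_add, integral_map (h.measurable 1 i).aemeasurable
    hmeas.aestronglyMeasurable]
  have h6 := integral_sub h2 (integrable_const (gradient (P.locF i) x))
  simp only [Problem.noise_eq]
  rw [h6, h5]
  simp

/-- The noise is orthogonal to everything that is independent of the sample. -/
theorem integral_inner_noise [IsProbabilityMeasure μ] (h : Oracle P σs μ ξ) (hS : P.Smooth L) (hR : P.Regular) (k : ℕ)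
    (i : Fin n) {x c : Ω → Vec d} (hx : Measurable x) (hc : Measurable c)
    (hIF : IndepFun (fun ω => (x ω, c ω)) (ξ (k + 1) i) μ)
    (hint : Integrable (fun ω => inner ℝ (c ω) (P.noise i (x ω) (ξ (k + 1) i ω))) μ) :
    ∫ ω, inner ℝ (c ω) (P.noise i (x ω) (ξ (k + 1) i ω)) ∂μ = 0 := by
  have := hR.prob i
  let Y : Ω → Vec d × Vec d := fun ω => (x ω, c ω)
  have hY : Measurable Y := hx.prodMk hc
  -- The joint law of (x, c) and the sample is a product, so by Fubini the sample is integrated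
  -- first, with x and c frozen. This also covers vectors c that depend on other agents' samples of
  -- the same time, where conditioning on ℱ_k would not suffice.
  have hmap := (indepFun_iff_map_prod_eq_prod_map_map hY.aemeasurable
    (h.measurable (k + 1) i).aemeasurable).1 (show IndepFun Y _ μ from hIF)
  rw [h.law k i] at hmap
  let Φ : (Vec d × Vec d) × S → ℝ := fun p => inner ℝ p.1.2 (P.noise i p.1.1 p.2)
  have hΦ : Measurable Φ := by
    have h1 : Measurable fun p : (Vec d × Vec d) × S => p.1.2 :=
      measurable_snd.comp measurable_fst
    have h2 : Measurable fun p : (Vec d × Vec d) × S => P.noise i p.1.1 p.2 :=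
      hS.measurable_noise hR i (measurable_fst.comp measurable_fst) measurable_snd
    exact h1.inner h2
  have hpair : Measurable fun ω => (Y ω, ξ (k + 1) i ω) := hY.prodMk (h.measurable (k + 1) i)
  have h1 : ∫ ω, inner ℝ (c ω) (P.noise i (x ω) (ξ (k + 1) i ω)) ∂μ
      = ∫ p, Φ p ∂((μ.map Y).prod (P.D i)) := by
    rw [← hmap, integral_map hpair.aemeasurable hΦ.aestronglyMeasurable]
  have h2 : Integrable Φ ((μ.map Y).prod (P.D i)) := by
    rw [← hmap]
    exact (integrable_map_measure hΦ.aestronglyMeasurable hpair.aemeasurable).2 hint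
  have := Measure.isProbabilityMeasure_map (μ := μ) hY.aemeasurable
  rw [h1, integral_prod _ h2]
  have h3 : ∀ y : Vec d × Vec d, ∫ s, Φ (y, s) ∂(P.D i) = 0 := by
    intro y
    simp only [Φ]
    rw [integral_inner (h.integrable_noise hS hR i y.1), h.integral_noise hS hR, inner_zero_right]
  simp [h3]

/-- The averaged noise of time `k + 1` at the points `x`. -/
theorem integral_inner_avg_noise [IsProbabilityMeasure μ] (h : Oracle P σs μ ξ) (hS : P.Smooth L) (hR : P.Regular) (k : ℕ)
    {x : Ω → Fin n → Vec d} (hx : ∀ i, Measurable[sampleFiltration ξ k] fun ω => x ω i)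
    {c : Ω → Vec d} (hc : Measurable[sampleFiltration ξ k] c) (hc2 : MemLp c 2 μ) :
    Integrable (fun ω => inner ℝ (c ω) (avg fun i => P.noise i (x ω i) (ξ (k + 1) i ω))) μ ∧
    ∫ ω, inner ℝ (c ω) (avg fun i => P.noise i (x ω i) (ξ (k + 1) i ω)) ∂μ = 0 := by
  have h1 : ∀ i, Integrable (fun ω => inner ℝ (c ω) (P.noise i (x ω i) (ξ (k + 1) i ω))) μ :=
    fun i => integrable_inner_of_memLp hc2 (h.memLp_noise hS hR k i (hx i))
  simp only [inner_avg]
  refine ⟨(integrable_finsetSum _ fun i _ => h1 i).const_mul _, ?_⟩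
  rw [integral_const_mul, integral_finsetSum _ fun i _ => h1 i]
  rw [Finset.sum_eq_zero, mul_zero]
  intro i _
  refine h.integral_inner_noise hS hR k i ((hx i).mono (h.sampleFiltration_le k) le_rfl)
    (hc.mono (h.sampleFiltration_le k) le_rfl) ?_ (h1 i)
  rw [IndepFun_iff_Indep]
  exact indep_of_indep_of_le_left (h.indep_past k i).symm
    (measurable_iff_comap_le.1 ((hx i).prodMk hc))

/-- In the expanded square the cross terms vanish: the noise of agent i is measurable for ℱ_k joined
with the sample of i, and the sample of j is independent of both together. Only the diagonal
remains, which yields the factor 1/n. -/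
theorem integral_avg_noise_sq_le [IsProbabilityMeasure μ] (h : Oracle P σs μ ξ) (hS : P.Smooth L) (hR : P.Regular) (k : ℕ)
    {σ : ℝ} (hσ : (n : ℝ)⁻¹ * ∑ i, σs i ^ 2 ≤ σ ^ 2)
    {x : Ω → Fin n → Vec d} (hx : ∀ i, Measurable[sampleFiltration ξ k] fun ω => x ω i) :
    ∫ ω, ‖avg fun i => P.noise i (x ω i) (ξ (k + 1) i ω)‖ ^ 2 ∂μ ≤ σ ^ 2 / n := by
  let N : Fin n → Ω → Vec d := fun i ω => P.noise i (x ω i) (ξ (k + 1) i ω)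
  have hN : ∀ i, MemLp (N i) 2 μ := fun i => h.memLp_noise hS hR k i (hx i)
  have h1 : ∀ i j, Integrable (fun ω => inner ℝ (N i ω) (N j ω)) μ :=
    fun i j => integrable_inner_of_memLp (hN i) (hN j)
  have h2 : ∀ i j, i ≠ j → ∫ ω, inner ℝ (N i ω) (N j ω) ∂μ = 0 := by
    intro i j hij
    have hm1 : ∀ i', Measurable[sampleFiltration ξ k ⊔ sampleAlg ξ (k + 1) i] fun ω => x ω i' :=
      fun i' => (hx i').mono le_sup_left le_rfl
    have hm2 : Measurable[sampleFiltration ξ k ⊔ sampleAlg ξ (k + 1) i] (ξ (k + 1) i) :=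
      (comap_measurable (ξ (k + 1) i)).mono le_sup_right le_rfl
    have hm3 : Measurable[sampleFiltration ξ k ⊔ sampleAlg ξ (k + 1) i] (N i) :=
      hS.measurable_noise hR i (hm1 i) hm2
    have hle := sup_le (h.sampleFiltration_le k) (h.sampleAlg_le (k + 1) i)
    refine h.integral_inner_noise hS hR k j ((hm1 j).mono hle le_rfl)
      (hm3.mono hle le_rfl) ?_ (h1 i j)
    rw [IndepFun_iff_Indep]
    exact indep_of_indep_of_le_left (h.indep_agents k j i hij.symm).symm
      (measurable_iff_comap_le.1 ((hm1 j).prodMk hm3))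
  have h3 : ∀ i, ∫ ω, inner ℝ (N i ω) (N i ω) ∂μ ≤ σs i ^ 2 := by
    intro i
    simp only [real_inner_self_eq_norm_sq]
    exact h.integral_noise_sq_le k i (hx i)
  have h4 : ∀ ω, ‖avg fun i => N i ω‖ ^ 2
      = ((n : ℝ)⁻¹) ^ 2 * ∑ i, ∑ j, inner ℝ (N i ω) (N j ω) := by
    intro ω
    rw [avg, norm_smul, mul_pow, Real.norm_eq_abs, sq_abs, ← real_inner_self_eq_norm_sq, sum_inner]
    simp only [inner_sum]
  change ∫ ω, ‖avg fun i => N i ω‖ ^ 2 ∂μ ≤ _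
  simp only [h4]
  rw [integral_const_mul, integral_finsetSum _ fun i _ => integrable_finsetSum _ fun j _ => h1 i j]
  have h5 : ∀ i, ∫ ω, ∑ j, inner ℝ (N i ω) (N j ω) ∂μ ≤ σs i ^ 2 := by
    intro i
    rw [integral_finsetSum _ fun j _ => h1 i j, Finset.sum_eq_single i]
    · exact h3 i
    · exact fun j _ hj => h2 i j hj.symm
    · simp
  calc ((n : ℝ)⁻¹) ^ 2 * ∑ i, ∫ ω, ∑ j, inner ℝ (N i ω) (N j ω) ∂μ
      ≤ ((n : ℝ)⁻¹) ^ 2 * ∑ i, σs i ^ 2 := by gcongr with i; exact h5 i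
    _ = ((n : ℝ)⁻¹ * ∑ i, σs i ^ 2) * (n : ℝ)⁻¹ := by ring
    _ ≤ σ ^ 2 * (n : ℝ)⁻¹ := by gcongr
    _ = σ ^ 2 / n := by rw [div_eq_mul_inv]

end Oracle

end Noise

/-! ### The averaged objective -/

section Objective

variable {n d : ℕ} {S : Type*} [MeasurableSpace S] {P : Problem n d S} {L : NNReal}

namespace Problem.Smooth

theorem hasGradientAt_F (hS : P.Smooth L) (x : Vec d) :
    HasGradientAt P.F (avg fun i => gradient (P.locF i) x) x := by
  have h1 : HasFDerivAt P.F ((n : ℝ)⁻¹ • ∑ i, fderiv ℝ (P.locF i) x) x :=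
    (HasFDerivAt.fun_sum fun i _ => (hS.differentiable i x).hasFDerivAt).const_mul _
  have h2 := h1.hasGradientAt
  convert h2 using 1
  simp only [avg, map_smul, map_sum]
  simp [gradient]

theorem gradient_F (hS : P.Smooth L) (x : Vec d) :
    gradient P.F x = avg fun i => gradient (P.locF i) x := (hS.hasGradientAt_F x).gradient

theorem differentiable_F (hS : P.Smooth L) : Differentiable ℝ P.F :=
  fun x => (hS.hasGradientAt_F x).differentiableAt

theorem norm_gradient_sub_le (hS : P.Smooth L) (i : Fin n) (x y : Vec d) :
    ‖gradient (P.locF i) x - gradient (P.locF i) y‖ ≤ L * ‖x - y‖ := by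
  simpa [dist_eq_norm] using (hS.lipschitz i).dist_le_mul x y

theorem norm_gradient_sub_sq_le (hS : P.Smooth L) (i : Fin n) (x y : Vec d) :
    ‖gradient (P.locF i) x - gradient (P.locF i) y‖ ^ 2 ≤ L ^ 2 * ‖x - y‖ ^ 2 := by
  rw [← mul_pow]
  gcongr
  exact hS.norm_gradient_sub_le i x y

/-- The average of the local gradients at the local points is close to the gradient. -/
theorem norm_avg_gradient_sub_sq_le (hS : P.Smooth L) (X : Fin n → Vec d) (x : Vec d) :
    ‖(avg fun i => gradient (P.locF i) (X i)) - gradient P.F x‖ ^ 2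
      ≤ L ^ 2 * ((n : ℝ)⁻¹ * ∑ i, ‖X i - x‖ ^ 2) := by
  rw [hS.gradient_F, ← avg_sub]
  refine (norm_avg_sq_le _).trans ?_
  have h := Finset.sum_le_sum fun i (_ : i ∈ Finset.univ) => hS.norm_gradient_sub_sq_le i (X i) x
  rw [← Finset.mul_sum] at h
  rw [mul_left_comm]
  gcongr
  exact h

theorem lipschitz_F (hS : P.Smooth L) : LipschitzWith L (gradient P.F) := by
  refine LipschitzWith.of_dist_le_mul fun x y => ?_
  rw [dist_eq_norm, dist_eq_norm]
  rcases Nat.eq_zero_or_pos n with rfl | hn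
  · rw [hS.gradient_F, hS.gradient_F]; simp [avg]; positivity
  have h1 := hS.norm_avg_gradient_sub_sq_le (fun _ => x) y
  rw [← hS.gradient_F] at h1
  have h2 : (n : ℝ)⁻¹ * ∑ _i : Fin n, ‖x - y‖ ^ 2 = ‖x - y‖ ^ 2 := by
    have : (n : ℝ) ≠ 0 := by positivity
    simp [this]
  rw [h2, ← mul_pow] at h1
  exact le_of_sq_le_sq h1 (by positivity)

theorem norm_gradient_F_sub_le (hS : P.Smooth L) (x y : Vec d) :
    ‖gradient P.F x - gradient P.F y‖ ≤ L * ‖x - y‖ := by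
  simpa [dist_eq_norm] using hS.lipschitz_F.dist_le_mul x y

end Problem.Smooth

end Objective

/-! ### The Lyapunov function -/

section Lyapunov

variable {d : ℕ} {Ψ : Vec d → EReal}

/-- The value of the proximal subproblem `min_y ⟨z, y - x⟩ + ‖y - x‖² / (2γ) + Ψ(y)`. -/
noncomputable def subValue (Ψ : Vec d → EReal) (γ : ℝ) (x z : Vec d) : ℝ :=
  inner ℝ z (prox Ψ γ (x - γ • z) - x) + γ⁻¹ / 2 * ‖prox Ψ γ (x - γ • z) - x‖ ^ 2
    + (Ψ (prox Ψ γ (x - γ • z))).toReal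

theorem inner_le_young {E : Type*} [NormedAddCommGroup E] [InnerProductSpace ℝ E] (a b : E)
    {c : ℝ} (hc : 0 < c) : |inner ℝ a b| ≤ c * ‖a‖ ^ 2 + (4 * c)⁻¹ * ‖b‖ ^ 2 := by
  refine (abs_real_inner_le_norm a b).trans ?_
  have h1 : c * ‖a‖ ^ 2 + (4 * c)⁻¹ * ‖b‖ ^ 2 - ‖a‖ * ‖b‖ = c * (‖a‖ - (2 * c)⁻¹ * ‖b‖) ^ 2 := by
    field_simp; ring
  have h2 : 0 ≤ c * (‖a‖ - (2 * c)⁻¹ * ‖b‖) ^ 2 := by positivity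
  linarith

namespace ClosedProperConvex

/-- In effect y = x is tried in the subproblem. This keeps Ψ - η nonnegative in the Lyapunov
function. -/
theorem subValue_le (h : ClosedProperConvex Ψ) {γ : ℝ} (hγ : 0 < γ) (x z : Vec d)
    (hx : Ψ x ≠ ⊤) : subValue Ψ γ x z ≤ (Ψ x).toReal := by
  have h1 := h.prox_variational hγ (x - γ • z) hx
  rw [subValue]
  set y := prox Ψ γ (x - γ • z)
  have h2 : γ⁻¹ * inner ℝ (x - γ • z - y) (x - y)
      = inner ℝ z (y - x) + γ⁻¹ * ‖y - x‖ ^ 2 := by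
    have h3 : x - γ • z - y = -(y - x) - γ • z := by abel
    have h4 : x - y = -(y - x) := by abel
    rw [h3, h4, inner_sub_left, inner_neg_neg, inner_neg_right, inner_smul_left,
      real_inner_self_eq_norm_sq]
    simp
    field_simp
    ring
  rw [h2] at h1
  have : 0 ≤ γ⁻¹ / 2 * ‖y - x‖ ^ 2 := by positivity
  linarith

/-- A first-order lower bound, obtained from the variational inequality at the old proximal point
tested at the new one. The product of Δz with η - Δx is absorbed by the quadratic γ⁻¹/2 * ‖η - Δx‖²,
so only ‖Δz‖² is lost and no term in ‖Δx‖² appears. A lower bound suffices because the subproblem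
value enters the Lyapunov function with a minus sign. -/
theorem subValue_step (h : ClosedProperConvex Ψ) {γ : ℝ} (hγ : 0 < γ) (x z x' z' : Vec d) :
    subValue Ψ γ x z - inner ℝ (z + γ⁻¹ • (prox Ψ γ (x - γ • z) - x)) (x' - x)
      + inner ℝ (prox Ψ γ (x - γ • z) - x) (z' - z) - γ / 2 * ‖z' - z‖ ^ 2
      ≤ subValue Ψ γ x' z' := by
  have h1 := h.prox_variational hγ (x - γ • z) (h.prox_ne_top hγ (x' - γ • z'))
  rw [subValue, subValue]
  set y := prox Ψ γ (x - γ • z)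
  set y' := prox Ψ γ (x' - γ • z')
  set p := y - x with hp
  set η := y' - y with hη
  set Δx := x' - x with hΔx
  set Δz := z' - z with hΔz
  have e1 : y' - x' = p + (η - Δx) := by rw [hp, hη, hΔx]; abel
  have e2 : z' = z + Δz := by rw [hΔz]; abel
  have e3 : x - γ • z - y = -p - γ • z := by rw [hp]; abel
  have h2 : γ⁻¹ * inner ℝ (x - γ • z - y) η = - γ⁻¹ * inner ℝ p η - inner ℝ z η := by
    rw [e3, inner_sub_left, inner_neg_left, inner_smul_left]
    simp
    field_simp
  rw [h2] at h1
  have h3 := inner_le_young Δz (η - Δx) (c := γ / 2) (by positivity)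
  have h4 := neg_abs_le (inner ℝ Δz (η - Δx))
  have h5 : (4 * (γ / 2))⁻¹ = γ⁻¹ / 2 := by field_simp; norm_num
  rw [h5] at h3
  rw [e1, e2, norm_add_sq_real]
  simp only [inner_add_left, inner_add_right, inner_sub_right, inner_smul_left] at h4 ⊢
  rw [real_inner_comm Δz p]
  simp only [inner_sub_right] at h3
  simp
  linarith

end ClosedProperConvex

end Lyapunov

/-! ### Averaged proximal steps against the proximal step at the averages -/

section Step

variable {n d : ℕ} {S : Type*} [MeasurableSpace S] {P : Problem n d S} {L : NNReal}

/-- The proximal steps of the agents. -/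
noncomputable def proxStep (Ψ : Vec d → EReal) (γ : ℝ) (X Z : Fin n → Vec d) : Fin n → Vec d :=
  fun i => prox Ψ γ (X i - γ • Z i)

/-- The proximal step at the averages, minus the average. -/
noncomputable def avgStep (Ψ : Vec d → EReal) (γ : ℝ) (X Z : Fin n → Vec d) : Vec d :=
  prox Ψ γ (avg X - γ • avg Z) - avg X

theorem ClosedProperConvex.sum_norm_proxStep_sub_le {Ψ : Vec d → EReal} (h : ClosedProperConvex Ψ)
    {γ : ℝ} (hγ : 0 < γ) (X Z : Fin n → Vec d) :
    ∑ i, ‖proxStep Ψ γ X Z i - (avg X + avgStep Ψ γ X Z)‖ ^ 2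
      ≤ 2 * dev X + 2 * γ ^ 2 * dev Z := by
  simp only [dev, Finset.mul_sum, ← Finset.sum_add_distrib]
  refine Finset.sum_le_sum fun i _ => ?_
  have h1 : proxStep Ψ γ X Z i - (avg X + avgStep Ψ γ X Z)
      = prox Ψ γ (X i - γ • Z i) - prox Ψ γ (avg X - γ • avg Z) := by
    rw [proxStep, avgStep]; abel_nf
  rw [h1]
  have h2 := h.norm_prox_sub_prox_le hγ (X i - γ • Z i) (avg X - γ • avg Z)
  have h3 : X i - γ • Z i - (avg X - γ • avg Z) = (X i - avg X) - γ • (Z i - avg Z) := by module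
  rw [h3] at h2
  calc _ ≤ ‖(X i - avg X) - γ • (Z i - avg Z)‖ ^ 2 := by gcongr
    _ ≤ 2 * ‖X i - avg X‖ ^ 2 + 2 * ‖γ • (Z i - avg Z)‖ ^ 2 := norm_sub_sq_le_two _ _
    _ = _ := by rw [norm_smul, mul_pow, Real.norm_eq_abs, sq_abs]; ring

theorem ClosedProperConvex.avg_mem {Ψ : Vec d → EReal} (h : ClosedProperConvex Ψ) (hn : 1 ≤ n)
    {Y : Fin n → Vec d} (hY : ∀ i, Ψ (Y i) ≠ ⊤) :
    Ψ (avg Y) ≠ ⊤ ∧ (Ψ (avg Y)).toReal ≤ (n : ℝ)⁻¹ * ∑ i, (Ψ (Y i)).toReal := by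
  have hn' : (n : ℝ) ≠ 0 := by positivity
  have h1 : avg Y = ∑ i, (n : ℝ)⁻¹ • Y i := by rw [avg, Finset.smul_sum]
  have hs : ∑ _i : Fin n, (n : ℝ)⁻¹ = 1 := by simp [hn']
  rw [h1]
  refine ⟨h.convexOn.1.sum_mem (fun _ _ => by positivity) hs fun i _ => hY i, ?_⟩
  have := h.convexOn.map_sum_le (t := Finset.univ) (w := fun _ : Fin n => (n : ℝ)⁻¹) (p := Y)
    (fun _ _ => by positivity) hs fun i _ => hY i
  simpa [Finset.mul_sum] using this

/-- Decrease of the regularizer in one averaged step. -/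
theorem ClosedProperConvex.avg_step_le {Ψ : Vec d → EReal} (h : ClosedProperConvex Ψ) (hn : 1 ≤ n)
    {γ : ℝ} (hγ : 0 < γ) (X Z : Fin n → Vec d) (hX : Ψ (avg X) ≠ ⊤) {α : ℝ} (hα : 0 ≤ α)
    (hα1 : α ≤ 1) {x' p q : Vec d} (hx' : x' = (1 - α) • avg X + α • avg (proxStep Ψ γ X Z))
    (hp : p = avgStep Ψ γ X Z) (hq : q = avg (proxStep Ψ γ X Z) - (avg X + p)) :
    Ψ x' ≠ ⊤ ∧ (Ψ x').toReal ≤ (Ψ (avg X)).toReal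
      - α * (inner ℝ (avg Z + γ⁻¹ • p) (p + q) + γ⁻¹ * inner ℝ p q)
      + α * ((n : ℝ)⁻¹ * (6 * γ⁻¹ * dev X + 6 * γ * dev Z)) := by
  have hY : ∀ i, Ψ (proxStep Ψ γ X Z i) ≠ ⊤ := fun i => h.prox_ne_top hγ _
  obtain ⟨hm, hJ⟩ := h.avg_mem hn hY
  have hn' : (0 : ℝ) < n := by positivity
  refine ⟨hx' ▸ h.convexOn.1 hX hm (sub_nonneg.2 hα1) hα (by ring), ?_⟩
  have hc := h.convexOn.2 hX hm (sub_nonneg.2 hα1) hα (by ring)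
  rw [← hx'] at hc
  simp only [smul_eq_mul] at hc
  set x := avg X with hx
  set z := avg Z with hz
  let Q : Fin n → Vec d := fun i => proxStep Ψ γ X Z i - (x + p)
  let χ : Fin n → Vec d := fun i => X i - x
  let ζ : Fin n → Vec d := fun i => Z i - z
  let s : Fin n → Vec d := fun i => ζ i + γ⁻¹ • Q i - γ⁻¹ • χ i
  have hQ : avg Q = q := by
    have : Q = proxStep Ψ γ X Z - fun _ => (x + p) := rfl
    rw [this, avg_sub, avg_const hn, hq]
  have hsumχ : ∑ i, χ i = 0 := sum_sub_avg hn X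
  have hsumζ : ∑ i, ζ i = 0 := sum_sub_avg hn Z
  have hsumQ : ∑ i, Q i = (n : ℝ) • q := by rw [← hQ, card_smul_avg hn]
  have hsums : ∑ i, s i = (n : ℝ) • γ⁻¹ • q := by
    simp only [s, Finset.sum_sub_distrib, Finset.sum_add_distrib, ← Finset.smul_sum, hsumχ, hsumζ,
      hsumQ]
    rw [zero_add, smul_zero, sub_zero, smul_comm]
  -- The variational inequality of agent i tested at the average x. The proximal point is x + p + Q
  -- i and its scaled residual is -(z + γ⁻¹p + s i). The centred parts of s i sum to zero, so in the
  -- average only γ⁻¹q survives of it.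
  have hVI : ∀ i, (Ψ (proxStep Ψ γ X Z i)).toReal ≤ (Ψ x).toReal
      - (inner ℝ (z + γ⁻¹ • p) (p + Q i) + inner ℝ p (s i) + inner ℝ (s i) (Q i)) := by
    intro i
    have h1 := h.prox_variational hγ (X i - γ • Z i) hX
    change (Ψ (proxStep Ψ γ X Z i)).toReal + γ⁻¹ * inner ℝ (X i - γ • Z i - proxStep Ψ γ X Z i)
      (x - proxStep Ψ γ X Z i) ≤ _ at h1
    have e1 : x - proxStep Ψ γ X Z i = -(p + Q i) := by simp only [Q]; abel
    have e2 : γ⁻¹ • (X i - γ • Z i - proxStep Ψ γ X Z i) = -(z + γ⁻¹ • p + s i) := by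
      have : γ⁻¹ • γ • Z i = Z i := by rw [smul_smul, inv_mul_cancel₀ hγ.ne', one_smul]
      simp only [s, Q, χ, ζ, smul_sub, smul_add, this]
      abel
    have e3 : γ⁻¹ * inner ℝ (X i - γ • Z i - proxStep Ψ γ X Z i) (x - proxStep Ψ γ X Z i)
        = inner ℝ (z + γ⁻¹ • p) (p + Q i) + inner ℝ p (s i) + inner ℝ (s i) (Q i) := by
      have := inner_smul_left (𝕜 := ℝ) (X i - γ • Z i - proxStep Ψ γ X Z i)
        (x - proxStep Ψ γ X Z i) γ⁻¹
      rw [show (starRingEnd ℝ) γ⁻¹ = γ⁻¹ by simp] at this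
      rw [← this, e1, e2, inner_neg_neg, inner_add_left (z + γ⁻¹ • p), inner_add_right (s i),
        real_inner_comm p (s i)]
      ring
    linarith
  have hsum := Finset.sum_le_sum fun i (_ : i ∈ Finset.univ) => hVI i
  simp only [Finset.sum_sub_distrib, Finset.sum_add_distrib, inner_add_right _ p, ← inner_sum,
    hsums, hsumQ, Finset.sum_const, Finset.card_univ, Fintype.card_fin, nsmul_eq_mul,
    inner_smul_right] at hsum
  rw [← Nat.cast_smul_eq_nsmul ℝ, inner_smul_right] at hsum
  -- Both factors are deviations from the averages, so their products are of second order and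
  -- bounded by the consensus errors.
  have hcross : -(∑ i, inner ℝ (s i) (Q i)) ≤ 6 * γ⁻¹ * dev X + 6 * γ * dev Z := by
    have h1 : ∀ i, -(inner ℝ (s i) (Q i)) ≤ γ / 2 * (3 * ‖ζ i‖ ^ 2 + 3 * (γ⁻¹ ^ 2 * ‖Q i‖ ^ 2)
        + 3 * (γ⁻¹ ^ 2 * ‖χ i‖ ^ 2)) + γ⁻¹ / 2 * ‖Q i‖ ^ 2 := by
      intro i
      have h2 := inner_le_young (s i) (Q i) (c := γ / 2) (by positivity)
      have h5 : (4 * (γ / 2))⁻¹ = γ⁻¹ / 2 := by field_simp; norm_num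
      rw [h5] at h2
      have h3 := norm_add_sq_le_three (ζ i) (γ⁻¹ • Q i) (-(γ⁻¹ • χ i))
      rw [← sub_eq_add_neg, norm_neg, norm_smul, norm_smul, mul_pow, mul_pow, Real.norm_eq_abs,
        sq_abs] at h3
      have h4 : γ / 2 * ‖s i‖ ^ 2 ≤ γ / 2 * (3 * ‖ζ i‖ ^ 2 + 3 * (γ⁻¹ ^ 2 * ‖Q i‖ ^ 2)
        + 3 * (γ⁻¹ ^ 2 * ‖χ i‖ ^ 2)) := by gcongr
      have := neg_le_abs (inner ℝ (s i) (Q i))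
      linarith
    have h2 := Finset.sum_le_sum fun i (_ : i ∈ Finset.univ) => h1 i
    have hS := h.sum_norm_proxStep_sub_le hγ X Z
    rw [← hp] at hS
    simp only [Finset.sum_neg_distrib, Finset.sum_add_distrib, ← Finset.mul_sum] at h2
    have h6 : ∑ i, ‖χ i‖ ^ 2 = dev X := rfl
    have h7 : ∑ i, ‖ζ i‖ ^ 2 = dev Z := rfl
    have h8 : ∑ i, ‖Q i‖ ^ 2 ≤ 2 * dev X + 2 * γ ^ 2 * dev Z := hS
    rw [h6, h7] at h2
    refine h2.trans ?_
    have h9 : γ / 2 * (3 * dev Z + 3 * (γ⁻¹ ^ 2 * ∑ i, ‖Q i‖ ^ 2) + 3 * (γ⁻¹ ^ 2 * dev X))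
        + γ⁻¹ / 2 * ∑ i, ‖Q i‖ ^ 2
        = 3 / 2 * γ * dev Z + 2 * γ⁻¹ * ∑ i, ‖Q i‖ ^ 2 + 3 / 2 * γ⁻¹ * dev X := by
      field_simp; ring
    have h10 : 2 * γ⁻¹ * ∑ i, ‖Q i‖ ^ 2 ≤ 2 * γ⁻¹ * (2 * dev X + 2 * γ ^ 2 * dev Z) := by gcongr
    have h11 : 2 * γ⁻¹ * (2 * dev X + 2 * γ ^ 2 * dev Z) = 4 * γ⁻¹ * dev X + 4 * γ * dev Z := by
      field_simp; ring
    have h12 : 0 ≤ γ⁻¹ * dev X := mul_nonneg (by positivity) (dev_nonneg X)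
    have h13 : 0 ≤ γ * dev Z := mul_nonneg (by positivity) (dev_nonneg Z)
    rw [h9]
    linarith
  have hfin : (n : ℝ)⁻¹ * ∑ i, (Ψ (proxStep Ψ γ X Z i)).toReal ≤ (Ψ x).toReal
      - (inner ℝ (z + γ⁻¹ • p) (p + q) + γ⁻¹ * inner ℝ p q)
      + (n : ℝ)⁻¹ * (6 * γ⁻¹ * dev X + 6 * γ * dev Z) := by
    have h1 := mul_le_mul_of_nonneg_left (hsum.trans (le_of_eq rfl)) (inv_nonneg.2 hn'.le)
    have h2 := mul_le_mul_of_nonneg_left hcross (inv_nonneg.2 hn'.le)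
    rw [inner_add_right]
    have h3 : (n : ℝ)⁻¹ * n = 1 := inv_mul_cancel₀ hn'.ne'
    simp only [mul_sub, mul_add, ← mul_assoc, h3, one_mul] at h1 h2 ⊢
    linarith
  have := mul_le_mul_of_nonneg_left (hJ.trans hfin) hα
  linarith

end Step

/-! ### Decrease of the Lyapunov function in one step -/

section LyapunovStep

variable {n d : ℕ} {S : Type*} [MeasurableSpace S] {P : Problem n d S} {L : NNReal}

/-- The Lyapunov function of the averaged iteration. -/
noncomputable def lyapunov (P : Problem n d S) (γ lam : ℝ) (x z : Vec d) : ℝ :=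
  P.F x + 2 * (P.Ψ x).toReal - subValue P.Ψ γ x z + lam * ‖z - gradient P.F x‖ ^ 2

/-- The average of the local gradients at the local points. -/
noncomputable def Problem.avgGrad (P : Problem n d S) (X : Fin n → Vec d) : Vec d :=
  avg fun i => gradient (P.locF i) (X i)

/-- The average of the next primal variables. -/
noncomputable def nextAvg (Ψ : Vec d → EReal) (γ α : ℝ) (X Z : Fin n → Vec d) : Vec d :=
  (1 - α) • avg X + α • avg (proxStep Ψ γ X Z)

/-- The predictable vector that multiplies the noise in the Lyapunov inequality. -/
noncomputable def noiseCoef (P : Problem n d S) (γ lam α : ℝ) (X Z : Fin n → Vec d) : Vec d :=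
  (γ * α ^ 2) • (P.avgGrad X - avg Z) - α • avgStep P.Ψ γ X Z
    + (2 * lam * α) • ((1 - α) • (avg Z - gradient P.F (avg X))
      + α • (P.avgGrad X - gradient P.F (avg X))
      + (gradient P.F (avg X) - gradient P.F (nextAvg P.Ψ γ α X Z)))

/-- The weight of the consensus error in the Lyapunov inequality. -/
noncomputable def consensusWeight (L γ lam : ℝ) : ℝ :=
  2 * (1 + γ ^ 2) * (lam⁻¹ + 19 * γ⁻¹) + 3 * γ * L ^ 2 + 12 * γ⁻¹ + 12 * γ + 3 * lam * L ^ 2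

theorem norm_convex_sq_le {E : Type*} [NormedAddCommGroup E] [InnerProductSpace ℝ E] (a b : E)
    {t : ℝ} (h0 : 0 ≤ t) (h1 : t ≤ 1) :
    ‖(1 - t) • a + t • b‖ ^ 2 ≤ (1 - t) * ‖a‖ ^ 2 + t * ‖b‖ ^ 2 := by
  have h2 : (1 - t) * ‖a‖ ^ 2 + t * ‖b‖ ^ 2 - ‖(1 - t) • a + t • b‖ ^ 2
      = t * (1 - t) * ‖a - b‖ ^ 2 := by
    rw [norm_add_sq_real, norm_sub_sq_real, norm_smul, norm_smul, inner_smul_left,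
      inner_smul_right, mul_pow, mul_pow, Real.norm_eq_abs, Real.norm_eq_abs, sq_abs, sq_abs]
    simp
    ring
  have h3 : 0 ≤ t * (1 - t) * ‖a - b‖ ^ 2 :=
    mul_nonneg (mul_nonneg h0 (sub_nonneg.2 h1)) (sq_nonneg _)
  linarith

theorem lyapunov_step (hS : P.Smooth L) (hΨ : ClosedProperConvex P.Ψ) (hn : 1 ≤ n) (hL : 0 < L)
    {γ lam α : ℝ} (hγ : 0 < γ) (hlam : lam = γ⁻¹ / (32 * L ^ 2)) (hα : 0 < α) (hα1 : α ≤ 1)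
    (hα2 : 8 * L * α ≤ γ⁻¹) (hα3 : 4 * γ * α ≤ lam) (X Z : Fin n → Vec d)
    (hX : P.Ψ (avg X) ≠ ⊤) {x' z' δ : Vec d} (hx' : x' = nextAvg P.Ψ γ α X Z)
    (hz' : z' = (1 - α) • avg Z + α • (P.avgGrad X + δ)) :
    P.Ψ x' ≠ ⊤ ∧ lyapunov P γ lam x' z' ≤ lyapunov P γ lam (avg X) (avg Z)
      - α * (γ⁻¹ / 2 * ‖avgStep P.Ψ γ X Z‖ ^ 2 + lam / 2 * ‖avg Z - gradient P.F (avg X)‖ ^ 2)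
      + α * (consensusWeight L γ lam * ((n : ℝ)⁻¹ * (dev X + dev Z)))
      + α ^ 2 * ((γ / 2 + lam) * ‖δ‖ ^ 2) + inner ℝ (noiseCoef P γ lam α X Z) δ := by
  have hL' : (0 : ℝ) < L := by exact_mod_cast hL
  have hn' : (0 : ℝ) < n := by positivity
  have hG : 0 < γ⁻¹ := inv_pos.2 hγ
  have hlam0 : 0 < lam := by rw [hlam]; positivity
  obtain ⟨p, hp⟩ : ∃ p, p = avgStep P.Ψ γ X Z := ⟨_, rfl⟩
  obtain ⟨q, hq⟩ : ∃ q, q = avg (proxStep P.Ψ γ X Z) - (avg X + p) := ⟨_, rfl⟩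
  obtain ⟨hA1, hA⟩ := hΨ.avg_step_le hn hγ X Z hX hα.le hα1 hx' hp hq
  refine ⟨hA1, ?_⟩
  have hB := le_of_lipschitzWith_gradient hS.differentiable_F hS.lipschitz_F (avg X) x'
  have hC := hΨ.subValue_step hγ (avg X) (avg Z) x' z'
  change subValue P.Ψ γ (avg X) (avg Z) - inner ℝ (avg Z + γ⁻¹ • avgStep P.Ψ γ X Z) (x' - avg X)
    + inner ℝ (avgStep P.Ψ γ X Z) (z' - avg Z) - γ / 2 * ‖z' - avg Z‖ ^ 2 ≤ _ at hC
  have hqb : ‖q‖ ^ 2 ≤ 2 * (1 + γ ^ 2) * ((n : ℝ)⁻¹ * (dev X + dev Z)) := by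
    have h1 := norm_avg_sq_le (fun i => proxStep P.Ψ γ X Z i - (avg X + p))
    have h2 := hΨ.sum_norm_proxStep_sub_le hγ X Z
    have h3 : (avg fun i => proxStep P.Ψ γ X Z i - (avg X + p)) = q := by
      have : (fun i => proxStep P.Ψ γ X Z i - (avg X + p))
        = proxStep P.Ψ γ X Z - fun _ => (avg X + p) := rfl
      rw [this, avg_sub, avg_const hn, hq]
    rw [h3, hp] at h1
    refine h1.trans ((mul_le_mul_of_nonneg_left h2 (by positivity)).trans ?_)
    have h4 := dev_nonneg X
    have h5 := dev_nonneg Z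
    rw [mul_left_comm]
    gcongr
    nlinarith [mul_nonneg (sq_nonneg γ) h4]
  have hbb := hS.norm_avg_gradient_sub_sq_le X (avg X)
  change ‖P.avgGrad X - gradient P.F (avg X)‖ ^ 2 ≤ L ^ 2 * ((n : ℝ)⁻¹ * dev X) at hbb
  rw [← hp] at hC ⊢
  rw [lyapunov, lyapunov, noiseCoef, ← hx', ← hp]
  have hxx : x' - avg X = α • (p + q) := by
    rw [hx', nextAvg, hq]; module
  obtain ⟨e, he⟩ : ∃ e, e = avg Z - gradient P.F (avg X) := ⟨_, rfl⟩
  obtain ⟨b, hb⟩ : ∃ b, b = P.avgGrad X - gradient P.F (avg X) := ⟨_, rfl⟩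
  have hzz : z' - avg Z = α • ((b - e) + δ) := by
    rw [hz', hb, he]; module
  have hgz : P.avgGrad X - avg Z = b - e := by rw [hb, he]; abel
  -- The drift of ∇F from x to x' is folded into w. The new gradient error is then the convex
  -- combination (1 - α)e + αw plus αδ, and convexity of the squared norm gives the decay factor 1 -
  -- α for ‖e‖². The drift is of order α, so w stays bounded in terms of b and p + q.
  obtain ⟨w, hw⟩ : ∃ w, w = b + α⁻¹ • (gradient P.F (avg X) - gradient P.F x') := ⟨_, rfl⟩
  have hm : (1 - α) • e + α • b + (gradient P.F (avg X) - gradient P.F x')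
      = (1 - α) • e + α • w := by
    rw [hw, smul_add, smul_smul, mul_inv_cancel₀ hα.ne', one_smul, add_assoc]
  have hee : z' - gradient P.F x' = ((1 - α) • e + α • w) + α • δ := by
    rw [← hm, hz', hb, he]; module
  rw [hxx, hzz] at hC
  rw [hxx] at hB
  rw [← hb] at hbb
  rw [hee, hgz, ← he, ← hb, hm]
  have hgF : gradient P.F (avg X) = avg Z - e := by rw [he]; abel
  rw [hgF] at hB
  have hwb : ‖w‖ ^ 2 ≤ 2 * ‖b‖ ^ 2 + 2 * (L ^ 2 * ‖p + q‖ ^ 2) := by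
    have h1 := hS.norm_gradient_F_sub_le (avg X) x'
    rw [norm_sub_rev (avg X), hxx, norm_smul, Real.norm_of_nonneg hα.le] at h1
    have h2 : ‖α⁻¹ • (gradient P.F (avg X) - gradient P.F x')‖ ≤ L * ‖p + q‖ := by
      rw [norm_smul, norm_inv, Real.norm_of_nonneg hα.le, inv_mul_le_iff₀ hα]
      linarith
    rw [hw, ← mul_pow]
    refine (norm_add_sq_le_two _ _).trans ?_
    gcongr
  have hmb := norm_convex_sq_le e w hα.le hα1
  have hpq := norm_add_sq_le_two p q
  have hbe := norm_sub_sq_le_two b e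
  have hyeq := inner_le_young e q (c := lam / 4) (by positivity)
  have hypb := inner_le_young p b (c := γ⁻¹ / 8) (by positivity)
  have hypq := inner_le_young p q (c := 1 / 24) (by norm_num)
  generalize P.avgGrad X = g at *
  set T := (n : ℝ)⁻¹ * (dev X + dev Z) with hT
  have hXT : (n : ℝ)⁻¹ * dev X ≤ T := by
    rw [hT]; gcongr; linarith [dev_nonneg Z]
  have hZT : (n : ℝ)⁻¹ * dev Z ≤ T := by
    rw [hT]; gcongr; linarith [dev_nonneg X]
  have hT0 : 0 ≤ T := (mul_nonneg (by positivity) (dev_nonneg X)).trans hXT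
  obtain ⟨J, hJ⟩ : ∃ J, J = inner ℝ (avg Z + γ⁻¹ • p) (p + q) := ⟨_, rfl⟩
  have hJ' : J = inner ℝ (avg Z) p + inner ℝ (avg Z) q + γ⁻¹ * ‖p‖ ^ 2 + γ⁻¹ * inner ℝ p q := by
    rw [hJ, inner_add_left, inner_add_right, inner_smul_left, inner_add_right,
      real_inner_self_eq_norm_sq]
    simp
    ring
  rw [← hJ] at hA
  rw [inner_smul_right, ← hJ, inner_smul_right, inner_add_right, inner_sub_right, norm_smul,
    mul_pow, Real.norm_eq_abs, sq_abs, norm_add_sq_real] at hC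
  rw [inner_smul_right, inner_sub_left, inner_add_right, inner_add_right, norm_smul, mul_pow,
    Real.norm_eq_abs, sq_abs, real_inner_comm p e] at hB
  obtain ⟨m, hmdef⟩ : ∃ m, m = (1 - α) • e + α • w := ⟨_, rfl⟩
  rw [← hmdef] at hmb ⊢
  rw [norm_add_sq_real m (α • δ), inner_smul_right, norm_smul, mul_pow, Real.norm_eq_abs α, sq_abs,
    inner_add_left _ _ δ, inner_sub_left _ _ δ, inner_smul_left, inner_smul_left, inner_smul_left]
  simp only [conj_trivial]
  have e1 : (4 * (lam / 4))⁻¹ = lam⁻¹ := by field_simp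
  have e2 : (4 * (γ⁻¹ / 8))⁻¹ = 2 * γ := by field_simp; norm_num
  rw [e1] at hyeq
  rw [e2] at hypb
  -- This fixes λ: the drift of ∇F costs 4λL²‖p‖², which is γ⁻¹/8 * ‖p‖².
  have hlamL : lam * L ^ 2 = γ⁻¹ / 32 := by rw [hlam]; field_simp
  -- When F, 2Ψ and -η are added, the terms ⟨avg Z, p + q⟩ and ⟨e, p⟩ cancel, leaving -α(γ⁻¹‖p‖² +
  -- λ‖e‖²) and the terms estimated here. These use four shares γ⁻¹/8 of ‖p‖² (`s2`, `s3`, `s4`,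
  -- `s6`) and two shares λ/4 of ‖e‖² (`s1`, `s5`), so half of each decrease survives.
  have s1 : -(α * inner ℝ e q) ≤ α * (lam / 4 * ‖e‖ ^ 2 + lam⁻¹ * ‖q‖ ^ 2) := by
    rw [← mul_neg]; gcongr; exact (neg_le_abs _).trans hyeq
  have s2 : -(α * inner ℝ p b) ≤ α * (γ⁻¹ / 8 * ‖p‖ ^ 2 + 2 * γ * ‖b‖ ^ 2) := by
    rw [← mul_neg]; gcongr; exact (neg_le_abs _).trans hypb
  have s3 : -(3 * (α * (γ⁻¹ * inner ℝ p q))) ≤ α * (γ⁻¹ / 8 * ‖p‖ ^ 2 + 18 * γ⁻¹ * ‖q‖ ^ 2) := by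
    have h1 := (neg_le_abs _).trans hypq
    have h2 : α * γ⁻¹ * -inner ℝ p q ≤ α * γ⁻¹ * (1 / 24 * ‖p‖ ^ 2 + (4 * (1 / 24))⁻¹ * ‖q‖ ^ 2) := by
      gcongr
    norm_num at h2
    linarith
  have s4 : L / 2 * (α ^ 2 * ‖p + q‖ ^ 2) ≤ α * (γ⁻¹ / 8 * (‖p‖ ^ 2 + ‖q‖ ^ 2)) := by
    have h1 : 8 * L * α * (α / 16 * ‖p + q‖ ^ 2)
        ≤ γ⁻¹ * (α / 16 * (2 * ‖p‖ ^ 2 + 2 * ‖q‖ ^ 2)) := by gcongr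
    linarith
  have s5 : γ / 2 * (α ^ 2 * ‖b - e‖ ^ 2) ≤ α * (lam / 4 * (‖b‖ ^ 2 + ‖e‖ ^ 2)) := by
    have h1 : 4 * γ * α * (α / 8 * ‖b - e‖ ^ 2)
        ≤ lam * (α / 8 * (2 * ‖b‖ ^ 2 + 2 * ‖e‖ ^ 2)) := by gcongr
    linarith
  have s6 : lam * ‖m‖ ^ 2 ≤ lam * ‖e‖ ^ 2 - α * (lam * ‖e‖ ^ 2)
      + α * (2 * lam * ‖b‖ ^ 2 + γ⁻¹ / 8 * (‖p‖ ^ 2 + ‖q‖ ^ 2)) := by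
    have h1 : ‖m‖ ^ 2 ≤ (1 - α) * ‖e‖ ^ 2 + α * (2 * ‖b‖ ^ 2
        + 2 * (L ^ 2 * (2 * ‖p‖ ^ 2 + 2 * ‖q‖ ^ 2))) := by
      refine hmb.trans ?_
      gcongr
      refine hwb.trans ?_
      gcongr
    have h2 := mul_le_mul_of_nonneg_left h1 hlam0.le
    have h3 : lam * ((1 - α) * ‖e‖ ^ 2 + α * (2 * ‖b‖ ^ 2
        + 2 * (L ^ 2 * (2 * ‖p‖ ^ 2 + 2 * ‖q‖ ^ 2)))) = lam * ‖e‖ ^ 2 - α * (lam * ‖e‖ ^ 2)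
        + α * (2 * lam * ‖b‖ ^ 2 + 4 * (lam * L ^ 2) * (‖p‖ ^ 2 + ‖q‖ ^ 2)) := by ring
    rw [h3, hlamL] at h2
    linarith
  have s7 : α * ((lam⁻¹ + 19 * γ⁻¹) * ‖q‖ ^ 2)
      ≤ α * ((lam⁻¹ + 19 * γ⁻¹) * (2 * (1 + γ ^ 2) * T)) := by gcongr
  have s8 : α * ((2 * γ + 3 * lam) * ‖b‖ ^ 2) ≤ α * ((2 * γ + 3 * lam) * (L ^ 2 * T)) := by
    gcongr
    exact hbb.trans (by gcongr)
  have s9 : α * ((n : ℝ)⁻¹ * (6 * γ⁻¹ * dev X + 6 * γ * dev Z)) ≤ α * (6 * γ⁻¹ * T + 6 * γ * T) := by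
    gcongr
    have h1 : 6 * γ⁻¹ * ((n : ℝ)⁻¹ * dev X) ≤ 6 * γ⁻¹ * T := by gcongr
    have h2 : 6 * γ * ((n : ℝ)⁻¹ * dev Z) ≤ 6 * γ * T := by gcongr
    linarith
  -- Slack for the constants rounded up in `consensusWeight`.
  have s10 : 0 ≤ α * (γ⁻¹ * ‖q‖ ^ 2) := by positivity
  have s11 : 0 ≤ α * (lam * ‖b‖ ^ 2) := by positivity
  have s12 : 0 ≤ α * (γ * (L ^ 2 * T)) := by positivity
  rw [hJ'] at hA hC
  rw [consensusWeight]
  linarith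

end LyapunovStep

/-! ### Lower bound and initial value of the Lyapunov function -/

section Bounds

variable {n d : ℕ} {S : Type*} [MeasurableSpace S] {P : Problem n d S} {L : NNReal}

theorem Problem.le_of_le_Phi (hΨ : ClosedProperConvex P.Ψ) {Φinf : ℝ}
    (hΦ : ∀ x, (Φinf : EReal) ≤ P.Phi x) {x : Vec d} (hx : P.Ψ x ≠ ⊤) :
    Φinf ≤ P.F x + (P.Ψ x).toReal := by
  have h1 := hΦ x
  rw [Problem.Phi, ← hΨ.coe_toReal hx, ← EReal.coe_add, EReal.coe_le_coe_iff] at h1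
  exact h1

theorem le_lyapunov (hΨ : ClosedProperConvex P.Ψ) {Φinf : ℝ}
    (hΦ : ∀ x, (Φinf : EReal) ≤ P.Phi x) {γ lam : ℝ} (hγ : 0 < γ) (hlam : 0 ≤ lam) {x : Vec d}
    (hx : P.Ψ x ≠ ⊤) (z : Vec d) : Φinf ≤ lyapunov P γ lam x z := by
  have h1 := Problem.le_of_le_Phi hΨ hΦ hx
  have h2 := hΨ.subValue_le hγ x z hx
  have h3 : 0 ≤ lam * ‖z - gradient P.F x‖ ^ 2 := by positivity
  rw [lyapunov]
  linarith

theorem Problem.initGap_le_iff (hΨ : ClosedProperConvex P.Ψ) {Φinf C₀ : ℝ}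
    (h : P.initGap Φinf ≤ (C₀ : EReal)) :
    P.Ψ 0 ≠ ⊤ ∧ P.F 0 + (P.Ψ 0).toReal - Φinf
      + (n : ℝ)⁻¹ * ∑ i, ‖gradient (P.locF i) 0‖ ^ 2 ≤ C₀ := by
  have h0 : P.Ψ 0 ≠ ⊤ := by
    intro htop
    rw [Problem.initGap, Problem.Phi, htop, EReal.coe_add_top, EReal.top_sub_coe,
      EReal.top_add_coe] at h
    exact EReal.coe_ne_top _ (top_le_iff.1 h)
  refine ⟨h0, ?_⟩
  rw [Problem.initGap, Problem.Phi, ← hΨ.coe_toReal h0, ← EReal.coe_add, ← EReal.coe_sub,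
    ← EReal.coe_add, EReal.coe_le_coe_iff] at h
  exact h

/-- The delicate term is Ψ(0) - Ψ(y) - ‖y‖²/(2γ) with y the proximal point of 0, since Ψ alone need
not be bounded below. Instead Φ ≥ Φinf is used at ty for a fixed small t, with convexity for Ψ and
the descent lemma for F. Division by t leaves ‖y‖²/(2γ), which the subproblem value cancels exactly.
-/
theorem lyapunov_zero_le (hS : P.Smooth L) (hΨ : ClosedProperConvex P.Ψ) {Φinf C₀ : ℝ}
    (hΦ : ∀ x, (Φinf : EReal) ≤ P.Phi x) (hC₀ : P.initGap Φinf ≤ (C₀ : EReal))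
    {γ lam c : ℝ} (hγ : 0 < γ) (hlam : 0 ≤ lam) (hγL : γ * L ≤ c) :
    lyapunov P γ lam 0 0 - Φinf ≤ (2 + 2 * c + γ + lam) * C₀ := by
  obtain ⟨h0, hinit⟩ := Problem.initGap_le_iff hΨ hC₀
  have hc0 : 0 ≤ c := le_trans (by positivity) hγL
  set D := P.F 0 + (P.Ψ 0).toReal - Φinf with hD
  have hD0 : 0 ≤ D := by linarith [Problem.le_of_le_Phi hΨ hΦ h0]
  have hgrad : ‖gradient P.F 0‖ ^ 2 ≤ (n : ℝ)⁻¹ * ∑ i, ‖gradient (P.locF i) 0‖ ^ 2 := by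
    rw [hS.gradient_F]; exact norm_avg_sq_le _
  set y := prox P.Ψ γ ((0 : Vec d) - γ • (0 : Vec d)) with hy
  have hyt : P.Ψ y ≠ ⊤ := hΨ.prox_ne_top hγ _
  -- Small enough that Lt ≤ γ⁻¹/2 when γL ≤ c. The factor 1/t = 1 + 2c goes into the final constant.
  set t := 1 / (1 + 2 * c) with ht
  have ht0 : 0 < t := by positivity
  have ht1 : t ≤ 1 := by rw [ht, div_le_one (by positivity)]; linarith
  have h1 := hΨ.convexOn.1 h0 hyt (sub_nonneg.2 ht1) ht0.le (by ring)
  have h2 := hΨ.convexOn.2 h0 hyt (sub_nonneg.2 ht1) ht0.le (by ring)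
  rw [smul_zero, zero_add] at h1 h2
  have h3 := Problem.le_of_le_Phi hΨ hΦ h1
  have h4 := le_of_lipschitzWith_gradient hS.differentiable_F hS.lipschitz_F 0 (t • y)
  rw [sub_zero, inner_smul_right, norm_smul, Real.norm_of_nonneg ht0.le, mul_pow] at h4
  simp only [smul_eq_mul] at h2
  have h5 := inner_le_young (gradient P.F 0) y hγ
  have h6 := le_abs_self (inner ℝ (gradient P.F 0) y)
  have hLt : L * t ≤ γ⁻¹ / 2 := by
    rw [ht, mul_one_div, div_le_iff₀ (by positivity), inv_eq_one_div, div_div, div_mul_eq_mul_div,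
      one_mul, le_div_iff₀ (by positivity)]
    linarith
  have h7 : t * ((P.Ψ 0).toReal - (P.Ψ y).toReal)
      ≤ D + t * (γ * ‖gradient P.F 0‖ ^ 2 + γ⁻¹ / 2 * ‖y‖ ^ 2) := by
    have h8 : L / 2 * (t ^ 2 * ‖y‖ ^ 2) ≤ t * (γ⁻¹ / 4 * ‖y‖ ^ 2) := by
      have : L * t * (t * ‖y‖ ^ 2 / 2) ≤ γ⁻¹ / 2 * (t * ‖y‖ ^ 2 / 2) := by gcongr
      linarith
    have h9 : t * inner ℝ (gradient P.F 0) y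
        ≤ t * (γ * ‖gradient P.F 0‖ ^ 2 + γ⁻¹ / 4 * ‖y‖ ^ 2) := by
      gcongr
      refine h6.trans (h5.trans (le_of_eq ?_))
      field_simp
    linarith
  have h10 : (P.Ψ 0).toReal - (P.Ψ y).toReal - γ⁻¹ / 2 * ‖y‖ ^ 2
      ≤ D * (1 + 2 * c) + γ * ‖gradient P.F 0‖ ^ 2 := by
    have h11 := mul_le_mul_of_nonneg_left h7 (show 0 ≤ 1 + 2 * c by linarith)
    have h12 : (1 + 2 * c) * t = 1 := by rw [ht]; field_simp
    rw [mul_add, ← mul_assoc, ← mul_assoc, h12] at h11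
    linarith
  have h13 : lyapunov P γ lam 0 0 - Φinf = D + ((P.Ψ 0).toReal - (P.Ψ y).toReal
      - γ⁻¹ / 2 * ‖y‖ ^ 2) + lam * ‖gradient P.F 0‖ ^ 2 := by
    rw [lyapunov, subValue, ← hy, hD, sub_zero, zero_sub, norm_neg, inner_zero_left]
    ring
  rw [h13]
  have h14 : 0 ≤ ‖gradient P.F 0‖ ^ 2 := sq_nonneg _
  have h15 : D ≤ C₀ := by linarith
  have h16 : ‖gradient P.F 0‖ ^ 2 ≤ C₀ := by linarith
  nlinarith [mul_le_mul_of_nonneg_left h15 hc0, mul_le_mul_of_nonneg_left h16 hγ.le,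
    mul_le_mul_of_nonneg_left h16 hlam]

end Bounds

/-! ### Measurability and square integrability -/

section Measurability

variable {n d : ℕ} {S : Type*} [MeasurableSpace S] {P : Problem n d S} {L : NNReal}

section

variable {A : Type*} {mA : MeasurableSpace A} {X Z : A → Fin n → Vec d}

theorem measurable_avg (hX : ∀ i, Measurable fun a => X a i) : Measurable fun a => avg (X a) := by
  simp only [avg]
  exact (Finset.measurable_fun_sum _ fun i _ => hX i).fun_const_smul _

theorem measurable_mix (M : Matrix (Fin n) (Fin n) ℝ) (hX : ∀ i, Measurable fun a => X a i)
    (i : Fin n) : Measurable fun a => mix M (X a) i := by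
  simp only [mix]
  exact Finset.measurable_fun_sum _ fun j _ => (hX j).fun_const_smul _

theorem measurable_proxStep (hΨ : ClosedProperConvex P.Ψ) {γ : ℝ} (hγ : 0 < γ)
    (hX : ∀ i, Measurable fun a => X a i) (hZ : ∀ i, Measurable fun a => Z a i) (i : Fin n) :
    Measurable fun a => proxStep P.Ψ γ (X a) (Z a) i := by
  simp only [proxStep]
  exact (hΨ.lipschitz_prox hγ).continuous.measurable.comp ((hX i).fun_sub ((hZ i).fun_const_smul γ))

theorem measurable_avgStep (hΨ : ClosedProperConvex P.Ψ) {γ : ℝ} (hγ : 0 < γ)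
    (hX : ∀ i, Measurable fun a => X a i) (hZ : ∀ i, Measurable fun a => Z a i) :
    Measurable fun a => avgStep P.Ψ γ (X a) (Z a) := by
  simp only [avgStep]
  exact ((hΨ.lipschitz_prox hγ).continuous.measurable.comp
      ((measurable_avg hX).fun_sub ((measurable_avg hZ).fun_const_smul γ))).fun_sub (measurable_avg hX)

theorem measurable_nextAvg (hΨ : ClosedProperConvex P.Ψ) {γ : ℝ} (hγ : 0 < γ) (α : ℝ)
    (hX : ∀ i, Measurable fun a => X a i) (hZ : ∀ i, Measurable fun a => Z a i) :
    Measurable fun a => nextAvg P.Ψ γ α (X a) (Z a) := by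
  simp only [nextAvg]
  exact ((measurable_avg hX).fun_const_smul _).fun_add
      ((measurable_avg (measurable_proxStep hΨ hγ hX hZ)).fun_const_smul _)

theorem Problem.Smooth.measurable_gradient_F (hS : P.Smooth L) {x : A → Vec d}
    (hx : Measurable x) : Measurable fun a => gradient P.F (x a) :=
  hS.lipschitz_F.continuous.measurable.comp hx

theorem Problem.Smooth.measurable_avgGrad (hS : P.Smooth L) (hX : ∀ i, Measurable fun a => X a i) :
    Measurable fun a => P.avgGrad (X a) :=
  measurable_avg fun i => (hS.continuous_gradient i).measurable.comp (hX i)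

/-- Applied to ℱ_k: the next average primal point uses no sample of time k + 1, so the coefficient
of the noise is predictable although it contains ∇F at that point. -/
theorem measurable_noiseCoef (hS : P.Smooth L) (hΨ : ClosedProperConvex P.Ψ) {γ : ℝ} (hγ : 0 < γ)
    (lam α : ℝ) (hX : ∀ i, Measurable fun a => X a i) (hZ : ∀ i, Measurable fun a => Z a i) :
    Measurable fun a => noiseCoef P γ lam α (X a) (Z a) := by
  simp only [noiseCoef]
  have h1 := hS.measurable_avgGrad hX
  have h2 := measurable_avg hZ
  have h3 := hS.measurable_gradient_F (measurable_avg hX)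
  have h4 := hS.measurable_gradient_F (measurable_nextAvg hΨ hγ α hX hZ)
  have h5 := measurable_avgStep hΨ hγ hX hZ
  exact (((h1.fun_sub h2).fun_const_smul _).fun_sub (h5.fun_const_smul _)).fun_add
    (((((h2.fun_sub h3).fun_const_smul _).fun_add ((h1.fun_sub h3).fun_const_smul _)).fun_add (h3.fun_sub h4)).fun_const_smul _)

end

variable {Ω : Type*} [MeasurableSpace Ω] {μ : Measure Ω} [IsProbabilityMeasure μ]
  {X Z : Ω → Fin n → Vec d}

theorem _root_.MeasureTheory.MemLp.fun_const_smul {A E : Type*} [MeasurableSpace A]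
    [NormedAddCommGroup E] [NormedSpace ℝ E] {ν : Measure A} {f : A → E} {p : ENNReal}
    (hf : MemLp f p ν) (c : ℝ) : MemLp (fun a => c • f a) p ν := hf.const_smul c

theorem _root_.MeasureTheory.MemLp.fun_add {A E : Type*} [MeasurableSpace A]
    [NormedAddCommGroup E] {ν : Measure A} {f g : A → E} {p : ENNReal}
    (hf : MemLp f p ν) (hg : MemLp g p ν) : MemLp (fun a => f a + g a) p ν := hf.add hg

theorem _root_.MeasureTheory.MemLp.fun_sub {A E : Type*} [MeasurableSpace A]
    [NormedAddCommGroup E] {ν : Measure A} {f g : A → E} {p : ENNReal}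
    (hf : MemLp f p ν) (hg : MemLp g p ν) : MemLp (fun a => f a - g a) p ν := hf.sub hg

theorem memLp_lipschitz_comp {E F : Type*} [NormedAddCommGroup E] [NormedAddCommGroup F]
    {f : E → F} {K : NNReal} (hf : LipschitzWith K f) {g : Ω → E} (hg : MemLp g 2 μ) :
    MemLp (fun ω => f (g ω)) 2 μ := by
  have h1 : LipschitzWith K fun x => f x - f 0 := fun x y => by simpa using hf x y
  have h2 := (h1.comp_memLp (by simp) hg).add (memLp_const (f 0))
  refine h2.ae_eq (Filter.Eventually.of_forall fun ω => ?_)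
  simp

omit [IsProbabilityMeasure μ] in
theorem memLp_avg (hX : ∀ i, MemLp (fun ω => X ω i) 2 μ) : MemLp (fun ω => avg (X ω)) 2 μ := by
  simp only [avg]
  exact (memLp_finsetSum _ fun i _ => hX i).fun_const_smul _

omit [IsProbabilityMeasure μ] in
theorem memLp_mix (M : Matrix (Fin n) (Fin n) ℝ) (hX : ∀ i, MemLp (fun ω => X ω i) 2 μ)
    (i : Fin n) : MemLp (fun ω => mix M (X ω) i) 2 μ := by
  simp only [mix]
  exact memLp_finsetSum _ fun j _ => (hX j).fun_const_smul _

omit [IsProbabilityMeasure μ] in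
theorem integrable_dev (hX : ∀ i, MemLp (fun ω => X ω i) 2 μ) :
    Integrable (fun ω => dev (X ω)) μ :=
  integrable_finsetSum _ fun i _ => ((hX i).fun_sub (memLp_avg hX)).norm.integrable_sq

theorem memLp_proxStep (hΨ : ClosedProperConvex P.Ψ) {γ : ℝ} (hγ : 0 < γ)
    (hX : ∀ i, MemLp (fun ω => X ω i) 2 μ) (hZ : ∀ i, MemLp (fun ω => Z ω i) 2 μ) (i : Fin n) :
    MemLp (fun ω => proxStep P.Ψ γ (X ω) (Z ω) i) 2 μ := by
  simp only [proxStep]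
  exact memLp_lipschitz_comp (hΨ.lipschitz_prox hγ) ((hX i).fun_sub ((hZ i).fun_const_smul γ))

theorem memLp_avgStep (hΨ : ClosedProperConvex P.Ψ) {γ : ℝ} (hγ : 0 < γ)
    (hX : ∀ i, MemLp (fun ω => X ω i) 2 μ) (hZ : ∀ i, MemLp (fun ω => Z ω i) 2 μ) :
    MemLp (fun ω => avgStep P.Ψ γ (X ω) (Z ω)) 2 μ := by
  simp only [avgStep]
  exact (memLp_lipschitz_comp (hΨ.lipschitz_prox hγ)
      ((memLp_avg hX).fun_sub ((memLp_avg hZ).fun_const_smul γ))).fun_sub (memLp_avg hX)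

theorem memLp_nextAvg (hΨ : ClosedProperConvex P.Ψ) {γ : ℝ} (hγ : 0 < γ) (α : ℝ)
    (hX : ∀ i, MemLp (fun ω => X ω i) 2 μ) (hZ : ∀ i, MemLp (fun ω => Z ω i) 2 μ) :
    MemLp (fun ω => nextAvg P.Ψ γ α (X ω) (Z ω)) 2 μ := by
  simp only [nextAvg]
  exact ((memLp_avg hX).fun_const_smul _).fun_add ((memLp_avg (memLp_proxStep hΨ hγ hX hZ)).fun_const_smul _)

theorem Problem.Smooth.memLp_avgGrad (hS : P.Smooth L) (hX : ∀ i, MemLp (fun ω => X ω i) 2 μ) :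
    MemLp (fun ω => P.avgGrad (X ω)) 2 μ :=
  memLp_avg fun i => memLp_lipschitz_comp (hS.lipschitz i) (hX i)

theorem memLp_noiseCoef (hS : P.Smooth L) (hΨ : ClosedProperConvex P.Ψ) {γ : ℝ} (hγ : 0 < γ)
    (lam α : ℝ) (hX : ∀ i, MemLp (fun ω => X ω i) 2 μ) (hZ : ∀ i, MemLp (fun ω => Z ω i) 2 μ) :
    MemLp (fun ω => noiseCoef P γ lam α (X ω) (Z ω)) 2 μ := by
  simp only [noiseCoef]
  have h1 := hS.memLp_avgGrad hX
  have h2 := memLp_avg hZ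
  have h3 := memLp_lipschitz_comp hS.lipschitz_F (memLp_avg hX)
  have h4 := memLp_lipschitz_comp hS.lipschitz_F (memLp_nextAvg hΨ hγ α hX hZ)
  have h5 := memLp_avgStep hΨ hγ hX hZ
  exact (((h1.fun_sub h2).fun_const_smul _).fun_sub (h5.fun_const_smul _)).fun_add
    (((((h2.fun_sub h3).fun_const_smul _).fun_add ((h1.fun_sub h3).fun_const_smul _)).fun_add (h3.fun_sub h4)).fun_const_smul _)

end Measurability

/-! ### Abstract runs

Both algorithms mix `(1 - α) x + α y` and `(1 - α) z + α w` with directions `w` whose average is the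
average of the stochastic gradients. -/

section Run

variable {n d : ℕ} {S : Type*} [MeasurableSpace S] {Ω : Type*} [MeasurableSpace Ω]

/-- A run of a decentralized proximal averaging method with primal variables `x`, dual variables `z`
and directions `w`. -/
structure IsRun (P : Problem n d S) (W : Matrix (Fin n) (Fin n) ℝ) (m : ℕ) (γ : ℝ) (α : ℕ → ℝ)
    (μ : Measure Ω) (ξ : ℕ → Fin n → Ω → S) (x z w : ℕ → Ω → Fin n → Vec d) : Prop where
  x_zero : ∀ ω, x 0 ω = 0
  z_zero : ∀ ω, z 0 ω = 0
  x_succ : ∀ k ω, x (k + 1) ω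
    = mix (W ^ m) ((1 - α k) • x k ω + α k • proxStep P.Ψ γ (x k ω) (z k ω))
  z_succ : ∀ k ω, z (k + 1) ω = mix (W ^ m) ((1 - α k) • z k ω + α k • w k ω)
  avg_w : ∀ k ω, avg (w k ω) = avg fun i => P.stochGrad i (x k ω i) (ξ (k + 1) i ω)
  measurable_x : ∀ k i, Measurable[sampleFiltration ξ k] fun ω => x k ω i
  measurable_z : ∀ k i, Measurable[sampleFiltration ξ k] fun ω => z k ω i
  memLp_x : ∀ k i, MemLp (fun ω => x k ω i) 2 μ
  memLp_z : ∀ k i, MemLp (fun ω => z k ω i) 2 μ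
  memLp_w : ∀ k i, MemLp (fun ω => w k ω i) 2 μ

variable {P : Problem n d S} {L : NNReal} {W : Matrix (Fin n) (Fin n) ℝ} {m : ℕ} {γ : ℝ}
  {α : ℕ → ℝ} {μ : Measure Ω} {ξ : ℕ → Fin n → Ω → S} {x z w : ℕ → Ω → Fin n → Vec d}
  {σs : Fin n → ℝ}

/-- The averaged noise in step `k`. -/
noncomputable def avgNoise (P : Problem n d S) (ξ : ℕ → Fin n → Ω → S)
    (x : ℕ → Ω → Fin n → Vec d) (k : ℕ) (ω : Ω) : Vec d :=
  avg fun i => P.noise i (x k ω i) (ξ (k + 1) i ω)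

namespace IsRun

theorem avg_x_succ (h : IsRun P W m γ α μ ξ x z w) (hW : IsGossip W) (k : ℕ) (ω : Ω) :
    avg (x (k + 1) ω) = nextAvg P.Ψ γ (α k) (x k ω) (z k ω) := by
  rw [h.x_succ, hW.avg_mix_pow, avg_add, avg_smul, avg_smul, nextAvg]

theorem avg_z_succ (h : IsRun P W m γ α μ ξ x z w) (hW : IsGossip W) (k : ℕ) (ω : Ω) :
    avg (z (k + 1) ω) = (1 - α k) • avg (z k ω)
      + α k • (P.avgGrad (x k ω) + avgNoise P ξ x k ω) := by
  rw [h.z_succ, hW.avg_mix_pow, avg_add, avg_smul, avg_smul, h.avg_w, Problem.avgGrad, avgNoise,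
    ← avg_add]
  congr 3
  ext1 i
  simp only [Pi.add_apply, Problem.noise_eq]
  abel

theorem avg_mem (h : IsRun P W m γ α μ ξ x z w) (hW : IsGossip W)
    (hΨ : ClosedProperConvex P.Ψ) (hn : 1 ≤ n) (hγ : 0 < γ) (h0 : P.Ψ 0 ≠ ⊤)
    (hα : ∀ k, 0 < α k) (hα1 : ∀ k, α k ≤ 1) (k : ℕ) (ω : Ω) : P.Ψ (avg (x k ω)) ≠ ⊤ := by
  induction k with
  | zero => rw [h.x_zero]; simpa [avg] using h0
  | succ k ih =>
    rw [h.avg_x_succ hW, nextAvg]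
    exact hΨ.convexOn.1 ih (hΨ.avg_mem hn fun i => hΨ.prox_ne_top hγ _).1
      (sub_nonneg.2 (hα1 k)) (hα k).le (by ring)

/-- The bound on the increments of the Lyapunov function along a run. -/
noncomputable def incr (P : Problem n d S) (L γ lam : ℝ) (α : ℕ → ℝ) (ξ : ℕ → Fin n → Ω → S)
    (x z : ℕ → Ω → Fin n → Vec d) (k : ℕ) (ω : Ω) : ℝ :=
  - (α k * (γ⁻¹ / 2 * ‖avgStep P.Ψ γ (x k ω) (z k ω)‖ ^ 2
      + lam / 2 * ‖avg (z k ω) - gradient P.F (avg (x k ω))‖ ^ 2))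
    + α k * (consensusWeight L γ lam * ((n : ℝ)⁻¹ * (dev (x k ω) + dev (z k ω))))
    + α k ^ 2 * ((γ / 2 + lam) * ‖avgNoise P ξ x k ω‖ ^ 2)
    + inner ℝ (noiseCoef P γ lam (α k) (x k ω) (z k ω)) (avgNoise P ξ x k ω)

variable [IsProbabilityMeasure μ]

theorem integral_incr_le (h : IsRun P W m γ α μ ξ x z w) (hO : Oracle P σs μ ξ) (hS : P.Smooth L)
    (hR : P.Regular) (hΨ : ClosedProperConvex P.Ψ) (hγ : 0 < γ)
    {lam σ : ℝ} (hlam : 0 ≤ lam) (hσ : (n : ℝ)⁻¹ * ∑ i, σs i ^ 2 ≤ σ ^ 2) (k : ℕ) :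
    Integrable (incr P L γ lam α ξ x z k) μ ∧ ∫ ω, incr P L γ lam α ξ x z k ω ∂μ ≤
      - (α k * (γ⁻¹ / 2 * ∫ ω, ‖avgStep P.Ψ γ (x k ω) (z k ω)‖ ^ 2 ∂μ
        + lam / 2 * ∫ ω, ‖avg (z k ω) - gradient P.F (avg (x k ω))‖ ^ 2 ∂μ))
      + α k * (consensusWeight L γ lam *
          ((n : ℝ)⁻¹ * (∫ ω, dev (x k ω) ∂μ + ∫ ω, dev (z k ω) ∂μ)))
      + α k ^ 2 * ((γ / 2 + lam) * (σ ^ 2 / n)) := by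
  have hx := h.memLp_x k
  have hz := h.memLp_z k
  have i1 := (memLp_avgStep hΨ hγ hx hz).norm.integrable_sq
  have i2 := ((memLp_avg hz).fun_sub
    (memLp_lipschitz_comp hS.lipschitz_F (memLp_avg hx))).norm.integrable_sq
  have i3 := integrable_dev hx
  have i4 := integrable_dev hz
  have hN : MemLp (fun ω => avgNoise P ξ x k ω) 2 μ := by
    simp only [avgNoise]
    exact memLp_avg fun i => hO.memLp_noise hS hR k i (h.measurable_x k i)
  have i5 := hN.norm.integrable_sq
  obtain ⟨i6, h6⟩ := hO.integral_inner_avg_noise hS hR k (h.measurable_x k)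
    (measurable_noiseCoef hS hΨ hγ lam (α k) (h.measurable_x k) (h.measurable_z k))
    (memLp_noiseCoef hS hΨ hγ lam (α k) hx hz)
  have h5 := hO.integral_avg_noise_sq_le hS hR k hσ (h.measurable_x k)
  change Integrable (fun ω => inner ℝ (noiseCoef P γ lam (α k) (x k ω) (z k ω))
    (avgNoise P ξ x k ω)) μ at i6
  change ∫ ω, inner ℝ (noiseCoef P γ lam (α k) (x k ω) (z k ω)) (avgNoise P ξ x k ω) ∂μ = 0 at h6
  change ∫ ω, ‖avgNoise P ξ x k ω‖ ^ 2 ∂μ ≤ _ at h5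
  have j1 := (((i1.const_mul (γ⁻¹ / 2)).add (i2.const_mul (lam / 2))).const_mul (α k)).neg
  have j2 := (((i3.add i4).const_mul (n : ℝ)⁻¹).const_mul (consensusWeight L γ lam)).const_mul (α k)
  have j3 := (i5.const_mul (γ / 2 + lam)).const_mul (α k ^ 2)
  refine ⟨((j1.add j2).add j3).add i6, ?_⟩
  have e1 : ∫ ω, incr P L γ lam α ξ x z k ω ∂μ =
      - (α k * (γ⁻¹ / 2 * ∫ ω, ‖avgStep P.Ψ γ (x k ω) (z k ω)‖ ^ 2 ∂μ
        + lam / 2 * ∫ ω, ‖avg (z k ω) - gradient P.F (avg (x k ω))‖ ^ 2 ∂μ))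
      + α k * (consensusWeight L γ lam *
          ((n : ℝ)⁻¹ * (∫ ω, dev (x k ω) ∂μ + ∫ ω, dev (z k ω) ∂μ)))
      + α k ^ 2 * ((γ / 2 + lam) * ∫ ω, ‖avgNoise P ξ x k ω‖ ^ 2 ∂μ) := by
    have a1 := integral_add ((j1.add j2).add j3) i6
    have a2 := integral_add (j1.add j2) j3
    have a3 := integral_add j1 j2
    have a4 := integral_add (i1.const_mul (γ⁻¹ / 2)) (i2.const_mul (lam / 2))
    have a5 := integral_add i3 i4
    simp only [Pi.add_apply, Pi.neg_apply, integral_neg, integral_const_mul] at a1 a2 a3 a4 a5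
    rw [a4, a5] at a3
    rw [a3] at a2
    rw [a2, h6, add_zero] at a1
    exact a1
  rw [e1]
  gcongr

/-- The summed Lyapunov inequality in expectation. -/
theorem sum_le (h : IsRun P W m γ α μ ξ x z w) (hW : IsGossip W) (hO : Oracle P σs μ ξ)
    (hS : P.Smooth L) (hR : P.Regular) (hΨ : ClosedProperConvex P.Ψ) (hn : 1 ≤ n) (hL : 0 < L)
    (hγ : 0 < γ) {lam σ Φinf : ℝ} (hlam : lam = γ⁻¹ / (32 * L ^ 2))
    (hσ : (n : ℝ)⁻¹ * ∑ i, σs i ^ 2 ≤ σ ^ 2) (hΦ : ∀ x, (Φinf : EReal) ≤ P.Phi x)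
    (h0 : P.Ψ 0 ≠ ⊤) (hα : ∀ k, 0 < α k) (hα1 : ∀ k, α k ≤ 1)
    (hα2 : ∀ k, 8 * L * α k ≤ γ⁻¹) (hα3 : ∀ k, 4 * γ * α k ≤ lam) (N : ℕ) :
    ∑ k ∈ Finset.range N, α k * (γ⁻¹ / 2 * ∫ ω, ‖avgStep P.Ψ γ (x k ω) (z k ω)‖ ^ 2 ∂μ
        + lam / 2 * ∫ ω, ‖avg (z k ω) - gradient P.F (avg (x k ω))‖ ^ 2 ∂μ)
      ≤ lyapunov P γ lam 0 0 - Φinf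
      + ∑ k ∈ Finset.range N, (α k * (consensusWeight L γ lam *
          ((n : ℝ)⁻¹ * (∫ ω, dev (x k ω) ∂μ + ∫ ω, dev (z k ω) ∂μ)))
        + α k ^ 2 * ((γ / 2 + lam) * (σ ^ 2 / n))) := by
  have hlam0 : 0 ≤ lam := by rw [hlam]; positivity
  -- The telescoping is done pathwise and only the bounds on the increments are integrated, so no
  -- integrability of the Lyapunov function is needed.
  have hpath : ∀ ω N, lyapunov P γ lam (avg (x N ω)) (avg (z N ω))
      ≤ lyapunov P γ lam 0 0 + ∑ k ∈ Finset.range N, incr P L γ lam α ξ x z k ω := by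
    intro ω N
    induction N with
    | zero => rw [h.x_zero, h.z_zero]; simp [avg]
    | succ k ih =>
      have h1 := (lyapunov_step hS hΨ hn hL hγ hlam (hα k) (hα1 k) (hα2 k) (hα3 k) (x k ω) (z k ω)
        (h.avg_mem hW hΨ hn hγ h0 hα hα1 k ω) (h.avg_x_succ hW k ω) (h.avg_z_succ hW k ω)).2
      rw [Finset.sum_range_succ, incr]
      linarith
  have hlow : ∀ ω, Φinf - lyapunov P γ lam 0 0
      ≤ ∑ k ∈ Finset.range N, incr P L γ lam α ξ x z k ω := by
    intro ω
    have h1 := hpath ω N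
    have h2 := le_lyapunov hΨ hΦ hγ hlam0 (h.avg_mem hW hΨ hn hγ h0 hα hα1 N ω) (avg (z N ω))
    linarith
  have hint := fun k => h.integral_incr_le hO hS hR hΨ hγ hlam0 hσ k
  have h1 : Φinf - lyapunov P γ lam 0 0
      ≤ ∑ k ∈ Finset.range N, ∫ ω, incr P L γ lam α ξ x z k ω ∂μ := by
    rw [← integral_finsetSum _ fun k _ => (hint k).1]
    have h2 := integral_mono (μ := μ) (integrable_const (Φinf - lyapunov P γ lam 0 0))
      (integrable_finsetSum _ fun k _ => (hint k).1) hlow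
    simpa using h2
  have h2 := h1.trans (Finset.sum_le_sum fun k _ => (hint k).2)
  simp only [Finset.sum_add_distrib, Finset.sum_neg_distrib] at h2 ⊢
  linarith

end IsRun

/-! ### Consensus errors -/

/-- With weight t = 1 - δ/2 and (1 - δ) ≤ (1 - δ/2)², half of the spectral gap survives, at the
price of a factor 2/δ on the perturbation. -/
theorem IsGossip.dev_mix_pow_add_le (hW : IsGossip W) (hn : 1 ≤ n) {δ : ℝ} (hδ : 0 < δ)
    (hδ1 : δ ≤ 1) (hρ : rho W ^ (2 * m) ≤ 1 - δ) (X Y : Fin n → Vec d) :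
    dev (mix (W ^ m) (X + Y)) ≤ (1 - δ / 2) * dev X + 2 / δ * dev Y := by
  have h1 := hW.dev_mix_pow_le hn m (X + Y)
  have h2 := dev_add_le X Y (t := 1 - δ / 2) (by linarith) (by linarith)
  have h3 := dev_nonneg X
  have h4 := dev_nonneg Y
  have hnn := dev_nonneg (X + Y)
  rw [sub_sub_cancel] at h2
  calc dev (mix (W ^ m) (X + Y)) ≤ (1 - δ) * dev (X + Y) := h1.trans (by gcongr)
    _ ≤ (1 - δ) * (dev X / (1 - δ / 2) + dev Y / (δ / 2)) := by gcongr
    _ = (1 - δ) / (1 - δ / 2) * dev X + (1 - δ) * (2 / δ * dev Y) := by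
      field_simp
    _ ≤ (1 - δ / 2) * dev X + 1 * (2 / δ * dev Y) := by
      gcongr
      · rw [div_le_iff₀ (by linarith)]; nlinarith
      · linarith
    _ = _ := by ring

theorem IsGossip.dev_mix_pow_add_le' (hW : IsGossip W) (hn : 1 ≤ n) {δ : ℝ} (hδ : 0 < δ)
    (hδ1 : δ ≤ 1) (hρ : rho W ^ (2 * m) ≤ 1 - δ) {a β : ℝ} (ha : 0 ≤ a) (haβ : a ≤ β)
    (X Y : Fin n → Vec d) :
    dev (mix (W ^ m) ((1 - a) • X + a • Y))
      ≤ (1 - δ / 2) * dev X + 2 / δ * (β ^ 2 * (2 * dev Y + 2 * dev X)) := by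
  have h1 : (1 - a) • X + a • Y = X + a • (Y - X) := by module
  rw [h1]
  refine (hW.dev_mix_pow_add_le hn hδ hδ1 hρ X _).trans ?_
  rw [dev_smul]
  have := dev_sub_le_two Y X
  have h2 := dev_nonneg X
  have h3 := dev_nonneg Y
  have h4 := dev_nonneg (Y - X)
  gcongr

theorem ClosedProperConvex.dev_proxStep_le {Ψ : Vec d → EReal} (hΨ : ClosedProperConvex Ψ)
    (hn : 1 ≤ n) (hγ : 0 < γ) (X Z : Fin n → Vec d) :
    dev (proxStep Ψ γ X Z) ≤ 2 * dev X + 2 * γ ^ 2 * dev Z :=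
  (dev_le_sum hn _ _).trans (hΨ.sum_norm_proxStep_sub_le hγ X Z)

namespace IsRun

theorem dev_x_succ_le (h : IsRun P W m γ α μ ξ x z w) (hW : IsGossip W)
    (hΨ : ClosedProperConvex P.Ψ) (hn : 1 ≤ n) (hγ : 0 < γ) {δ : ℝ} (hδ : 0 < δ)
    (hδ1 : δ ≤ 1) (hρ : rho W ^ (2 * m) ≤ 1 - δ) {β : ℝ} (hα : ∀ k, 0 < α k)
    (hαβ : ∀ k, α k ≤ β) (k : ℕ) (ω : Ω) :
    dev (x (k + 1) ω) ≤ (1 - δ / 2) * dev (x k ω)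
      + 2 / δ * (β ^ 2 * (6 * dev (x k ω) + 4 * γ ^ 2 * dev (z k ω))) := by
  rw [h.x_succ]
  refine (hW.dev_mix_pow_add_le' hn hδ hδ1 hρ (hα k).le (hαβ k) _ _).trans ?_
  have h1 := hΨ.dev_proxStep_le hn hγ (x k ω) (z k ω)
  refine add_le_add le_rfl (mul_le_mul_of_nonneg_left (mul_le_mul_of_nonneg_left ?_
    (sq_nonneg β)) (by positivity))
  linarith

theorem dev_z_succ_le (h : IsRun P W m γ α μ ξ x z w) (hW : IsGossip W)
    (hn : 1 ≤ n) {δ : ℝ} (hδ : 0 < δ)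
    (hδ1 : δ ≤ 1) (hρ : rho W ^ (2 * m) ≤ 1 - δ) {β : ℝ} (hα : ∀ k, 0 < α k)
    (hαβ : ∀ k, α k ≤ β) (k : ℕ) (ω : Ω) :
    dev (z (k + 1) ω) ≤ (1 - δ / 2) * dev (z k ω)
      + 2 / δ * (β ^ 2 * (2 * dev (w k ω) + 2 * dev (z k ω))) := by
  rw [h.z_succ]
  exact hW.dev_mix_pow_add_le' hn hδ hδ1 hρ (hα k).le (hαβ k) _ _

/-- Mixing may move the local points by far more than the stepsize. The displacement is therefore
split into the deviations at both times and the motion of the average; only the last carries β². It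
bounds the gradient increments in the tracking recursion. -/
theorem sum_norm_x_succ_sub_le (h : IsRun P W m γ α μ ξ x z w) (hW : IsGossip W)
    (hΨ : ClosedProperConvex P.Ψ) (hn : 1 ≤ n) (hγ : 0 < γ) {β : ℝ} (hα : ∀ k, 0 < α k)
    (hαβ : ∀ k, α k ≤ β) (k : ℕ) (ω : Ω) :
    ∑ i, ‖x (k + 1) ω i - x k ω i‖ ^ 2 ≤ 3 * dev (x (k + 1) ω) + 3 * dev (x k ω)
      + 3 * (β ^ 2 * (2 * n * ‖avgStep P.Ψ γ (x k ω) (z k ω)‖ ^ 2 + 4 * dev (x k ω)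
        + 4 * γ ^ 2 * dev (z k ω))) := by
  have hn' : (0 : ℝ) < n := by positivity
  set X := x k ω with hX
  set X' := x (k + 1) ω with hX'
  set Z := z k ω
  set p := avgStep P.Ψ γ X Z with hp
  have h1 : avg X' - avg X = α k • (avg (proxStep P.Ψ γ X Z) - avg X) := by
    rw [hX', h.avg_x_succ hW, nextAvg]; module
  have h2 : (n : ℝ) * ‖avg (proxStep P.Ψ γ X Z) - avg X‖ ^ 2
      ≤ 2 * n * ‖p‖ ^ 2 + 4 * dev X + 4 * γ ^ 2 * dev Z := by
    have h3 := norm_avg_sq_le (fun i => proxStep P.Ψ γ X Z i - (avg X + p))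
    have h4 := hΨ.sum_norm_proxStep_sub_le hγ X Z
    have h5 : (avg fun i => proxStep P.Ψ γ X Z i - (avg X + p))
        = avg (proxStep P.Ψ γ X Z) - (avg X + p) := by
      have : (fun i => proxStep P.Ψ γ X Z i - (avg X + p))
        = proxStep P.Ψ γ X Z - fun _ => (avg X + p) := rfl
      rw [this, avg_sub, avg_const hn]
    rw [h5] at h3
    have h6 := norm_add_sq_le_two p (avg (proxStep P.Ψ γ X Z) - (avg X + p))
    rw [show p + (avg (proxStep P.Ψ γ X Z) - (avg X + p)) = avg (proxStep P.Ψ γ X Z) - avg X by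
      abel] at h6
    have h7 := mul_le_mul_of_nonneg_left h3 hn'.le
    rw [← mul_assoc, mul_inv_cancel₀ hn'.ne', one_mul] at h7
    have h8 := mul_le_mul_of_nonneg_left h6 hn'.le
    rw [← hp] at h4
    linarith
  have h3 : (n : ℝ) * ‖avg X' - avg X‖ ^ 2
      ≤ β ^ 2 * (2 * n * ‖p‖ ^ 2 + 4 * dev X + 4 * γ ^ 2 * dev Z) := by
    rw [h1, norm_smul, mul_pow, Real.norm_eq_abs, sq_abs, mul_left_comm]
    have := hα k
    have := hαβ k
    gcongr
  have h4 : ∀ i, ‖X' i - X i‖ ^ 2 ≤ 3 * ‖X' i - avg X'‖ ^ 2 + 3 * ‖X i - avg X‖ ^ 2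
      + 3 * ‖avg X' - avg X‖ ^ 2 := by
    intro i
    have h5 := norm_add_sq_le_three (X' i - avg X') (-(X i - avg X)) (avg X' - avg X)
    rw [norm_neg] at h5
    rwa [show X' i - avg X' + -(X i - avg X) + (avg X' - avg X) = X' i - X i by abel] at h5
  have h5 := Finset.sum_le_sum fun i (_ : i ∈ Finset.univ) => h4 i
  simp only [Finset.sum_add_distrib, ← Finset.mul_sum, Finset.sum_const, Finset.card_univ,
    Fintype.card_fin, nsmul_eq_mul] at h5
  change _ ≤ 3 * dev X' + 3 * dev X + _ at h5
  linarith

end IsRun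

end Run

/-! ### Summing the coupled recursions -/

/-- Telescoping of the potential AβT + Bβ³U. The choice Bδ/2 = Ap lets the decay of U pay for its
feedback Apβ³U into T. The choice Aδ/2 = 2E gives a gain 2EβT, of which one half is the claim and
the other absorbs the β³ terms by `hsmall`. Noise enters at order β³ per step and progress at order
β⁵. -/
theorem sum_coupled_le {T U a : ℕ → ℝ} {δ p β N₂ E A B : ℝ} (hT0 : T 0 = 0)
    (hT : ∀ k, 0 ≤ T k) (hδ : 0 < δ) (hp : 0 ≤ p) (hβ : 0 ≤ β) (hβ1 : β ≤ 1) (hE : 0 ≤ E)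
    (hA : A = 4 * E / δ) (hB : B = 2 * A * p / δ) (hsmall : β * ((A + B) * p) ≤ E)
    (hTs : ∀ k, T (k + 1) ≤ (1 - δ / 2) * T k + β ^ 2 * (p * (T k + U k)))
    (hUs : ∀ k, U (k + 1) ≤ (1 - δ / 2) * U k + p * (N₂ + T k + β ^ 2 * a k)) (N : ℕ) :
    A * β * T N + B * β ^ 3 * U N + β * E * ∑ k ∈ Finset.range N, T k
      ≤ B * β ^ 3 * U 0 + N * (B * β ^ 3 * (p * N₂))
        + B * β ^ 5 * p * ∑ k ∈ Finset.range N, a k := by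
  have hA0 : 0 ≤ A := by rw [hA]; positivity
  have hB0 : 0 ≤ B := by rw [hB]; positivity
  have hAδ : A * (δ / 2) = 2 * E := by rw [hA]; field_simp; ring
  have hBδ : B * (δ / 2) = A * p := by rw [hB]; field_simp
  induction N with
  | zero => simp [hT0]
  | succ k ih =>
    rw [Finset.sum_range_succ, Finset.sum_range_succ]
    have h1 := mul_le_mul_of_nonneg_left (hTs k) (mul_nonneg hA0 hβ)
    have h2 := mul_le_mul_of_nonneg_left (hUs k) (mul_nonneg hB0 (pow_nonneg hβ 3))
    have h3 : β ^ 3 * ((A + B) * p) * T k ≤ β * E * T k := by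
      have h4 : β ^ 3 * ((A + B) * p) ≤ β * E := by
        calc β ^ 3 * ((A + B) * p) = β * β * (β * ((A + B) * p)) := by ring
          _ ≤ β * 1 * E := by gcongr
          _ = β * E := by ring
      exact mul_le_mul_of_nonneg_right h4 (hT k)
    have e1 : A * β * ((1 - δ / 2) * T k + β ^ 2 * (p * (T k + U k)))
        = A * β * T k - 2 * E * β * T k + A * β ^ 3 * p * T k + A * p * β ^ 3 * U k := by
      rw [← hAδ]; ring
    have e2 : B * β ^ 3 * ((1 - δ / 2) * U k + p * (N₂ + T k + β ^ 2 * a k))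
        = B * β ^ 3 * U k - A * p * β ^ 3 * U k + B * β ^ 3 * (p * N₂) + B * β ^ 3 * p * T k
          + B * β ^ 5 * p * a k := by
      rw [← hBδ]; ring
    rw [e1] at h1
    rw [e2] at h2
    push_cast
    linarith

/-- The weight of the gradient error in the Lyapunov function. -/
noncomputable def gradWeight (L γ : ℝ) : ℝ := γ⁻¹ / (32 * L ^ 2)

/-- The growth constant in the recursions of the consensus errors. -/
noncomputable def growth (n : ℕ) (L γ δ : ℝ) : ℝ :=
  2 / δ * (8 + 4 * γ ^ 2 + 6 * n
    + 9 * L ^ 2 * (6 + 4 * γ ^ 2 + 2 / δ * (6 + 4 * γ ^ 2) + 2 * n))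

/-- The decrease of the consensus potential per step, up to the stepsize. -/
noncomputable def consensusGain (n : ℕ) (L γ : ℝ) : ℝ :=
  (consensusWeight L γ (gradWeight L γ) + L ^ 2) * (n : ℝ)⁻¹

/-- The weight of the dispersion of the directions in the consensus potential. -/
noncomputable def dirWeight (n : ℕ) (L γ δ : ℝ) : ℝ :=
  2 * (4 * consensusGain n L γ / δ) * growth n L γ δ / δ

/-- The rate of decrease of the Lyapunov function. -/
noncomputable def lyapunovRate (L γ : ℝ) : ℝ := min (γ⁻¹ / 2) (gradWeight L γ / 2)

/-- The smallness conditions on the stepsizes, which are at most `β`. -/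
structure SmallStep (n : ℕ) (L γ δ κ M β : ℝ) : Prop where
  le_one : β ≤ 1
  smooth : β * (8 * L) ≤ γ⁻¹
  dual : β * (4 * γ) ≤ gradWeight L γ
  potential : β * ((4 * consensusGain n L γ / δ + dirWeight n L γ δ) * growth n L γ δ)
    ≤ consensusGain n L γ
  init : β * (dirWeight n L γ δ * growth n L γ δ) ≤ 1
  progress : β * (dirWeight n L γ δ * growth n L γ δ) ≤ κ * lyapunovRate L γ / 2
  noise : β * (dirWeight n L γ δ * growth n L γ δ * M) ≤ 1

theorem consensusWeight_nonneg {L γ lam : ℝ} (hγ : 0 < γ) (hlam : 0 ≤ lam) :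
    0 ≤ consensusWeight L γ lam := by
  rw [consensusWeight]; positivity

section Positivity

variable {n : ℕ} {L γ δ : ℝ}

theorem gradWeight_pos (hL : 0 < L) (hγ : 0 < γ) : 0 < gradWeight L γ := by
  rw [gradWeight]; positivity

theorem growth_nonneg (hδ : 0 < δ) : 0 ≤ growth n L γ δ := by
  rw [growth]; positivity

theorem consensusGain_pos (hn : 1 ≤ n) (hL : 0 < L) (hγ : 0 < γ) : 0 < consensusGain n L γ := by
  have h1 := consensusWeight_nonneg (L := L) hγ (gradWeight_pos hL hγ).le
  rw [consensusGain]; positivity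

theorem dirWeight_nonneg (hn : 1 ≤ n) (hL : 0 < L) (hγ : 0 < γ) (hδ : 0 < δ) :
    0 ≤ dirWeight n L γ δ := by
  have h1 := consensusGain_pos hn hL hγ
  have h2 : 0 ≤ growth n L γ δ := growth_nonneg hδ
  rw [dirWeight]; positivity

theorem lyapunovRate_pos (hL : 0 < L) (hγ : 0 < γ) : 0 < lyapunovRate L γ := by
  have h1 := gradWeight_pos hL hγ
  exact lt_min (by positivity) (by positivity)

open Filter Topology in
theorem eventually_smallStep (hn : 1 ≤ n) (hL : 0 < L) (hγ : 0 < γ) {κ M : ℝ} (hκ : 0 < κ) :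
    ∀ᶠ β in 𝓝 (0 : ℝ), SmallStep n L γ δ κ M β := by
  have key : ∀ c e : ℝ, 0 < e → ∀ᶠ β in 𝓝 (0 : ℝ), β * c ≤ e := by
    intro c e he
    have h1 : Tendsto (fun β : ℝ => β * c) (𝓝 0) (𝓝 (0 * c)) :=
      (continuous_id.mul continuous_const).tendsto 0
    rw [zero_mul] at h1
    filter_upwards [h1.eventually_lt_const he] with β hβ using hβ.le
  filter_upwards [key 1 1 one_pos, key (8 * L) γ⁻¹ (by positivity),
    key (4 * γ) _ (gradWeight_pos hL hγ),
    key ((4 * consensusGain n L γ / δ + dirWeight n L γ δ) * growth n L γ δ) _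
      (consensusGain_pos hn hL hγ), key (dirWeight n L γ δ * growth n L γ δ) 1 one_pos,
    key (dirWeight n L γ δ * growth n L γ δ) (κ * lyapunovRate L γ / 2)
      (by have := lyapunovRate_pos hL hγ; positivity),
    key (dirWeight n L γ δ * growth n L γ δ * M) 1 one_pos] with β h1 h2 h3 h4 h5 h6 h7
  exact ⟨by simpa using h1, h2, h3, h4, h5, h6, h7⟩

end Positivity

/-- The Lyapunov sum has a consensus error as a source, and the consensus potential has ‖p‖² as a
source. Adding the two estimates closes the loop, because the second source carries β⁵ and is below
half of the Lyapunov decrease. Here a, e, χ, ζ, U stand for the expectations of ‖p‖², the squared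
gradient error and the dispersions of x, z, w. -/
theorem coupled_sequences_le {n N : ℕ} {L γ δ κ M β N₂ C₀ V D : ℝ} {a e χ ζ U α : ℕ → ℝ}
    (hn : 1 ≤ n) (hL' : 0 < L) (hγ : 0 < γ) (hδ : 0 < δ) (hδ1 : δ ≤ 1) (hκ : 0 < κ) (hβ : 0 < β)
    (hN₂ : 0 ≤ N₂) (hC₀ : 0 ≤ C₀) (hV : 0 ≤ V) (hsmall : SmallStep n L γ δ κ M β)
    (hN : N * β ^ 2 ≤ M) (hα : ∀ k, κ * β ≤ α k) (hαβ : ∀ k, α k ≤ β)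
    (ha0 : ∀ k, 0 ≤ a k) (he0 : ∀ k, 0 ≤ e k) (hχ0 : ∀ k, 0 ≤ χ k) (hζ0 : ∀ k, 0 ≤ ζ k)
    (hU0 : ∀ k, 0 ≤ U k) (hχz : χ 0 = 0) (hζz : ζ 0 = 0) (hUz : U 0 ≤ 6 * n * (N₂ + C₀))
    (hχs : ∀ k, χ (k + 1) ≤ (1 - δ / 2) * χ k
      + 2 / δ * (β ^ 2 * (6 * χ k + 4 * γ ^ 2 * ζ k)))
    (hζs : ∀ k, ζ (k + 1) ≤ (1 - δ / 2) * ζ k + 2 / δ * (β ^ 2 * (2 * U k + 2 * ζ k)))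
    (hUs : ∀ k, U (k + 1) ≤ (1 - δ / 2) * U k + 2 / δ * (6 * n * N₂ + 9 * L ^ 2 *
      (χ (k + 1) + χ k + β ^ 2 * (2 * n * a k + 4 * χ k + 4 * γ ^ 2 * ζ k))))
    (hsum : ∑ k ∈ Finset.range N, α k * (γ⁻¹ / 2 * a k + gradWeight L γ / 2 * e k) ≤ D
      + ∑ k ∈ Finset.range N, (α k * (consensusWeight L γ (gradWeight L γ) *
        ((n : ℝ)⁻¹ * (χ k + ζ k))) + α k ^ 2 * V)) :
    κ * β * (lyapunovRate L γ / 2) * ∑ k ∈ Finset.range N, (a k + e k)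
      + β * ∑ k ∈ Finset.range N, L ^ 2 / n * χ k ≤ D + 2 * N₂ + C₀ + M * V := by
  have hn' : (0 : ℝ) < n := by positivity
  have hα0 : ∀ k, 0 < α k := fun k => (mul_pos hκ hβ).trans_le (hα k)
  set lam := gradWeight L γ with hlam
  have hlam0 : 0 < lam := gradWeight_pos hL' hγ
  set p := growth n L γ δ with hp
  set E := consensusGain n L γ with hE
  set B := dirWeight n L γ δ with hB
  set c := lyapunovRate L γ with hc
  have hp0 : 0 ≤ p := growth_nonneg hδ
  have hE0 : 0 < E := consensusGain_pos hn hL' hγ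
  have hB0 : 0 ≤ B := dirWeight_nonneg hn hL' hγ hδ
  have hc0 : 0 < c := lyapunovRate_pos hL' hγ
  have hcw := consensusWeight_nonneg (L := L) hγ hlam0.le
  set Cw := consensusWeight L γ lam with hCw
  have hβ1 := hsmall.le_one
  have hβ21 : β ^ 2 ≤ 1 := pow_le_one₀ hβ.le hβ1
  have hs0 : 0 < 2 / δ := by positivity
  have hs2 : 2 ≤ 2 / δ := by rw [le_div_iff₀ hδ]; linarith
  obtain ⟨T, hT⟩ : ∃ T : ℕ → ℝ, ∀ k, T k = χ k + ζ k := ⟨_, fun _ => rfl⟩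
  have hTn : ∀ k, 0 ≤ T k := fun k => hT k ▸ add_nonneg (hχ0 k) (hζ0 k)
  have hT0 : T 0 = 0 := by
    rw [hT, hχz, hζz, add_zero]
  have hγ2 : 0 ≤ γ ^ 2 := sq_nonneg γ
  have hHT : ∀ k, 6 * χ k + 4 * γ ^ 2 * ζ k ≤ (6 + 4 * γ ^ 2) * T k := by
    intro k
    rw [hT]
    nlinarith [hχ0 k, hζ0 k, mul_nonneg hγ2 (hχ0 k), mul_nonneg hγ2 (hζ0 k)]
  have hTs : ∀ k, T (k + 1) ≤ (1 - δ / 2) * T k + β ^ 2 * (p * (T k + U k)) := by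
    intro k
    have h1 : 2 / δ * (8 + 4 * γ ^ 2) ≤ p := by
      rw [hp, growth]
      refine mul_le_mul_of_nonneg_left ?_ hs0.le
      have : 0 ≤ 6 * (n : ℝ)
        + 9 * L ^ 2 * (6 + 4 * γ ^ 2 + 2 / δ * (6 + 4 * γ ^ 2) + 2 * n) := by positivity
      linarith
    have h2 : 2 / δ * (6 * χ k + 4 * γ ^ 2 * ζ k) + 2 / δ * (2 * U k + 2 * ζ k)
        ≤ p * (T k + U k) := by
      calc _ = 2 / δ * ((6 * χ k + 4 * γ ^ 2 * ζ k) + (2 * U k + 2 * ζ k)) := by ring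
        _ ≤ 2 / δ * ((8 + 4 * γ ^ 2) * (T k + U k)) := by
          refine mul_le_mul_of_nonneg_left ?_ hs0.le
          have := hHT k
          have := mul_nonneg hγ2 (hU0 k)
          have := hU0 k
          have : ζ k ≤ T k := by rw [hT]; linarith [hχ0 k]
          linarith
        _ = 2 / δ * (8 + 4 * γ ^ 2) * (T k + U k) := by ring
        _ ≤ p * (T k + U k) := by
          have := add_nonneg (hTn k) (hU0 k)
          gcongr
    have h3 := mul_le_mul_of_nonneg_left h2 (sq_nonneg β)
    rw [hT (k + 1)]
    have h4 := hχs k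
    have h5 := hζs k
    have h6 := hT k
    rw [h6] at h3 ⊢
    linarith
  have hUs' : ∀ k, U (k + 1) ≤ (1 - δ / 2) * U k + p * (N₂ + T k + β ^ 2 * a k) := by
    intro k
    refine (hUs k).trans (add_le_add le_rfl ?_)
    -- The dispersion at time k + 1 in the recursion of U is reduced to time k, with β² ≤ 1, so that
    -- the pair (T, U) satisfies a closed system.
    have h1 : χ (k + 1) ≤ χ k + 2 / δ * ((6 + 4 * γ ^ 2) * T k) := by
      refine (hχs k).trans (add_le_add ?_ (mul_le_mul_of_nonneg_left ?_ hs0.le))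
      · have := mul_nonneg hδ.le (hχ0 k)
        linarith
      · calc β ^ 2 * (6 * χ k + 4 * γ ^ 2 * ζ k) ≤ 1 * ((6 + 4 * γ ^ 2) * T k) := by
              have h2 : 0 ≤ 6 * χ k + 4 * γ ^ 2 * ζ k := by
                have := hχ0 k
                have := hζ0 k
                positivity
              gcongr
              exact hHT k
          _ = _ := one_mul _
    have h2 : χ k ≤ T k := by rw [hT]; linarith [hζ0 k]
    have h3 : β ^ 2 * (4 * χ k + 4 * γ ^ 2 * ζ k) ≤ (4 + 4 * γ ^ 2) * T k := by
      have h4 : 4 * χ k + 4 * γ ^ 2 * ζ k ≤ (4 + 4 * γ ^ 2) * T k := by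
        rw [hT]
        nlinarith [hχ0 k, hζ0 k, mul_nonneg hγ2 (hχ0 k), mul_nonneg hγ2 (hζ0 k)]
      have h5 : 0 ≤ 4 * χ k + 4 * γ ^ 2 * ζ k := by
        have := hχ0 k
        have := hζ0 k
        positivity
      calc _ ≤ 1 * ((4 + 4 * γ ^ 2) * T k) := by gcongr
        _ = _ := one_mul _
    have hL2 : 0 ≤ L ^ 2 := sq_nonneg _
    have h6 : χ (k + 1) + χ k + β ^ 2 * (2 * n * a k + 4 * χ k + 4 * γ ^ 2 * ζ k)
        ≤ (6 + 4 * γ ^ 2 + 2 / δ * (6 + 4 * γ ^ 2)) * T k + 2 * n * (β ^ 2 * a k) := by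
      linarith
    have hb0 : 0 ≤ β ^ 2 * a k := mul_nonneg (sq_nonneg _) (ha0 k)
    have hTk := hTn k
    set H := 6 + 4 * γ ^ 2 + 2 / δ * (6 + 4 * γ ^ 2) with hH
    have hH0 : 0 ≤ H := by positivity
    calc 2 / δ * (6 * n * N₂
          + 9 * L ^ 2 * (χ (k + 1) + χ k + β ^ 2 * (2 * n * a k + 4 * χ k + 4 * γ ^ 2 * ζ k)))
        ≤ 2 / δ * (6 * n * N₂ + 9 * L ^ 2 * (H * T k + 2 * n * (β ^ 2 * a k))) := by gcongr
      _ ≤ 2 / δ * ((8 + 4 * γ ^ 2 + 6 * n + 9 * L ^ 2 * (H + 2 * n))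
            * (N₂ + T k + β ^ 2 * a k)) := by
          refine mul_le_mul_of_nonneg_left ?_ hs0.le
          have g1 : 0 ≤ (8 + 4 * γ ^ 2) * (N₂ + T k + β ^ 2 * a k) := by positivity
          have g2 : 0 ≤ 6 * n * (T k + β ^ 2 * a k) := by positivity
          have g3 : 0 ≤ 9 * L ^ 2 * (H * (N₂ + β ^ 2 * a k) + 2 * n * (N₂ + T k)) := by
            positivity
          linarith
      _ = p * (N₂ + T k + β ^ 2 * a k) := by rw [hp, growth]; ring
  have hpot := sum_coupled_le hT0 hTn hδ hp0 hβ.le hβ1 hE0.le rfl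
    (show B = 2 * (4 * E / δ) * p / δ by rw [hB, dirWeight]) hsmall.potential hTs hUs' N
  -- the terms of the potential
  have hBp : 0 ≤ B * p := mul_nonneg hB0 hp0
  have t0 : 0 ≤ 4 * E / δ * β * T N + B * β ^ 3 * U N := by
    have := hTn N
    have := hU0 N
    positivity
  have t1 : B * β ^ 3 * U 0 ≤ N₂ + C₀ := by
    have h1 : U 0 ≤ p * (N₂ + C₀) := by
      refine hUz.trans ?_
      have h2 : 6 * (n : ℝ) ≤ p := by
        have h3 : 0 ≤ 8 + 4 * γ ^ 2
            + 9 * L ^ 2 * (6 + 4 * γ ^ 2 + 2 / δ * (6 + 4 * γ ^ 2) + 2 * n) := by positivity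
        have h4 : (1 : ℝ) * (6 * n) ≤ 2 / δ * (8 + 4 * γ ^ 2 + 6 * n
            + 9 * L ^ 2 * (6 + 4 * γ ^ 2 + 2 / δ * (6 + 4 * γ ^ 2) + 2 * n)) :=
          mul_le_mul (by linarith) (by linarith) (by positivity) hs0.le
        rw [hp, growth]; linarith
      have := add_nonneg hN₂ hC₀
      gcongr
    calc B * β ^ 3 * U 0 ≤ B * β ^ 3 * (p * (N₂ + C₀)) := by gcongr
      _ = β ^ 2 * (β * (B * p)) * (N₂ + C₀) := by ring
      _ ≤ 1 * 1 * (N₂ + C₀) := by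
        have := add_nonneg hN₂ hC₀
        gcongr
        exact hsmall.init
      _ = _ := by ring
  -- Of the three powers of β, two pay for the number of steps through Nβ² ≤ M. The remaining one
  -- makes the network-dependent factor BpM harmless.
  have t2 : N * (B * β ^ 3 * (p * N₂)) ≤ N₂ := by
    calc N * (B * β ^ 3 * (p * N₂)) = (N * β ^ 2) * (β * (B * p)) * N₂ := by ring
      _ ≤ M * (β * (B * p)) * N₂ := by gcongr
      _ = β * (B * p * M) * N₂ := by ring
      _ ≤ 1 * N₂ := by gcongr; exact hsmall.noise
      _ = N₂ := one_mul _
  have hsa0 : 0 ≤ ∑ k ∈ Finset.range N, a k := Finset.sum_nonneg fun k _ => ha0 k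
  have hse0 : 0 ≤ ∑ k ∈ Finset.range N, e k := Finset.sum_nonneg fun k _ => he0 k
  -- This takes half of the Lyapunov decrease in ‖p‖², hence the rate c/2 in the conclusion.
  have t3 : B * β ^ 5 * p * ∑ k ∈ Finset.range N, a k
      ≤ κ * β * (c / 2) * ∑ k ∈ Finset.range N, a k := by
    refine mul_le_mul_of_nonneg_right ?_ hsa0
    calc B * β ^ 5 * p = β * β * β ^ 2 * (β * (B * p)) := by ring
      _ ≤ β * 1 * 1 * (κ * c / 2) := by
        gcongr
        exact hsmall.progress
      _ = κ * β * (c / 2) := by ring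
  -- the Lyapunov sum
  have u1 : κ * β * c * (∑ k ∈ Finset.range N, (a k + e k))
      ≤ ∑ k ∈ Finset.range N, α k * (γ⁻¹ / 2 * a k + lam / 2 * e k) := by
    rw [Finset.mul_sum]
    refine Finset.sum_le_sum fun k _ => ?_
    rw [mul_assoc]
    have h1 : c ≤ γ⁻¹ / 2 := min_le_left _ _
    have h2 : c ≤ lam / 2 := min_le_right _ _
    have := ha0 k
    have := he0 k
    have := hα k
    rw [mul_add c]
    gcongr
    exact (hα0 k).le
  have u2 : ∑ k ∈ Finset.range N, (α k * (Cw * ((n : ℝ)⁻¹ * (χ k + ζ k)))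
        + α k ^ 2 * V)
      ≤ β * (Cw * (n : ℝ)⁻¹) * (∑ k ∈ Finset.range N, T k)
        + M * V := by
    have h1 : ∀ k ∈ Finset.range N, α k * (Cw * ((n : ℝ)⁻¹ * (χ k + ζ k)))
        + α k ^ 2 * V ≤ β * (Cw * (n : ℝ)⁻¹) * T k
        + β ^ 2 * V := by
      intro k _
      rw [← hT k]
      have := hTn k
      have := hαβ k
      have := (hα0 k).le
      have h2 : α k * (Cw * ((n : ℝ)⁻¹ * T k)) ≤ β * (Cw * ((n : ℝ)⁻¹ * T k)) := by gcongr
      have h3 : α k ^ 2 * V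
        ≤ β ^ 2 * V := by gcongr
      linarith
    refine (Finset.sum_le_sum h1).trans ?_
    rw [Finset.sum_add_distrib, ← Finset.mul_sum, Finset.sum_const, Finset.card_range,
      nsmul_eq_mul, ← mul_assoc (N : ℝ)]
    gcongr
  -- The gain E has two parts: the one with `Cw` cancels the consensus term of the Lyapunov sum, and
  -- L²/n yields the consensus error of the conclusion.
  have u3 : β * E * ∑ k ∈ Finset.range N, T k = β * (Cw * (n : ℝ)⁻¹) * (∑ k ∈ Finset.range N, T k)
      + β * (L ^ 2 / n) * ∑ k ∈ Finset.range N, T k := by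
    rw [hE, consensusGain, ← hlam, ← hCw, div_eq_mul_inv]; ring
  have u4 : β * ∑ k ∈ Finset.range N, L ^ 2 / n * χ k
      ≤ β * (L ^ 2 / n) * ∑ k ∈ Finset.range N, T k := by
    rw [← Finset.mul_sum, ← mul_assoc]
    gcongr with k
    rw [hT]; linarith [hζ0 k]
  have u5 : 0 ≤ κ * β * (c / 2) * ∑ k ∈ Finset.range N, e k := by positivity
  rw [Finset.sum_add_distrib] at u1 ⊢
  linarith

/-! ### The combined estimate in expectation for a run -/

section Run

variable {n d : ℕ} {S : Type*} [MeasurableSpace S] {Ω : Type*} [MeasurableSpace Ω]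
  {P : Problem n d S} {L : NNReal} {W : Matrix (Fin n) (Fin n) ℝ} {m : ℕ} {γ : ℝ}
  {α : ℕ → ℝ} {μ : Measure Ω} {ξ : ℕ → Fin n → Ω → S} {x z w : ℕ → Ω → Fin n → Vec d}
  {σs : Fin n → ℝ}

/-- The recursion of the dispersion of the directions that both algorithms satisfy. -/
structure DirectionBound (P : Problem n d S) (L γ δ β N₂ C₀ : ℝ) (μ : Measure Ω)
    (x z w : ℕ → Ω → Fin n → Vec d) : Prop where
  zero : ∫ ω, dev (w 0 ω) ∂μ ≤ 6 * n * (N₂ + C₀)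
  succ : ∀ k, ∫ ω, dev (w (k + 1) ω) ∂μ ≤ (1 - δ / 2) * ∫ ω, dev (w k ω) ∂μ
    + 2 / δ * (6 * n * N₂ + 9 * L ^ 2 * (∫ ω, dev (x (k + 1) ω) ∂μ + ∫ ω, dev (x k ω) ∂μ
      + β ^ 2 * (2 * n * ∫ ω, ‖avgStep P.Ψ γ (x k ω) (z k ω)‖ ^ 2 ∂μ + 4 * ∫ ω, dev (x k ω) ∂μ
        + 4 * γ ^ 2 * ∫ ω, dev (z k ω) ∂μ)))

variable [IsProbabilityMeasure μ]

theorem IsRun.main_bound (h : IsRun P W m γ α μ ξ x z w) (hW : IsGossip W) (hO : Oracle P σs μ ξ)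
    (hS : P.Smooth L) (hR : P.Regular) (hΨ : ClosedProperConvex P.Ψ) (hn : 1 ≤ n) (hL : 0 < L)
    (hγ : 0 < γ) {σ Φinf C₀ N₂ δ κ β M : ℝ}
    (hσ : (n : ℝ)⁻¹ * ∑ i, σs i ^ 2 ≤ σ ^ 2) (hΦ : ∀ x, (Φinf : EReal) ≤ P.Phi x)
    (h0 : P.Ψ 0 ≠ ⊤) (hC₀ : 0 ≤ C₀) (hN₂ : 0 ≤ N₂) (hδ : 0 < δ)
    (hδ1 : δ ≤ 1) (hρ : rho W ^ (2 * m) ≤ 1 - δ) (hκ : 0 < κ) (hβ : 0 < β)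
    (hα : ∀ k, κ * β ≤ α k) (hαβ : ∀ k, α k ≤ β) (hsmall : SmallStep n L γ δ κ M β)
    (hU : DirectionBound P L γ δ β N₂ C₀ μ x z w) (N : ℕ) (hN : N * β ^ 2 ≤ M) :
    κ * β * (lyapunovRate L γ / 2) * ∑ k ∈ Finset.range N,
        (∫ ω, ‖avgStep P.Ψ γ (x k ω) (z k ω)‖ ^ 2 ∂μ
          + ∫ ω, ‖avg (z k ω) - gradient P.F (avg (x k ω))‖ ^ 2 ∂μ)
      + β * ∑ k ∈ Finset.range N, L ^ 2 / n * ∫ ω, dev (x k ω) ∂μ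
      ≤ lyapunov P γ (gradWeight L γ) 0 0 - Φinf + 2 * N₂ + C₀
        + M * ((γ / 2 + gradWeight L γ) * (σ ^ 2 / n)) := by
  have hL' : (0 : ℝ) < L := by exact_mod_cast hL
  have hn' : (0 : ℝ) < n := by positivity
  set lam := gradWeight L γ with hlam
  have hlam0 : 0 < lam := gradWeight_pos hL' hγ
  have hα0 : ∀ k, 0 < α k := fun k => (mul_pos hκ hβ).trans_le (hα k)
  have hsum := h.sum_le hW hO hS hR hΨ hn hL hγ (lam := lam) rfl hσ hΦ h0 hα0
    (fun k => (hαβ k).trans hsmall.le_one)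
    (fun k => le_trans (by rw [mul_comm β]; gcongr; exact hαβ k) hsmall.smooth)
    (fun k => le_trans (by rw [mul_comm β]; gcongr; exact hαβ k) hsmall.dual) N
  obtain ⟨a, ha⟩ : ∃ a : ℕ → ℝ, ∀ k, a k = ∫ ω, ‖avgStep P.Ψ γ (x k ω) (z k ω)‖ ^ 2 ∂μ :=
    ⟨_, fun _ => rfl⟩
  obtain ⟨e, he⟩ : ∃ e : ℕ → ℝ, ∀ k, e k
      = ∫ ω, ‖avg (z k ω) - gradient P.F (avg (x k ω))‖ ^ 2 ∂μ := ⟨_, fun _ => rfl⟩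
  obtain ⟨χ, hχ⟩ : ∃ χ : ℕ → ℝ, ∀ k, χ k = ∫ ω, dev (x k ω) ∂μ := ⟨_, fun _ => rfl⟩
  obtain ⟨ζ, hζ⟩ : ∃ ζ : ℕ → ℝ, ∀ k, ζ k = ∫ ω, dev (z k ω) ∂μ := ⟨_, fun _ => rfl⟩
  obtain ⟨U, hUd⟩ : ∃ U : ℕ → ℝ, ∀ k, U k = ∫ ω, dev (w k ω) ∂μ := ⟨_, fun _ => rfl⟩
  have ha0 : ∀ k, 0 ≤ a k := fun k => ha k ▸ integral_nonneg fun ω => sq_nonneg _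
  have he0 : ∀ k, 0 ≤ e k := fun k => he k ▸ integral_nonneg fun ω => sq_nonneg _
  have hχ0 : ∀ k, 0 ≤ χ k := fun k => hχ k ▸ integral_nonneg fun ω => dev_nonneg _
  have hζ0 : ∀ k, 0 ≤ ζ k := fun k => hζ k ▸ integral_nonneg fun ω => dev_nonneg _
  have hU0 : ∀ k, 0 ≤ U k := fun k => hUd k ▸ integral_nonneg fun ω => dev_nonneg _
  have hχs : ∀ k, χ (k + 1) ≤ (1 - δ / 2) * χ k
      + 2 / δ * (β ^ 2 * (6 * χ k + 4 * γ ^ 2 * ζ k)) := by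
    intro k
    have i1 := integrable_dev (h.memLp_x k)
    have i2 := integrable_dev (h.memLp_z k)
    have h1 := integral_mono (integrable_dev (h.memLp_x (k + 1)))
      ((i1.const_mul (1 - δ / 2)).add
        ((((i1.const_mul 6).add (i2.const_mul (4 * γ ^ 2))).const_mul (β ^ 2)).const_mul (2 / δ)))
      (fun ω => h.dev_x_succ_le hW hΨ hn hγ hδ hδ1 hρ hα0 hαβ k ω)
    have h2 := integral_add (i1.const_mul (1 - δ / 2))
        ((((i1.const_mul 6).add (i2.const_mul (4 * γ ^ 2))).const_mul (β ^ 2)).const_mul (2 / δ))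
    have h3 := integral_add (i1.const_mul 6) (i2.const_mul (4 * γ ^ 2))
    simp only [Pi.add_apply, integral_const_mul] at h1 h2 h3
    rw [h2, h3] at h1
    rw [hχ, hχ, hζ]
    exact h1
  have hζs : ∀ k, ζ (k + 1) ≤ (1 - δ / 2) * ζ k + 2 / δ * (β ^ 2 * (2 * U k + 2 * ζ k)) := by
    intro k
    have i1 := integrable_dev (h.memLp_w k)
    have i2 := integrable_dev (h.memLp_z k)
    have h1 := integral_mono (integrable_dev (h.memLp_z (k + 1)))
      ((i2.const_mul (1 - δ / 2)).add
        ((((i1.const_mul 2).add (i2.const_mul 2)).const_mul (β ^ 2)).const_mul (2 / δ)))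
      (fun ω => h.dev_z_succ_le hW hn hδ hδ1 hρ hα0 hαβ k ω)
    have h2 := integral_add (i2.const_mul (1 - δ / 2))
        ((((i1.const_mul 2).add (i2.const_mul 2)).const_mul (β ^ 2)).const_mul (2 / δ))
    have h3 := integral_add (i1.const_mul 2) (i2.const_mul 2)
    simp only [Pi.add_apply, integral_const_mul] at h1 h2 h3
    rw [h2, h3] at h1
    rw [hζ, hζ, hUd]
    exact h1
  have hUz := hU.zero
  have hUs := hU.succ
  simp only [← ha, ← he, ← hχ, ← hζ, ← hUd] at hsum hUz hUs ⊢
  have hV : 0 ≤ (γ / 2 + lam) * (σ ^ 2 / n) := by positivity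
  exact coupled_sequences_le hn hL' hγ hδ hδ1 hκ hβ hN₂ hC₀ hV hsmall hN hα hαβ ha0 he0 hχ0 hζ0 hU0
    (by rw [hχ]; simp [h.x_zero, dev_zero]) (by rw [hζ]; simp [h.z_zero, dev_zero]) hUz hχs hζs hUs
    hsum

end Run

section Algorithms

variable {n d : ℕ} {S : Type*} [MeasurableSpace S] {Ω : Type*} [MeasurableSpace Ω]
  {P : Problem n d S} {L : NNReal} {W : Matrix (Fin n) (Fin n) ℝ} {m : ℕ} {γ : ℝ}
  {α : ℕ → ℝ} {μ : Measure Ω} {ξ : ℕ → Fin n → Ω → S} {x : Ω → Fin n → Vec d}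
  {σs : Fin n → ℝ}

theorem measurable_stochGrad {A : Type*} {_ : MeasurableSpace A} (hR : P.Regular) (i : Fin n)
    {x : A → Vec d} {s : A → S} (hx : Measurable x) (hs : Measurable s) :
    Measurable fun a => P.stochGrad i (x a) (s a) :=
  (hR.measurable i).comp (hx.prodMk hs)

theorem stochGrad_eq (P : Problem n d S) (i : Fin n) (x : Vec d) (s : S) :
    P.stochGrad i x s = P.noise i x s + gradient (P.locF i) x := by
  rw [Problem.noise_eq, sub_add_cancel]

theorem Oracle.memLp_stochGrad [IsProbabilityMeasure μ] (hO : Oracle P σs μ ξ) (hS : P.Smooth L)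
    (hR : P.Regular) (k : ℕ) (i : Fin n) {x : Ω → Vec d} (hx : Measurable[sampleFiltration ξ k] x)
    (hx2 : MemLp x 2 μ) : MemLp (fun ω => P.stochGrad i (x ω) (ξ (k + 1) i ω)) 2 μ := by
  simp only [stochGrad_eq]
  exact (hO.memLp_noise hS hR k i hx).fun_add (memLp_lipschitz_comp (hS.lipschitz i) hx2)

theorem Oracle.sum_integral_noise_sq_le [IsProbabilityMeasure μ] (hO : Oracle P σs μ ξ)
    (hS : P.Smooth L) (hR : P.Regular) (hn : 1 ≤ n) {σ : ℝ}
    (hσ : (n : ℝ)⁻¹ * ∑ i, σs i ^ 2 ≤ σ ^ 2) (k : ℕ)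
    (hx : ∀ i, Measurable[sampleFiltration ξ k] fun ω => x ω i) :
    Integrable (fun ω => ∑ i, ‖P.noise i (x ω i) (ξ (k + 1) i ω)‖ ^ 2) μ ∧
    ∫ ω, ∑ i, ‖P.noise i (x ω i) (ξ (k + 1) i ω)‖ ^ 2 ∂μ ≤ n * σ ^ 2 := by
  have hn' : (0 : ℝ) < n := by positivity
  have h1 : ∀ i, Integrable (fun ω => ‖P.noise i (x ω i) (ξ (k + 1) i ω)‖ ^ 2) μ :=
    fun i => (hO.memLp_noise hS hR k i (hx i)).norm.integrable_sq
  refine ⟨integrable_finsetSum _ fun i _ => h1 i, ?_⟩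
  rw [integral_finsetSum _ fun i _ => h1 i]
  refine (Finset.sum_le_sum fun i _ => hO.integral_noise_sq_le k i (hx i)).trans ?_
  rwa [inv_mul_le_iff₀ hn'] at hσ

/-! ### Prox-DASA -/

/-- The primal variables of Prox-DASA as a process. -/
noncomputable def dasaX (P : Problem n d S) (W : Matrix (Fin n) (Fin n) ℝ) (m : ℕ) (γ : ℝ)
    (α : ℕ → ℝ) (ξ : ℕ → Fin n → Ω → S) (k : ℕ) (ω : Ω) : Fin n → Vec d :=
  (dasa P W m γ α (fun t j => ξ t j ω) k).x

/-- The dual variables of Prox-DASA as a process. -/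
noncomputable def dasaZ (P : Problem n d S) (W : Matrix (Fin n) (Fin n) ℝ) (m : ℕ) (γ : ℝ)
    (α : ℕ → ℝ) (ξ : ℕ → Fin n → Ω → S) (k : ℕ) (ω : Ω) : Fin n → Vec d :=
  (dasa P W m γ α (fun t j => ξ t j ω) k).z

/-- The stochastic gradients of Prox-DASA as a process. -/
noncomputable def dasaV (P : Problem n d S) (W : Matrix (Fin n) (Fin n) ℝ) (m : ℕ) (γ : ℝ)
    (α : ℕ → ℝ) (ξ : ℕ → Fin n → Ω → S) (k : ℕ) (ω : Ω) : Fin n → Vec d :=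
  fun i => P.stochGrad i (dasaX P W m γ α ξ k ω i) (ξ (k + 1) i ω)

omit [MeasurableSpace Ω] in
theorem dasaX_succ (k : ℕ) (ω : Ω) : dasaX P W m γ α ξ (k + 1) ω
    = mix (W ^ m) (fun i => (1 - α k) • dasaX P W m γ α ξ k ω i
      + α k • proxStep P.Ψ γ (dasaX P W m γ α ξ k ω) (dasaZ P W m γ α ξ k ω) i) := rfl

omit [MeasurableSpace Ω] in
theorem dasaZ_succ (k : ℕ) (ω : Ω) : dasaZ P W m γ α ξ (k + 1) ω
    = mix (W ^ m) (fun i => (1 - α k) • dasaZ P W m γ α ξ k ω i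
      + α k • dasaV P W m γ α ξ k ω i) := rfl

omit [MeasurableSpace Ω] in
theorem measurable_dasa (hR : P.Regular) (hΨ : ClosedProperConvex P.Ψ) (hγ : 0 < γ)
    (k : ℕ) : ∀ i, Measurable[sampleFiltration ξ k] (fun ω => dasaX P W m γ α ξ k ω i) ∧
      Measurable[sampleFiltration ξ k] (fun ω => dasaZ P W m γ α ξ k ω i) := by
  induction k with
  | zero => exact fun i => ⟨measurable_const, measurable_const⟩
  | succ k ih =>
    have hx : ∀ i, Measurable[sampleFiltration ξ (k + 1)]
        (fun ω => dasaX P W m γ α ξ k ω i) :=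
      fun i => (ih i).1.mono (sampleFiltration_mono ξ k.le_succ) le_rfl
    have hz : ∀ i, Measurable[sampleFiltration ξ (k + 1)]
        (fun ω => dasaZ P W m γ α ξ k ω i) :=
      fun i => (ih i).2.mono (sampleFiltration_mono ξ k.le_succ) le_rfl
    have hv : ∀ i, Measurable[sampleFiltration ξ (k + 1)]
        (fun ω => dasaV P W m γ α ξ k ω i) :=
      fun i => measurable_stochGrad hR i (hx i) (measurable_sample ξ k i)
    intro i
    simp only [dasaX_succ, dasaZ_succ]
    exact ⟨measurable_mix _ (fun i => ((hx i).fun_const_smul _).fun_add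
      ((measurable_proxStep hΨ hγ hx hz i).fun_const_smul _)) i,
      measurable_mix _ (fun i => ((hz i).fun_const_smul _).fun_add ((hv i).fun_const_smul _)) i⟩

theorem memLp_dasa [IsProbabilityMeasure μ] (hO : Oracle P σs μ ξ) (hS : P.Smooth L)
    (hR : P.Regular) (hΨ : ClosedProperConvex P.Ψ) (hγ : 0 < γ)
    (k : ℕ) : ∀ i, MemLp (fun ω => dasaX P W m γ α ξ k ω i) 2 μ ∧
      MemLp (fun ω => dasaZ P W m γ α ξ k ω i) 2 μ := by
  induction k with
  | zero => exact fun i => ⟨memLp_const (0 : Vec d), memLp_const (0 : Vec d)⟩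
  | succ k ih =>
    have hv : ∀ i, MemLp (fun ω => dasaV P W m γ α ξ k ω i) 2 μ := fun i =>
      hO.memLp_stochGrad hS hR k i (measurable_dasa hR hΨ hγ k i).1 (ih i).1
    intro i
    simp only [dasaX_succ, dasaZ_succ]
    exact ⟨memLp_mix _ (fun i => ((ih i).1.fun_const_smul _).fun_add
      ((memLp_proxStep hΨ hγ (fun i => (ih i).1) (fun i => (ih i).2) i).fun_const_smul _)) i,
      memLp_mix _ (fun i => ((ih i).2.fun_const_smul _).fun_add ((hv i).fun_const_smul _)) i⟩

theorem isRun_dasa [IsProbabilityMeasure μ] (hO : Oracle P σs μ ξ) (hS : P.Smooth L)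
    (hR : P.Regular) (hΨ : ClosedProperConvex P.Ψ) (hγ : 0 < γ) :
    IsRun P W m γ α μ ξ (dasaX P W m γ α ξ) (dasaZ P W m γ α ξ) (dasaV P W m γ α ξ) where
  x_zero _ := rfl
  z_zero _ := rfl
  x_succ k ω := dasaX_succ k ω
  z_succ k ω := dasaZ_succ k ω
  avg_w _ _ := rfl
  measurable_x k i := (measurable_dasa hR hΨ hγ k i).1
  measurable_z k i := (measurable_dasa hR hΨ hγ k i).2
  memLp_x k i := (memLp_dasa hO hS hR hΨ hγ k i).1
  memLp_z k i := (memLp_dasa hO hS hR hΨ hγ k i).2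
  memLp_w k i := hO.memLp_stochGrad hS hR k i (measurable_dasa hR hΨ hγ k i).1
    (memLp_dasa hO hS hR hΨ hγ k i).1

/-- Here the dispersion of the stochastic gradients is bounded at each time by noise, ν² and L²
times the dispersion of x. The recursion follows because its contraction term is nonnegative and 1 ≤
2/δ; it is stated so that both algorithms share one analysis. -/
theorem directionBound_dasa [IsProbabilityMeasure μ] (hO : Oracle P σs μ ξ) (hS : P.Smooth L)
    (hR : P.Regular) (hΨ : ClosedProperConvex P.Ψ) (hn : 1 ≤ n) (hγ : 0 < γ)
    {σ ν δ β C₀ : ℝ} (hσ : (n : ℝ)⁻¹ * ∑ i, σs i ^ 2 ≤ σ ^ 2) (hC₀ : 0 ≤ C₀)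
    (hδ : 0 < δ) (hδ1 : δ ≤ 1) (hν : P.BoundedHeterogeneity ν) :
    DirectionBound P L γ δ β (σ ^ 2 + ν ^ 2) C₀ μ (dasaX P W m γ α ξ) (dasaZ P W m γ α ξ)
      (dasaV P W m γ α ξ) := by
  have hrun : IsRun P W m γ α μ ξ _ _ _ := isRun_dasa hO hS hR hΨ hγ
  have key : ∀ k, ∫ ω, dev (dasaV P W m γ α ξ k ω) ∂μ
      ≤ 3 * (n * (σ ^ 2 + ν ^ 2)) + 3 * L ^ 2 * ∫ ω, dev (dasaX P W m γ α ξ k ω) ∂μ := by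
    intro k
    obtain ⟨i1, h1⟩ := hO.sum_integral_noise_sq_le hS hR hn hσ k (hrun.measurable_x k)
    have i2 := integrable_dev (hrun.memLp_x k)
    have hpt : ∀ ω, dev (dasaV P W m γ α ξ k ω)
        ≤ 3 * (∑ i, ‖P.noise i (dasaX P W m γ α ξ k ω i) (ξ (k + 1) i ω)‖ ^ 2)
          + 3 * L ^ 2 * dev (dasaX P W m γ α ξ k ω) + 3 * (n * ν ^ 2) := by
      intro ω
      set X := dasaX P W m γ α ξ k ω
      refine (dev_le_sum hn _ (gradient P.F (avg X))).trans ?_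
      have h2 : ∀ i, ‖dasaV P W m γ α ξ k ω i - gradient P.F (avg X)‖ ^ 2
          ≤ 3 * ‖P.noise i (X i) (ξ (k + 1) i ω)‖ ^ 2 + 3 * (L ^ 2 * ‖X i - avg X‖ ^ 2)
            + 3 * ν ^ 2 := by
        intro i
        have h3 := norm_add_sq_le_three (P.noise i (X i) (ξ (k + 1) i ω))
          (gradient (P.locF i) (X i) - gradient (P.locF i) (avg X))
          (gradient (P.locF i) (avg X) - gradient P.F (avg X))
        have h4 : P.noise i (X i) (ξ (k + 1) i ω)
            + (gradient (P.locF i) (X i) - gradient (P.locF i) (avg X))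
            + (gradient (P.locF i) (avg X) - gradient P.F (avg X))
            = dasaV P W m γ α ξ k ω i - gradient P.F (avg X) := by
          rw [dasaV, stochGrad_eq]; abel
        rw [h4] at h3
        have h5 := hS.norm_gradient_sub_sq_le i (X i) (avg X)
        have h6 := hν i (avg X)
        have h7 : ‖gradient (P.locF i) (avg X) - gradient P.F (avg X)‖ ^ 2 ≤ ν ^ 2 := by gcongr
        linarith
      refine (Finset.sum_le_sum fun i _ => h2 i).trans (le_of_eq ?_)
      simp only [Finset.sum_add_distrib, ← Finset.mul_sum, Finset.sum_const, Finset.card_univ,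
        Fintype.card_fin, nsmul_eq_mul, dev]
      ring
    have h2 := integral_mono (integrable_dev (hrun.memLp_w k))
      (((i1.const_mul 3).add (i2.const_mul (3 * (L : ℝ) ^ 2))).add
        (integrable_const (3 * (n * ν ^ 2)))) hpt
    have h3 := integral_add ((i1.const_mul 3).add (i2.const_mul (3 * (L : ℝ) ^ 2)))
        (integrable_const (3 * (n * ν ^ 2)))
    have h4 := integral_add (i1.const_mul 3) (i2.const_mul (3 * (L : ℝ) ^ 2))
    simp only [Pi.add_apply, integral_const_mul, integral_const, probReal_univ, one_smul]
      at h2 h3 h4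
    rw [h3, h4] at h2
    linarith
  have hχ0 : ∀ k, 0 ≤ ∫ ω, dev (dasaX P W m γ α ξ k ω) ∂μ :=
    fun k => integral_nonneg fun ω => dev_nonneg _
  have hs2 : 2 ≤ 2 / δ := by rw [le_div_iff₀ hδ]; linarith
  refine ⟨?_, fun k => ?_⟩
  · have h1 := key 0
    have h2 : ∫ ω, dev (dasaX P W m γ α ξ 0 ω) ∂μ = 0 := by
      simp [hrun.x_zero, dev_zero]
    rw [h2] at h1
    have : (0 : ℝ) ≤ n * (σ ^ 2 + ν ^ 2) := by positivity
    have : (0 : ℝ) ≤ n * C₀ := by positivity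
    linarith
  · have h0 : 0 ≤ (1 - δ / 2) * ∫ ω, dev (dasaV P W m γ α ξ k ω) ∂μ :=
      mul_nonneg (by linarith) (integral_nonneg fun ω => dev_nonneg _)
    refine (key (k + 1)).trans ((le_add_of_nonneg_left h0).trans (add_le_add le_rfl ?_))
    have g1 : 0 ≤ ∫ ω, ‖avgStep P.Ψ γ (dasaX P W m γ α ξ k ω) (dasaZ P W m γ α ξ k ω)‖ ^ 2 ∂μ :=
      integral_nonneg fun ω => sq_nonneg _
    have g2 : 0 ≤ ∫ ω, dev (dasaZ P W m γ α ξ k ω) ∂μ := integral_nonneg fun ω => dev_nonneg _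
    have g3 := hχ0 k
    have g4 := hχ0 (k + 1)
    set X' := ∫ ω, dev (dasaX P W m γ α ξ (k + 1) ω) ∂μ
    set Y := ∫ ω, dev (dasaX P W m γ α ξ k ω) ∂μ + β ^ 2 * (2 * n * ∫ ω, ‖avgStep P.Ψ γ
      (dasaX P W m γ α ξ k ω) (dasaZ P W m γ α ξ k ω)‖ ^ 2 ∂μ
        + 4 * ∫ ω, dev (dasaX P W m γ α ξ k ω) ∂μ
        + 4 * γ ^ 2 * ∫ ω, dev (dasaZ P W m γ α ξ k ω) ∂μ) with hY
    have hY0 : 0 ≤ Y := by positivity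
    have h5 : (0 : ℝ) ≤ n * (σ ^ 2 + ν ^ 2) := by positivity
    have h6 : 0 ≤ (L : ℝ) ^ 2 * X' := by positivity
    have h7 : 0 ≤ (L : ℝ) ^ 2 * Y := by positivity
    calc 3 * (n * (σ ^ 2 + ν ^ 2)) + 3 * L ^ 2 * X'
        ≤ 1 * (6 * n * (σ ^ 2 + ν ^ 2) + 9 * L ^ 2 * (X' + Y)) := by linarith
      _ ≤ 2 / δ * (6 * n * (σ ^ 2 + ν ^ 2) + 9 * L ^ 2 * (X' + Y)) :=
        mul_le_mul_of_nonneg_right (by linarith) (by positivity)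
      _ = _ := by rw [hY]; ring

end Algorithms

/-! ### Prox-DASA-GT -/

section GradientTracking

variable {n d : ℕ} {S : Type*} [MeasurableSpace S] {Ω : Type*} [MeasurableSpace Ω]
  {P : Problem n d S} {L : NNReal} {W : Matrix (Fin n) (Fin n) ℝ} {m : ℕ} {γ : ℝ}
  {α : ℕ → ℝ} {μ : Measure Ω} {ξ : ℕ → Fin n → Ω → S}
  {σs : Fin n → ℝ}

/-- The primal variables of Prox-DASA-GT as a process. -/
noncomputable def gtX (P : Problem n d S) (W : Matrix (Fin n) (Fin n) ℝ) (m : ℕ) (γ : ℝ)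
    (α : ℕ → ℝ) (ξ : ℕ → Fin n → Ω → S) (k : ℕ) (ω : Ω) : Fin n → Vec d :=
  (dasaGT P W m γ α (fun t j => ξ t j ω) k).x

/-- The dual variables of Prox-DASA-GT as a process. -/
noncomputable def gtZ (P : Problem n d S) (W : Matrix (Fin n) (Fin n) ℝ) (m : ℕ) (γ : ℝ)
    (α : ℕ → ℝ) (ξ : ℕ → Fin n → Ω → S) (k : ℕ) (ω : Ω) : Fin n → Vec d :=
  (dasaGT P W m γ α (fun t j => ξ t j ω) k).z

/-- The tracking variables of Prox-DASA-GT as a process. -/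
noncomputable def gtU (P : Problem n d S) (W : Matrix (Fin n) (Fin n) ℝ) (m : ℕ) (γ : ℝ)
    (α : ℕ → ℝ) (ξ : ℕ → Fin n → Ω → S) (k : ℕ) (ω : Ω) : Fin n → Vec d :=
  (dasaGTFull P W m γ α (fun t j => ξ t j ω) k).u

/-- The last stochastic gradients of Prox-DASA-GT as a process. -/
noncomputable def gtV (P : Problem n d S) (W : Matrix (Fin n) (Fin n) ℝ) (m : ℕ) (γ : ℝ)
    (α : ℕ → ℝ) (ξ : ℕ → Fin n → Ω → S) (k : ℕ) (ω : Ω) : Fin n → Vec d :=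
  (dasaGTFull P W m γ α (fun t j => ξ t j ω) k).v

/-- The tracking variables of Prox-DASA-GT before mixing. -/
noncomputable def gtDir (P : Problem n d S) (W : Matrix (Fin n) (Fin n) ℝ) (m : ℕ) (γ : ℝ)
    (α : ℕ → ℝ) (ξ : ℕ → Fin n → Ω → S) (k : ℕ) (ω : Ω) : Fin n → Vec d :=
  fun i => gtU P W m γ α ξ k ω i + gtV P W m γ α ξ (k + 1) ω i - gtV P W m γ α ξ k ω i

omit [MeasurableSpace Ω] in
theorem gtX_succ (k : ℕ) (ω : Ω) : gtX P W m γ α ξ (k + 1) ω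
    = mix (W ^ m) (fun i => (1 - α k) • gtX P W m γ α ξ k ω i
      + α k • proxStep P.Ψ γ (gtX P W m γ α ξ k ω) (gtZ P W m γ α ξ k ω) i) := rfl

omit [MeasurableSpace Ω] in
theorem gtZ_succ (k : ℕ) (ω : Ω) : gtZ P W m γ α ξ (k + 1) ω
    = mix (W ^ m) (fun i => (1 - α k) • gtZ P W m γ α ξ k ω i
      + α k • gtDir P W m γ α ξ k ω i) := rfl

omit [MeasurableSpace Ω] in
theorem gtU_succ (k : ℕ) (ω : Ω) : gtU P W m γ α ξ (k + 1) ω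
    = mix (W ^ m) (gtDir P W m γ α ξ k ω) := rfl

omit [MeasurableSpace Ω] in
theorem gtV_succ (k : ℕ) (ω : Ω) (i : Fin n) : gtV P W m γ α ξ (k + 1) ω i
    = P.stochGrad i (gtX P W m γ α ξ k ω i) (ξ (k + 1) i ω) := rfl

omit [MeasurableSpace Ω] in
theorem measurable_gt (hR : P.Regular) (hΨ : ClosedProperConvex P.Ψ) (hγ : 0 < γ)
    (k : ℕ) : (∀ i, Measurable[sampleFiltration ξ k] (fun ω => gtX P W m γ α ξ k ω i)) ∧
      (∀ i, Measurable[sampleFiltration ξ k] (fun ω => gtZ P W m γ α ξ k ω i)) ∧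
      (∀ i, Measurable[sampleFiltration ξ k] (fun ω => gtU P W m γ α ξ k ω i)) ∧
      (∀ i, Measurable[sampleFiltration ξ k] (fun ω => gtV P W m γ α ξ k ω i)) := by
  induction k with
  | zero => exact ⟨fun i => measurable_const, fun i => measurable_const,
      fun i => measurable_const, fun i => measurable_const⟩
  | succ k ih =>
    obtain ⟨ihx, ihz, ihu, ihv⟩ := ih
    have hle := sampleFiltration_mono ξ k.le_succ
    have hx : ∀ i, Measurable[sampleFiltration ξ (k + 1)] (fun ω => gtX P W m γ α ξ k ω i) :=
      fun i => (ihx i).mono hle le_rfl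
    have hz : ∀ i, Measurable[sampleFiltration ξ (k + 1)] (fun ω => gtZ P W m γ α ξ k ω i) :=
      fun i => (ihz i).mono hle le_rfl
    have hu : ∀ i, Measurable[sampleFiltration ξ (k + 1)] (fun ω => gtU P W m γ α ξ k ω i) :=
      fun i => (ihu i).mono hle le_rfl
    have hv : ∀ i, Measurable[sampleFiltration ξ (k + 1)] (fun ω => gtV P W m γ α ξ k ω i) :=
      fun i => (ihv i).mono hle le_rfl
    have hv' : ∀ i, Measurable[sampleFiltration ξ (k + 1)]
        (fun ω => gtV P W m γ α ξ (k + 1) ω i) :=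
      fun i => measurable_stochGrad hR i (hx i) (measurable_sample ξ k i)
    have hw : ∀ i, Measurable[sampleFiltration ξ (k + 1)] (fun ω => gtDir P W m γ α ξ k ω i) :=
      fun i => ((hu i).fun_add (hv' i)).fun_sub (hv i)
    refine ⟨fun i => ?_, fun i => ?_, fun i => ?_, hv'⟩
    · simp only [gtX_succ]
      exact measurable_mix _ (fun i => ((hx i).fun_const_smul _).fun_add
        ((measurable_proxStep hΨ hγ hx hz i).fun_const_smul _)) i
    · simp only [gtZ_succ]
      exact measurable_mix _ (fun i => ((hz i).fun_const_smul _).fun_add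
        ((hw i).fun_const_smul _)) i
    · simp only [gtU_succ]
      exact measurable_mix _ hw i

section

variable [IsProbabilityMeasure μ]

theorem memLp_gtV_succ (hO : Oracle P σs μ ξ) (hS : P.Smooth L)
    (hR : P.Regular) (hΨ : ClosedProperConvex P.Ψ) (hγ : 0 < γ) (k : ℕ)
    (hx : ∀ i, MemLp (fun ω => gtX P W m γ α ξ k ω i) 2 μ) (i : Fin n) :
    MemLp (fun ω => gtV P W m γ α ξ (k + 1) ω i) 2 μ := by
  simp only [gtV_succ]
  exact hO.memLp_stochGrad hS hR k i ((measurable_gt hR hΨ hγ k).1 i) (hx i)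

theorem memLp_gt (hO : Oracle P σs μ ξ) (hS : P.Smooth L)
    (hR : P.Regular) (hΨ : ClosedProperConvex P.Ψ) (hγ : 0 < γ)
    (k : ℕ) : (∀ i, MemLp (fun ω => gtX P W m γ α ξ k ω i) 2 μ) ∧
      (∀ i, MemLp (fun ω => gtZ P W m γ α ξ k ω i) 2 μ) ∧
      (∀ i, MemLp (fun ω => gtU P W m γ α ξ k ω i) 2 μ) ∧
      (∀ i, MemLp (fun ω => gtV P W m γ α ξ k ω i) 2 μ) := by
  induction k with
  | zero => exact ⟨fun i => memLp_const (0 : Vec d), fun i => memLp_const (0 : Vec d),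
      fun i => memLp_const (0 : Vec d), fun i => memLp_const (0 : Vec d)⟩
  | succ k ih =>
    obtain ⟨hx, hz, hu, hv⟩ := ih
    have hv' : ∀ i, MemLp (fun ω => gtV P W m γ α ξ (k + 1) ω i) 2 μ :=
      memLp_gtV_succ hO hS hR hΨ hγ k hx
    have hw : ∀ i, MemLp (fun ω => gtDir P W m γ α ξ k ω i) 2 μ :=
      fun i => ((hu i).fun_add (hv' i)).fun_sub (hv i)
    refine ⟨fun i => ?_, fun i => ?_, fun i => ?_, hv'⟩
    · simp only [gtX_succ]
      exact memLp_mix _ (fun i => ((hx i).fun_const_smul _).fun_add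
        ((memLp_proxStep hΨ hγ hx hz i).fun_const_smul _)) i
    · simp only [gtZ_succ]
      exact memLp_mix _ (fun i => ((hz i).fun_const_smul _).fun_add
        ((hw i).fun_const_smul _)) i
    · simp only [gtU_succ]
      exact memLp_mix _ hw i

theorem memLp_gtDir (hO : Oracle P σs μ ξ) (hS : P.Smooth L)
    (hR : P.Regular) (hΨ : ClosedProperConvex P.Ψ) (hγ : 0 < γ) (k : ℕ) (i : Fin n) :
    MemLp (fun ω => gtDir P W m γ α ξ k ω i) 2 μ := by
  obtain ⟨hx, hz, hu, hv⟩ := memLp_gt (W := W) (m := m) (α := α) hO hS hR hΨ hγ k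
  exact ((hu i).fun_add (memLp_gtV_succ hO hS hR hΨ hγ k hx i)).fun_sub (hv i)

end

-- The tracking invariant: u and v have equal averages, initially because both vanish, and
-- afterwards because mixing preserves averages.
omit [MeasurableSpace Ω] in
theorem avg_gtDir (hW : IsGossip W) (k : ℕ) (ω : Ω) :
    avg (gtDir P W m γ α ξ k ω) = avg (gtV P W m γ α ξ (k + 1) ω) := by
  have h1 : gtDir P W m γ α ξ k ω
      = gtU P W m γ α ξ k ω + gtV P W m γ α ξ (k + 1) ω - gtV P W m γ α ξ k ω := rfl
  have h2 : avg (gtU P W m γ α ξ k ω) = avg (gtV P W m γ α ξ k ω) := by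
    induction k with
    | zero => rfl
    | succ k ih =>
      have h3 : gtDir P W m γ α ξ k ω
          = gtU P W m γ α ξ k ω + gtV P W m γ α ξ (k + 1) ω - gtV P W m γ α ξ k ω := rfl
      rw [gtU_succ, hW.avg_mix_pow, h3, avg_sub, avg_add, ih h3]
      abel
  rw [h1, avg_sub, avg_add, h2]
  abel

theorem isRun_gt [IsProbabilityMeasure μ] (hW : IsGossip W) (hO : Oracle P σs μ ξ)
    (hS : P.Smooth L) (hR : P.Regular) (hΨ : ClosedProperConvex P.Ψ) (hγ : 0 < γ) :
    IsRun P W m γ α μ ξ (gtX P W m γ α ξ) (gtZ P W m γ α ξ) (gtDir P W m γ α ξ) where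
  x_zero _ := rfl
  z_zero _ := rfl
  x_succ k ω := gtX_succ k ω
  z_succ k ω := gtZ_succ k ω
  avg_w k ω := avg_gtDir hW k ω
  measurable_x k := (measurable_gt hR hΨ hγ k).1
  measurable_z k := (measurable_gt hR hΨ hγ k).2.1
  memLp_x k := (memLp_gt hO hS hR hΨ hγ k).1
  memLp_z k := (memLp_gt hO hS hR hΨ hγ k).2.1
  memLp_w k := memLp_gtDir hO hS hR hΨ hγ k

/-- The variant for tracking, where the gradient increment is added after mixing. -/
theorem IsGossip.dev_mix_pow_add_right_le (hW : IsGossip W) (hn : 1 ≤ n) {δ : ℝ} (hδ : 0 < δ)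
    (hδ1 : δ ≤ 1) (hρ : rho W ^ (2 * m) ≤ 1 - δ) (X Y : Fin n → Vec d) :
    dev (mix (W ^ m) X + Y) ≤ (1 - δ / 2) * dev X + 2 / δ * dev Y := by
  have h1 := hW.dev_mix_pow_le hn m X
  have h2 := dev_add_le (mix (W ^ m) X) Y (t := 1 - δ / 2) (by linarith) (by linarith)
  have h3 := dev_nonneg X
  rw [sub_sub_cancel] at h2
  calc dev (mix (W ^ m) X + Y) ≤ dev (mix (W ^ m) X) / (1 - δ / 2) + dev Y / (δ / 2) := h2
    _ ≤ (1 - δ) * dev X / (1 - δ / 2) + dev Y / (δ / 2) := by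
      have : 0 ≤ 1 - δ / 2 := by linarith
      gcongr
      exact h1.trans (by gcongr)
    _ = (1 - δ) / (1 - δ / 2) * dev X + 2 / δ * dev Y := by
      field_simp
    _ ≤ (1 - δ / 2) * dev X + 2 / δ * dev Y := by
      gcongr
      rw [div_le_iff₀ (by linarith)]
      nlinarith

/-- Each direction is the mixed previous one plus an increment of stochastic gradients. The
increment consists of two noises and a gradient difference at successive points of the same agent,
so differences between the agents' objectives do not enter. They appear only at the start, through
∇Fᵢ(0), since u⁰ = v⁰ = 0. -/
theorem directionBound_gt [IsProbabilityMeasure μ] (hW : IsGossip W) (hO : Oracle P σs μ ξ)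
    (hS : P.Smooth L) (hR : P.Regular) (hΨ : ClosedProperConvex P.Ψ) (hn : 1 ≤ n) (hγ : 0 < γ)
    {σ δ β C₀ : ℝ} (hσ : (n : ℝ)⁻¹ * ∑ i, σs i ^ 2 ≤ σ ^ 2) (hC₀ : 0 ≤ C₀)
    (hgrad : (n : ℝ)⁻¹ * ∑ i, ‖gradient (P.locF i) 0‖ ^ 2 ≤ C₀)
    (hδ : 0 < δ) (hδ1 : δ ≤ 1) (hρ : rho W ^ (2 * m) ≤ 1 - δ) (hα : ∀ k, 0 < α k)
    (hαβ : ∀ k, α k ≤ β) :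
    DirectionBound P L γ δ β (σ ^ 2) C₀ μ (gtX P W m γ α ξ) (gtZ P W m γ α ξ)
      (gtDir P W m γ α ξ) := by
  have hrun : IsRun P W m γ α μ ξ (gtX P W m γ α ξ) (gtZ P W m γ α ξ) (gtDir P W m γ α ξ) :=
    isRun_gt hW hO hS hR hΨ hγ
  have hn' : (0 : ℝ) < n := by positivity
  let η : ℕ → Ω → ℝ := fun k ω => ∑ i, ‖P.noise i (gtX P W m γ α ξ k ω i) (ξ (k + 1) i ω)‖ ^ 2
  have hη : ∀ k, Integrable (η k) μ ∧ ∫ ω, η k ω ∂μ ≤ n * σ ^ 2 := fun k =>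
    hO.sum_integral_noise_sq_le hS hR hn hσ k (hrun.measurable_x k)
  refine ⟨?_, fun k => ?_⟩
  · have hpt : ∀ ω, dev (gtDir P W m γ α ξ 0 ω) ≤ 2 * η 0 ω + 2 * (n * C₀) := by
      intro ω
      refine (dev_le_sum hn _ 0).trans ?_
      have h1 : ∀ i, ‖gtDir P W m γ α ξ 0 ω i - 0‖ ^ 2
          ≤ 2 * ‖P.noise i (gtX P W m γ α ξ 0 ω i) (ξ (0 + 1) i ω)‖ ^ 2
            + 2 * ‖gradient (P.locF i) 0‖ ^ 2 := by
        intro i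
        have h2 : gtDir P W m γ α ξ 0 ω i = P.noise i (gtX P W m γ α ξ 0 ω i) (ξ (0 + 1) i ω)
            + gradient (P.locF i) 0 := by
          have h3 : gtDir P W m γ α ξ 0 ω i
              = 0 + P.stochGrad i (gtX P W m γ α ξ 0 ω i) (ξ (0 + 1) i ω) - 0 := rfl
          rw [h3, zero_add, sub_zero, stochGrad_eq]
          rfl
        rw [sub_zero, h2]
        exact norm_add_sq_le_two _ _
      refine (Finset.sum_le_sum fun i _ => h1 i).trans ?_
      rw [Finset.sum_add_distrib, ← Finset.mul_sum, ← Finset.mul_sum]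
      rw [inv_mul_le_iff₀ hn'] at hgrad
      gcongr
    have h2 := integral_mono (integrable_dev (hrun.memLp_w 0))
      (((hη 0).1.const_mul 2).add (integrable_const (2 * (n * C₀)))) hpt
    have h3 := integral_add ((hη 0).1.const_mul 2) (integrable_const (2 * (n * C₀)))
    simp only [Pi.add_apply, integral_const_mul, integral_const, probReal_univ, one_smul] at h2 h3
    rw [h3] at h2
    have h4 := (hη 0).2
    have : (0 : ℝ) ≤ n * σ ^ 2 := by positivity
    have : (0 : ℝ) ≤ n * C₀ := by positivity
    linarith
  · have hpt : ∀ ω, dev (gtDir P W m γ α ξ (k + 1) ω)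
        ≤ (1 - δ / 2) * dev (gtDir P W m γ α ξ k ω) + 2 / δ * (3 * η (k + 1) ω + 3 * η k ω
          + 9 * L ^ 2 * (dev (gtX P W m γ α ξ (k + 1) ω) + dev (gtX P W m γ α ξ k ω)
          + β ^ 2 * (2 * n * ‖avgStep P.Ψ γ (gtX P W m γ α ξ k ω) (gtZ P W m γ α ξ k ω)‖ ^ 2
            + 4 * dev (gtX P W m γ α ξ k ω) + 4 * γ ^ 2 * dev (gtZ P W m γ α ξ k ω)))) := by
      intro ω
      have h1 : gtDir P W m γ α ξ (k + 1) ω = mix (W ^ m) (gtDir P W m γ α ξ k ω)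
          + (gtV P W m γ α ξ (k + 2) ω - gtV P W m γ α ξ (k + 1) ω) := by
        rw [← gtU_succ, ← add_sub_assoc]
        rfl
      rw [h1]
      refine (hW.dev_mix_pow_add_right_le hn hδ hδ1 hρ _ _).trans
        (add_le_add le_rfl (mul_le_mul_of_nonneg_left ?_ (by positivity)))
      refine (dev_le_sum hn _ 0).trans ?_
      have h2 : ∀ i, ‖(gtV P W m γ α ξ (k + 2) ω - gtV P W m γ α ξ (k + 1) ω) i - 0‖ ^ 2
          ≤ 3 * ‖P.noise i (gtX P W m γ α ξ (k + 1) ω i) (ξ (k + 1 + 1) i ω)‖ ^ 2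
            + 3 * ‖P.noise i (gtX P W m γ α ξ k ω i) (ξ (k + 1) i ω)‖ ^ 2
            + 3 * (L ^ 2 * ‖gtX P W m γ α ξ (k + 1) ω i - gtX P W m γ α ξ k ω i‖ ^ 2) := by
        intro i
        have h3 := norm_add_sq_le_three (P.noise i (gtX P W m γ α ξ (k + 1) ω i)
          (ξ (k + 1 + 1) i ω)) (-P.noise i (gtX P W m γ α ξ k ω i) (ξ (k + 1) i ω))
          (gradient (P.locF i) (gtX P W m γ α ξ (k + 1) ω i)
            - gradient (P.locF i) (gtX P W m γ α ξ k ω i))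
        have h4 : (gtV P W m γ α ξ (k + 2) ω - gtV P W m γ α ξ (k + 1) ω) i - 0
            = P.noise i (gtX P W m γ α ξ (k + 1) ω i) (ξ (k + 1 + 1) i ω)
            + -P.noise i (gtX P W m γ α ξ k ω i) (ξ (k + 1) i ω)
            + (gradient (P.locF i) (gtX P W m γ α ξ (k + 1) ω i)
              - gradient (P.locF i) (gtX P W m γ α ξ k ω i)) := by
          rw [Pi.sub_apply, gtV_succ, gtV_succ, stochGrad_eq, stochGrad_eq]
          abel
        rw [norm_neg] at h3
        rw [h4]
        refine h3.trans (add_le_add le_rfl (mul_le_mul_of_nonneg_left ?_ (by norm_num)))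
        exact hS.norm_gradient_sub_sq_le i _ _
      refine (Finset.sum_le_sum fun i _ => h2 i).trans ?_
      simp only [Finset.sum_add_distrib, ← Finset.mul_sum]
      have h5 := mul_le_mul_of_nonneg_left
        (hrun.sum_norm_x_succ_sub_le hW hΨ hn hγ hα hαβ k ω) (sq_nonneg (L : ℝ))
      simp only [η]
      linarith
    have i1 := integrable_dev (hrun.memLp_w k)
    have i2 := integrable_dev (hrun.memLp_x (k + 1))
    have i3 := integrable_dev (hrun.memLp_x k)
    have i4 := integrable_dev (hrun.memLp_z k)
    have i5 := (memLp_avgStep hΨ hγ (hrun.memLp_x k) (hrun.memLp_z k)).norm.integrable_sq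
    have i6 := (hη k).1
    have i7 := (hη (k + 1)).1
    have j1 := i5.const_mul (2 * (n : ℝ))
    have j2 := i3.const_mul 4
    have j3 := i4.const_mul (4 * γ ^ 2)
    have j4 := ((j1.add j2).add j3).const_mul (β ^ 2)
    have j5 := ((i2.add i3).add j4).const_mul (9 * (L : ℝ) ^ 2)
    have j6 := (i7.const_mul 3).add (i6.const_mul 3)
    have j7 := (j6.add j5).const_mul (2 / δ)
    have j8 := i1.const_mul (1 - δ / 2)
    have h1 := integral_mono (integrable_dev (hrun.memLp_w (k + 1))) (j8.add j7) hpt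
    have e1 := integral_add j8 j7
    have e2 := integral_add j6 j5
    have e3 := integral_add (i7.const_mul 3) (i6.const_mul 3)
    have e4 := integral_add (i2.add i3) j4
    have e5 := integral_add i2 i3
    have e6 := integral_add (j1.add j2) j3
    have e7 := integral_add j1 j2
    simp only [Pi.add_apply, integral_const_mul] at h1 e1 e2 e3 e4 e5 e6 e7
    rw [e1, e2, e3, e4, e5, e6, e7] at h1
    refine h1.trans (add_le_add le_rfl (mul_le_mul_of_nonneg_left ?_ (by positivity)))
    refine add_le_add ?_ le_rfl
    have := (hη k).2
    have := (hη (k + 1)).2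
    linarith

end GradientTracking

section Output

variable {n d : ℕ} {S : Type*} [MeasurableSpace S] {Ω : Type*} [MeasurableSpace Ω]
  {P : Problem n d S} {L : NNReal} {W : Matrix (Fin n) (Fin n) ℝ} {m : ℕ} {γ : ℝ}
  {α : ℕ → ℝ} {μ : Measure Ω} {ξ : ℕ → Fin n → Ω → S} {σs : Fin n → ℝ}

/-! ### The random output index -/

theorem IsUniformIndex.ae_mem {K : ℕ} {R : Ω → ℕ} (hR : IsUniformIndex μ ξ K R) :
    ∀ᵐ ω ∂μ, R ω ∈ Finset.Icc 1 K := by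
  have h1 : μ.map R (Set.Icc 1 K)ᶜ = 0 := by
    rw [hR.law, uniformOn_eq_zero_iff (Set.finite_Icc 1 K)]
    simp
  rw [Measure.map_apply hR.measurable (by measurability)] at h1
  rw [ae_iff]
  refine measure_mono_null (fun ω hω => ?_) h1
  simpa using hω

theorem IsUniformIndex.measureReal_eq {K : ℕ} {R : Ω → ℕ} (hR : IsUniformIndex μ ξ K R)
    {k : ℕ} (hk : k ∈ Finset.Icc 1 K) : μ.real (R ⁻¹' {k}) = (K : ℝ)⁻¹ := by
  have h1 : μ.map R {k} = (K : ENNReal)⁻¹ := by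
    have h2 := uniformOn_apply_finset (s := Finset.Icc 1 K) (t := {k})
    rw [Finset.inter_singleton_of_mem hk] at h2
    rw [hR.law]
    simpa using h2
  rw [Measure.map_apply hR.measurable (measurableSet_singleton k)] at h1
  rw [measureReal_def, h1]
  simp

/-- On the event R = k the integrand is f k, which is measurable for the samples, so independence of
R factors each piece with probability 1/K. -/
theorem IsUniformIndex.integral_eq [IsProbabilityMeasure μ] {K : ℕ} {R : Ω → ℕ}
    (hR : IsUniformIndex μ ξ K R) {f : ℕ → Ω → ℝ}
    (hf : ∀ k, Measurable[sampleFiltration ξ k] (f k)) (hint : ∀ k, Integrable (f k) μ) :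
    Integrable (fun ω => f (R ω) ω) μ ∧
      ∫ ω, f (R ω) ω ∂μ = (K : ℝ)⁻¹ * ∑ k ∈ Finset.Icc 1 K, ∫ ω, f k ω ∂μ := by
  let I : ℕ → Ω → ℝ := fun k => (R ⁻¹' {k}).indicator 1
  have hms : ∀ k, MeasurableSet (R ⁻¹' {k}) := fun k => hR.measurable (measurableSet_singleton k)
  have hae : (fun ω => f (R ω) ω) =ᵐ[μ] fun ω => ∑ k ∈ Finset.Icc 1 K, (I k * f k) ω := by
    filter_upwards [hR.ae_mem] with ω hω
    rw [Finset.sum_eq_single_of_mem (R ω) hω]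
    · simp [I]
    · intro k _ hk
      simp [I, Set.indicator, Ne.symm hk]
  have hI : ∀ k, Integrable (I k * f k) μ := by
    intro k
    have : I k * f k = (R ⁻¹' {k}).indicator (f k) := by
      ext ω
      by_cases h : R ω = k <;> simp [I, Set.indicator, h]
    rw [this]
    exact (hint k).indicator (hms k)
  have hval : ∀ k ∈ Finset.Icc 1 K, ∫ ω, (I k * f k) ω ∂μ = (K : ℝ)⁻¹ * ∫ ω, f k ω ∂μ := by
    intro k hk
    have hind : IndepFun R (f k) μ := by
      rw [IndepFun_iff_Indep]
      exact indep_of_indep_of_le_right hR.indep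
        ((measurable_iff_comap_le.1 (hf k)).trans (le_iSup (sampleFiltration ξ) k))
    have h1 : I k = (({k} : Set ℕ).indicator 1) ∘ R := by
      ext ω
      by_cases hk : R ω = k <;> simp [I, hk]
    have h2 : IndepFun (I k) (f k) μ := by
      rw [h1]
      exact hind.comp (φ := ({k} : Set ℕ).indicator (1 : ℕ → ℝ)) (ψ := id)
        measurable_from_top measurable_id
    rw [h2.integral_mul_eq_mul_integral
      ((measurable_const.indicator (hms k)).aestronglyMeasurable) (hint k).1]
    congr 1
    rw [integral_indicator_one (hms k), hR.measureReal_eq hk]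
  refine ⟨(integrable_finsetSum _ fun k _ => hI k).congr hae.symm, ?_⟩
  rw [integral_congr_ae hae, integral_finsetSum _ fun k _ => hI k, Finset.mul_sum]
  exact Finset.sum_congr rfl hval

theorem IsStationaryPoint.congr {L ε : ℝ} {X Y : Ω → Fin n → Vec d}
    (h : IsStationaryPoint P L γ μ ε X) (hXY : X =ᵐ[μ] Y) : IsStationaryPoint P L γ μ ε Y := by
  have h1 : (fun ω => ‖gradMap P.Ψ (avg (X ω)) (gradient P.F (avg (X ω))) γ‖ ^ 2) =ᵐ[μ]
      fun ω => ‖gradMap P.Ψ (avg (Y ω)) (gradient P.F (avg (Y ω))) γ‖ ^ 2 := by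
    filter_upwards [hXY] with ω hω
    rw [hω]
  have h2 : (fun ω => L ^ 2 / n * ∑ i, ‖X ω i - avg (X ω)‖ ^ 2) =ᵐ[μ]
      fun ω => L ^ 2 / n * ∑ i, ‖Y ω i - avg (Y ω)‖ ^ 2 := by
    filter_upwards [hXY] with ω hω
    rw [hω]
  exact ⟨h.integrable_violation.congr h1, integral_congr_ae h1 ▸ h.violation_le,
    h.integrable_consensus.congr h2, integral_congr_ae h2 ▸ h.consensus_le⟩

/-! ### The stationarity violation -/

/-- Replacing z by g moves the proximal point by at most γ‖z - g‖, which compensates the prefactor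
1/γ. This turns the Lyapunov decrease into a bound on stationarity. -/
theorem ClosedProperConvex.norm_gradMap_sq_le {Ψ : Vec d → EReal} (hΨ : ClosedProperConvex Ψ)
    (hγ : 0 < γ) (x z g : Vec d) :
    ‖gradMap Ψ x g γ‖ ^ 2 ≤ 2 * γ⁻¹ ^ 2 * ‖prox Ψ γ (x - γ • z) - x‖ ^ 2 + 2 * ‖z - g‖ ^ 2 := by
  set y := prox Ψ γ (x - γ • z)
  set y' := prox Ψ γ (x - γ • g)
  have h1 : gradMap Ψ x g γ = γ⁻¹ • (-(y - x)) + γ⁻¹ • (y - y') := by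
    rw [gradMap, one_div, ← smul_add]
    congr 1
    abel
  have h2 := hΨ.norm_prox_sub_prox_le hγ (x - γ • z) (x - γ • g)
  have h3 : x - γ • z - (x - γ • g) = (-γ) • (z - g) := by module
  rw [h3, norm_smul, norm_neg, Real.norm_of_nonneg hγ.le] at h2
  have h4 : ‖γ⁻¹ • (y - y')‖ ≤ ‖z - g‖ := by
    rw [norm_smul, Real.norm_of_nonneg (inv_nonneg.2 hγ.le), inv_mul_le_iff₀ hγ]
    exact h2
  rw [h1]
  refine (norm_add_sq_le_two _ _).trans ?_
  have h5 : ‖γ⁻¹ • -(y - x)‖ ^ 2 = γ⁻¹ ^ 2 * ‖y - x‖ ^ 2 := by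
    rw [norm_smul, norm_neg, mul_pow, Real.norm_eq_abs, sq_abs]
  rw [h5, ← mul_assoc]
  gcongr

theorem measurable_norm_sq {A : Type*} {mA : MeasurableSpace A} {f : A → Vec d}
    (hf : Measurable f) : Measurable fun a => ‖f a‖ ^ 2 := hf.norm.pow_const 2

theorem measurable_const_mul_dev {A : Type*} {mA : MeasurableSpace A} {X : A → Fin n → Vec d}
    (hX : ∀ i, Measurable fun a => X a i) (c : ℝ) :
    Measurable fun a => c * ∑ i, ‖X a i - avg (X a)‖ ^ 2 :=
  (Finset.measurable_fun_sum _ fun i _ =>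
    measurable_norm_sq ((hX i).fun_sub (measurable_avg hX))).const_mul c

theorem average_le_of_weighted_sum_le {q e : ℕ → ℝ} (hq : ∀ k, 0 ≤ q k) (he : ∀ k, 0 ≤ e k)
    {c D κ β : ℝ} {K : ℕ} (hK : 1 ≤ K) (hc : 0 < c) (hκ : 0 < κ) (hβ : 0 < β)
    (h : κ * β * (c / 2) * ∑ k ∈ Finset.range (K + 1), q k
      + β * ∑ k ∈ Finset.range (K + 1), e k ≤ D) :
    (K : ℝ)⁻¹ * ∑ k ∈ Finset.Icc 1 K, q k ≤ 2 * D / (κ * β * K * c) ∧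
      (K : ℝ)⁻¹ * ∑ k ∈ Finset.Icc 1 K, e k ≤ D / (β * K) := by
  have hK' : (0 : ℝ) < K := by positivity
  -- The summed estimate starts at index 0, which R does not take; that nonnegative term is dropped.
  have hsub : Finset.Icc 1 K ⊆ Finset.range (K + 1) := by
    intro k hk
    rw [Finset.mem_Icc] at hk
    rw [Finset.mem_range]
    omega
  have hq1 := Finset.sum_le_sum_of_subset_of_nonneg hsub fun k _ _ => hq k
  have he1 := Finset.sum_le_sum_of_subset_of_nonneg hsub fun k _ _ => he k
  have hq0 := Finset.sum_nonneg fun k (_ : k ∈ Finset.Icc 1 K) => hq k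
  have he0 := Finset.sum_nonneg fun k (_ : k ∈ Finset.Icc 1 K) => he k
  have hw : 0 < κ * β * (c / 2) := by positivity
  have h1 := mul_le_mul_of_nonneg_left hq1 hw.le
  have h2 := mul_le_mul_of_nonneg_left he1 hβ.le
  have h3 := mul_nonneg hw.le hq0
  have h4 := mul_nonneg hβ.le he0
  constructor
  · rw [inv_mul_eq_div, div_le_div_iff₀ hK' (by positivity)]
    have : (κ * β * (c / 2) * ∑ k ∈ Finset.Icc 1 K, q k) * (2 * K) ≤ D * (2 * K) :=
      mul_le_mul_of_nonneg_right (by linarith) (by positivity)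
    linarith
  · rw [inv_mul_eq_div, div_le_div_iff₀ hK' (by positivity)]
    have : (β * ∑ k ∈ Finset.Icc 1 K, e k) * K ≤ D * K :=
      mul_le_mul_of_nonneg_right (by linarith) (by positivity)
    linarith

variable {x z w : ℕ → Ω → Fin n → Vec d}

theorem IsRun.isStationaryPoint [IsProbabilityMeasure μ] (h : IsRun P W m γ α μ ξ x z w)
    (hS : P.Smooth L) (hΨ : ClosedProperConvex P.Ψ)
    (hγ : 0 < γ) {c s D κ β ε : ℝ} {K : ℕ} (hK : 1 ≤ K) (hc : 0 < c) (hκ : 0 < κ) (hβ : 0 < β)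
    (hbound : κ * β * (c / 2) * ∑ k ∈ Finset.range (K + 1),
        (∫ ω, ‖avgStep P.Ψ γ (x k ω) (z k ω)‖ ^ 2 ∂μ
          + ∫ ω, ‖avg (z k ω) - gradient P.F (avg (x k ω))‖ ^ 2 ∂μ)
      + β * ∑ k ∈ Finset.range (K + 1), L ^ 2 / n * ∫ ω, dev (x k ω) ∂μ ≤ D)
    (hs : 2 * γ⁻¹ ^ 2 + 2 ≤ s)
    (hε₁ : s * (2 * D) / (κ * β * K * c) ≤ ε) (hε₂ : D / (β * K) ≤ ε)
    {R : Ω → ℕ} (hR : IsUniformIndex μ ξ K R) :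
    IsStationaryPoint P L γ μ ε (fun ω => x (R ω) ω) := by
  have ha0 : ∀ k, 0 ≤ ∫ ω, ‖avgStep P.Ψ γ (x k ω) (z k ω)‖ ^ 2 ∂μ :=
    fun k => integral_nonneg fun ω => sq_nonneg _
  have he0 : ∀ k, 0 ≤ ∫ ω, ‖avg (z k ω) - gradient P.F (avg (x k ω))‖ ^ 2 ∂μ :=
    fun k => integral_nonneg fun ω => sq_nonneg _
  have hχ0 : ∀ k, 0 ≤ (L : ℝ) ^ 2 / n * ∫ ω, dev (x k ω) ∂μ :=
    fun k => mul_nonneg (by positivity) (integral_nonneg fun ω => dev_nonneg _)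
  obtain ⟨hq, he⟩ := average_le_of_weighted_sum_le (fun k => add_nonneg (ha0 k) (he0 k)) hχ0
    hK hc hκ hβ hbound
  have hmx : ∀ k, Measurable[sampleFiltration ξ k] fun ω => avg (x k ω) :=
    fun k => measurable_avg (h.measurable_x k)
  have hmg : ∀ k, Measurable[sampleFiltration ξ k]
      fun ω => gradMap P.Ψ (avg (x k ω)) (gradient P.F (avg (x k ω))) γ := fun k =>
    ((hmx k).fun_sub ((hΨ.lipschitz_prox hγ).continuous.measurable.comp
      ((hmx k).fun_sub ((hS.measurable_gradient_F (hmx k)).fun_const_smul γ)))).fun_const_smul _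
  have hig : ∀ k, MemLp (fun ω => gradMap P.Ψ (avg (x k ω)) (gradient P.F (avg (x k ω))) γ) 2 μ := by
    intro k
    have h1 := memLp_avg (h.memLp_x k)
    have h2 := memLp_lipschitz_comp hS.lipschitz_F h1
    exact (h1.fun_sub (memLp_lipschitz_comp (hΨ.lipschitz_prox hγ)
      (h1.fun_sub (h2.fun_const_smul γ)))).fun_const_smul _
  obtain ⟨hv1, hv2⟩ := hR.integral_eq
    (f := fun k ω => ‖gradMap P.Ψ (avg (x k ω)) (gradient P.F (avg (x k ω))) γ‖ ^ 2)
    (fun k => measurable_norm_sq (hmg k)) (fun k => (hig k).norm.integrable_sq)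
  obtain ⟨hc1, hc2⟩ := hR.integral_eq
    (f := fun k ω => L ^ 2 / n * ∑ i, ‖x k ω i - avg (x k ω)‖ ^ 2)
    (fun k => measurable_const_mul_dev (h.measurable_x k) _)
    (fun k => (integrable_dev (h.memLp_x k)).const_mul _)
  have hs0 : 0 ≤ s := le_trans (by positivity) hs
  refine ⟨hv1, ?_, hc1, ?_⟩
  · rw [hv2]
    have h1 : ∀ k ∈ Finset.Icc 1 K,
        ∫ ω, ‖gradMap P.Ψ (avg (x k ω)) (gradient P.F (avg (x k ω))) γ‖ ^ 2 ∂μ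
        ≤ s * (∫ ω, ‖avgStep P.Ψ γ (x k ω) (z k ω)‖ ^ 2 ∂μ
          + ∫ ω, ‖avg (z k ω) - gradient P.F (avg (x k ω))‖ ^ 2 ∂μ) := by
      intro k _
      have i1 := (memLp_avgStep hΨ hγ (h.memLp_x k) (h.memLp_z k)).norm.integrable_sq
      have i2 := ((memLp_avg (h.memLp_z k)).fun_sub
        (memLp_lipschitz_comp hS.lipschitz_F (memLp_avg (h.memLp_x k)))).norm.integrable_sq
      have h2 := integral_mono (hig k).norm.integrable_sq
        ((i1.const_mul (2 * γ⁻¹ ^ 2)).add (i2.const_mul 2))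
        (fun ω => hΨ.norm_gradMap_sq_le hγ (avg (x k ω)) (avg (z k ω)) _)
      have h3 := integral_add (i1.const_mul (2 * γ⁻¹ ^ 2)) (i2.const_mul 2)
      simp only [Pi.add_apply, integral_const_mul] at h2 h3
      rw [h3] at h2
      refine h2.trans ?_
      rw [mul_add]
      have h4 : 0 ≤ γ⁻¹ ^ 2 := sq_nonneg _
      exact add_le_add (mul_le_mul_of_nonneg_right (by linarith) (ha0 k))
        (mul_le_mul_of_nonneg_right (by linarith) (he0 k))
    have h2 := mul_le_mul_of_nonneg_left (Finset.sum_le_sum h1)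
      (inv_nonneg.2 (Nat.cast_nonneg (α := ℝ) K))
    rw [← Finset.mul_sum, mul_left_comm] at h2
    refine (h2.trans (mul_le_mul_of_nonneg_left hq hs0)).trans ?_
    rwa [← mul_div_assoc]
  · rw [hc2]
    simp only [integral_const_mul]
    exact he.trans hε₂

/-! ### The iterates depend only on the past stepsizes -/

theorem dasa_congr {α' : ℕ → ℝ} {s : ℕ → Fin n → S} {k : ℕ} (h : ∀ j < k, α j = α' j) :
    dasa P W m γ α s k = dasa P W m γ α' s k := by
  induction k with
  | zero => rfl
  | succ k ih => simp only [dasa, ih fun j hj => h j (by omega), h k (by omega)]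

theorem dasaGTFull_congr {α' : ℕ → ℝ} {s : ℕ → Fin n → S} {k : ℕ} (h : ∀ j < k, α j = α' j) :
    dasaGTFull P W m γ α s k = dasaGTFull P W m γ α' s k := by
  induction k with
  | zero => rfl
  | succ k ih => simp only [dasaGTFull, ih fun j hj => h j (by omega), h k (by omega)]

theorem dasa_samples (α : ℕ → ℝ) (s : ℕ → Fin n → S) (k : ℕ) (i : Fin n) :
    (dasa P W m γ α s k).samples i = k := by
  induction k with
  | zero => rfl
  | succ k ih => exact congrArg (· + 1) ih

theorem dasaGT_samples (α : ℕ → ℝ) (s : ℕ → Fin n → S) (k : ℕ) (i : Fin n) :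
    (dasaGT P W m γ α s k).samples i = k := by
  induction k with
  | zero => rfl
  | succ k ih => exact congrArg (· + 1) ih

end Output

/-! ### Constants that do not depend on the network -/

section Constants

variable {c₁ c₂ a₁ a₂ L γ σ ν C₀ : ℝ}

/-- A bound for the right-hand side of the descent estimate over a whole run. -/
noncomputable def descentBudget (c₁ c₂ a₂ L σ ν C₀ : ℝ) : ℝ :=
  (3 + 2 * c₂ + c₂ / L + 1 / (32 * L * c₁)) * C₀ + 2 * (σ ^ 2 + ν ^ 2)
    + 2 * a₂ ^ 2 * ((c₂ / L / 2 + 1 / (32 * L * c₁)) * σ ^ 2)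

/-- A lower bound of `lyapunovRate L γ` for `γ ≤ c₂ / L`. -/
noncomputable def rateBound (c₂ L : ℝ) : ℝ := min (L / (2 * c₂)) (1 / (64 * L * c₂))

/-- Both stationarity measures of the output are at most this constant divided by `√(n K)`. -/
noncomputable def stationarityConst (c₁ c₂ a₁ a₂ L σ ν C₀ : ℝ) : ℝ :=
  (2 * (L / c₁) ^ 2 + 2) * (2 * descentBudget c₁ c₂ a₂ L σ ν C₀) / (a₁ * rateBound c₂ L)
    + descentBudget c₁ c₂ a₂ L σ ν C₀ / a₂

theorem rateBound_pos (hc₂ : 0 < c₂) (hL : 0 < L) : 0 < rateBound c₂ L := by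
  rw [rateBound, lt_min_iff]; constructor <;> positivity

theorem inv_le_of_div_le (hc₁ : 0 < c₁) (hL : 0 < L) (h : c₁ / L ≤ γ) : γ⁻¹ ≤ L / c₁ := by
  rw [← inv_div c₁ L]
  exact inv_anti₀ (by positivity) h

theorem le_inv_of_le_div (hγ : 0 < γ) (h : γ ≤ c₂ / L) : L / c₂ ≤ γ⁻¹ := by
  rw [← inv_div c₂ L]
  exact inv_anti₀ hγ h

theorem gradWeight_le (hc₁ : 0 < c₁) (hL : 0 < L) (h : c₁ / L ≤ γ) :
    gradWeight L γ ≤ 1 / (32 * L * c₁) := by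
  have h1 := inv_le_of_div_le hc₁ hL h
  calc gradWeight L γ ≤ L / c₁ / (32 * L ^ 2) := by rw [gradWeight]; gcongr
    _ = 1 / (32 * L * c₁) := by field_simp

theorem rateBound_le (hc₂ : 0 < c₂) (hL : 0 < L) (hγ : 0 < γ) (h : γ ≤ c₂ / L) :
    rateBound c₂ L ≤ lyapunovRate L γ := by
  have h1 := le_inv_of_le_div hγ h
  refine min_le_min ?_ ?_
  · calc L / (2 * c₂) = L / c₂ / 2 := by field_simp
      _ ≤ γ⁻¹ / 2 := by gcongr
  · calc 1 / (64 * L * c₂) = L / c₂ / (32 * L ^ 2) / 2 := by field_simp; norm_num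
      _ ≤ gradWeight L γ / 2 := by rw [gradWeight]; gcongr

theorem descentBudget_nonneg (hc₁ : 0 < c₁) (hc₂ : 0 < c₂) (hL : 0 < L) (hC₀ : 0 ≤ C₀) :
    0 ≤ descentBudget c₁ c₂ a₂ L σ ν C₀ := by
  rw [descentBudget]; positivity

/-- K = ⌈BT⌉ works. As BT ≥ 1, K + 1 ≤ BT + 2 ≤ 3BT, which covers the rounding and the additional
pass of the tracking variant. -/
theorem exists_iterations_le {b C e q : ℝ} (he : 0 ≤ e) (hq : 0 ≤ q)
    {k : ℕ} (hk : 1 ≤ k) : ∃ K : ℕ, k ≤ K ∧ b * q ≤ K ∧ C * e ≤ K ∧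
      (K : ℝ) + 1 ≤ 3 * max 1 (max b C) * max e (max (k : ℝ) q) := by
  set B := max 1 (max b C)
  set T := max e (max (k : ℝ) q)
  have hk' : (1 : ℝ) ≤ k := by exact_mod_cast hk
  have hB1 : 1 ≤ B := le_max_left _ _
  have hBb : b ≤ B := (le_max_left b C).trans (le_max_right _ _)
  have hBC : C ≤ B := (le_max_right b C).trans (le_max_right _ _)
  have hTe : e ≤ T := le_max_left _ _
  have hTk : (k : ℝ) ≤ T := (le_max_left (k : ℝ) q).trans (le_max_right _ _)
  have hTq : q ≤ T := (le_max_right (k : ℝ) q).trans (le_max_right _ _)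
  have hB0 : 0 ≤ B := zero_le_one.trans hB1
  have hBT : 1 ≤ B * T := one_le_mul_of_one_le_of_one_le hB1 (hk'.trans hTk)
  refine ⟨⌈B * T⌉₊, ?_, ?_, ?_, ?_⟩
  · rw [← Nat.cast_le (α := ℝ)]
    refine le_trans ?_ (Nat.le_ceil _)
    have := mul_le_mul hB1 hTk (by positivity) hB0
    linarith
  · exact (mul_le_mul hBb hTq hq hB0).trans (Nat.le_ceil _)
  · exact (mul_le_mul hBC hTe he hB0).trans (Nat.le_ceil _)
  · have := Nat.ceil_lt_add_one (zero_le_one.trans hBT)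
    linarith

end Constants

/-! ### From the summed estimate to ε-stationarity -/

section Complexity

variable {n d : ℕ} {S : Type*} [MeasurableSpace S] {Ω : Type*} [MeasurableSpace Ω]
  {P : Problem n d S} {L : NNReal} {W : Matrix (Fin n) (Fin n) ℝ} {m : ℕ} {γ : ℝ}
  {α : ℕ → ℝ} {μ : Measure Ω} {ξ : ℕ → Fin n → Ω → S} {σs : Fin n → ℝ}

/-- From some `K` on, the stepsizes of order `√(n / K)` are small enough. -/
theorem exists_smallStep (n : ℕ) (L ϱ γ : ℝ) {a₁ a₂ : ℝ} (ha₁ : 0 < a₁) (ha₂ : 0 < a₂) :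
    ∃ K₀ : ℕ, 1 ≤ K₀ ∧ (1 ≤ n → 0 < L → 0 < γ → ∀ K : ℕ, K₀ ≤ K →
      SmallStep n L γ (1 / (2 * (1 + ϱ))) (a₁ / a₂) (2 * a₂ ^ 2 * n) (a₂ * √((n : ℝ) / K))) := by
  by_cases h : 1 ≤ n ∧ 0 < L ∧ 0 < γ
  · obtain ⟨hn, hL, hγ⟩ := h
    have h1 : Filter.Tendsto (fun K : ℕ => a₂ * √((n : ℝ) / K)) Filter.atTop (nhds 0) := by
      have h2 := ((tendsto_const_div_atTop_nhds_zero_nat (n : ℝ)).sqrt).const_mul a₂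
      simpa using h2
    obtain ⟨K₀, hK₀⟩ := Filter.eventually_atTop.1
      (h1.eventually (eventually_smallStep hn hL hγ (div_pos ha₁ ha₂)))
    exact ⟨max 1 K₀, le_max_left _ _, fun _ _ _ K hK => hK₀ K ((le_max_right _ _).trans hK)⟩
  -- The threshold has to be a function of all values of n, L, ϱ, γ, so it gets a default value
  -- where the positivity conditions fail.
  · exact ⟨1, le_rfl, fun h1 h2 h3 => absurd ⟨h1, h2, h3⟩ h⟩

theorem IsRun.isStationaryPoint_of_le [IsProbabilityMeasure μ]
    {x z w : ℕ → Ω → Fin n → Vec d} (h : IsRun P W m γ α μ ξ x z w) (hW : IsGossip W)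
    (hO : Oracle P σs μ ξ) (hS : P.Smooth L) (hR : P.Regular) (hΨ : ClosedProperConvex P.Ψ)
    (hn : 1 ≤ n) (hL : 0 < L) {c₁ c₂ a₁ a₂ σ ν Φinf C₀ N₂ δ ε : ℝ} {K : ℕ}
    (hσ : (n : ℝ)⁻¹ * ∑ i, σs i ^ 2 ≤ σ ^ 2) (hΦ : ∀ x, (Φinf : EReal) ≤ P.Phi x)
    (hgap : P.initGap Φinf ≤ (C₀ : EReal)) (hC₀ : 0 ≤ C₀)
    (hc₁ : 0 < c₁) (hc₁₂ : c₁ ≤ c₂) (hγ₁ : c₁ / L ≤ γ) (hγ₂ : γ ≤ c₂ / L)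
    (ha₁ : 0 < a₁) (ha₁₂ : a₁ ≤ a₂) (hN₂ : 0 ≤ N₂) (hN₂' : N₂ ≤ σ ^ 2 + ν ^ 2)
    (hδ : 0 < δ) (hδ1 : δ ≤ 1) (hρ : rho W ^ (2 * m) ≤ 1 - δ)
    (hα : ∀ k, a₁ * √((n : ℝ) / K) ≤ α k ∧ α k ≤ a₂ * √((n : ℝ) / K))
    (hsmall : SmallStep n L γ δ (a₁ / a₂) (2 * a₂ ^ 2 * n) (a₂ * √((n : ℝ) / K)))
    (hU : DirectionBound P L γ δ (a₂ * √((n : ℝ) / K)) N₂ C₀ μ x z w) (hK : 1 ≤ K) (hε : 0 < ε)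
    (hKε : stationarityConst c₁ c₂ a₁ a₂ L σ ν C₀ ^ 2 * ((n : ℝ)⁻¹ * (ε ^ 2)⁻¹) ≤ K)
    {R : Ω → ℕ} (hRi : IsUniformIndex μ ξ K R) :
    IsStationaryPoint P L γ μ ε (fun ω => x (R ω) ω) := by
  have hL' : (0 : ℝ) < L := by exact_mod_cast hL
  have hn' : (0 : ℝ) < n := by positivity
  have hK' : (0 : ℝ) < K := by positivity
  have hK1 : (1 : ℝ) ≤ K := by exact_mod_cast hK
  have hc₂ : 0 < c₂ := hc₁.trans_le hc₁₂
  have ha₂ : 0 < a₂ := ha₁.trans_le ha₁₂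
  have hγ : 0 < γ := (div_pos hc₁ hL').trans_le hγ₁
  have hγL : γ * L ≤ c₂ := (le_div_iff₀ hL').1 hγ₂
  obtain ⟨h0, -⟩ := Problem.initGap_le_iff hΨ hgap
  have hlam0 := gradWeight_pos hL' hγ
  have hlam := gradWeight_le hc₁ hL' hγ₁
  have hrate := rateBound_le hc₂ hL' hγ hγ₂
  have hr0 := rateBound_pos hc₂ hL'
  set D := descentBudget c₁ c₂ a₂ L σ ν C₀ with hD
  have hD0 : 0 ≤ D := descentBudget_nonneg hc₁ hc₂ hL' hC₀
  set r := √((n : ℝ) / K) with hr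
  have hrpos : 0 < r := Real.sqrt_pos.2 (by positivity)
  have hrsq : r ^ 2 = n / K := Real.sq_sqrt (by positivity)
  have hκβ : a₁ / a₂ * (a₂ * r) = a₁ * r := by field_simp
  -- The K + 1 indices 0, …, K are summed, since R may equal K. The ratio (K + 1)/K ≤ 2 explains the
  -- 2 in M.
  have hN : ((K + 1 : ℕ) : ℝ) * (a₂ * r) ^ 2 ≤ 2 * a₂ ^ 2 * n := by
    rw [mul_pow, hrsq]
    push_cast
    have h1 : ((K : ℝ) + 1) * (a₂ ^ 2 * (n / K)) = a₂ ^ 2 * n * ((K + 1) / K) := by ring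
    have h2 : ((K : ℝ) + 1) / K ≤ 2 := by rw [div_le_iff₀ hK']; linarith
    rw [h1]
    nlinarith [mul_le_mul_of_nonneg_left h2 (by positivity : 0 ≤ a₂ ^ 2 * (n : ℝ))]
  have hmain := h.main_bound hW hO hS hR hΨ hn hL hγ hσ hΦ h0 hC₀ hN₂ hδ hδ1 hρ
    (div_pos ha₁ ha₂) (mul_pos ha₂ hrpos) (fun k => hκβ.le.trans (hα k).1) (fun k => (hα k).2)
    hsmall hU (K + 1) hN
  have hRHS : lyapunov P γ (gradWeight L γ) 0 0 - Φinf + 2 * N₂ + C₀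
        + 2 * a₂ ^ 2 * n * ((γ / 2 + gradWeight L γ) * (σ ^ 2 / n)) ≤ D := by
    have h1 := lyapunov_zero_le hS hΨ hΦ hgap hγ hlam0.le hγL
    have h2 : (2 + 2 * c₂ + γ + gradWeight L γ) * C₀
        ≤ (2 + 2 * c₂ + c₂ / L + 1 / (32 * L * c₁)) * C₀ := by gcongr
    -- The factor n from the squared stepsizes cancels the 1/n of the averaged noise, so the budget
    -- does not depend on n.
    have h3 : 2 * a₂ ^ 2 * n * ((γ / 2 + gradWeight L γ) * (σ ^ 2 / n))
        = 2 * a₂ ^ 2 * ((γ / 2 + gradWeight L γ) * σ ^ 2) := by field_simp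
    have h4 : 2 * a₂ ^ 2 * ((γ / 2 + gradWeight L γ) * σ ^ 2)
        ≤ 2 * a₂ ^ 2 * ((c₂ / L / 2 + 1 / (32 * L * c₁)) * σ ^ 2) := by gcongr
    rw [h3, hD, descentBudget]
    linarith
  have hq0 : 0 ≤ ∑ k ∈ Finset.range (K + 1),
      (∫ ω, ‖avgStep P.Ψ γ (x k ω) (z k ω)‖ ^ 2 ∂μ
        + ∫ ω, ‖avg (z k ω) - gradient P.F (avg (x k ω))‖ ^ 2 ∂μ) :=
    Finset.sum_nonneg fun k _ => add_nonneg (integral_nonneg fun ω => sq_nonneg _)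
      (integral_nonneg fun ω => sq_nonneg _)
  have hbound := (add_le_add_left (mul_le_mul_of_nonneg_right
    (mul_le_mul_of_nonneg_left (div_le_div_of_nonneg_right hrate zero_le_two)
      (mul_pos (div_pos ha₁ ha₂) (mul_pos ha₂ hrpos)).le) hq0) _).trans (hmain.trans hRHS)
  have hinv : γ⁻¹ ≤ L / c₁ := inv_le_of_div_le hc₁ hL' hγ₁
  have hs : 2 * γ⁻¹ ^ 2 + 2 ≤ 2 * (L / c₁) ^ 2 + 2 := by gcongr
  set Q := stationarityConst c₁ c₂ a₁ a₂ L σ ν C₀ with hQ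
  have hQ1 : 0 ≤ (2 * (L / c₁) ^ 2 + 2) * (2 * D) / (a₁ * rateBound c₂ L) := by positivity
  have hQ2 : 0 ≤ D / a₂ := by positivity
  have hQeq : Q = (2 * (L / c₁) ^ 2 + 2) * (2 * D) / (a₁ * rateBound c₂ L) + D / a₂ := rfl
  have hrK : 0 < r * K := by positivity
  -- Since rK = √(nK), squaring reduces the claim to Q² ≤ ε²nK, which is the assumption on K.
  have hQr : Q / (r * K) ≤ ε := by
    rw [div_le_iff₀ hrK]
    refine le_of_sq_le_sq ?_ (by positivity)
    have h1 : (ε * (r * K)) ^ 2 = ε ^ 2 * (n * K) := by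
      rw [mul_pow, mul_pow, hrsq]; field_simp
    rw [h1]
    have h2 : Q ^ 2 * ((n : ℝ)⁻¹ * (ε ^ 2)⁻¹) = Q ^ 2 / (n * ε ^ 2) := by
      rw [← mul_inv, div_eq_mul_inv]
    rw [h2, div_le_iff₀ (by positivity)] at hKε
    linarith
  refine h.isStationaryPoint hS hΨ hγ hK hr0 (div_pos ha₁ ha₂) (mul_pos ha₂ hrpos) hbound hs
    ?_ ?_ hRi
  · refine le_trans ?_ hQr
    rw [hκβ]
    calc (2 * (L / c₁) ^ 2 + 2) * (2 * D) / (a₁ * r * K * rateBound c₂ L)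
        = (2 * (L / c₁) ^ 2 + 2) * (2 * D) / (a₁ * rateBound c₂ L) / (r * K) := by
          rw [div_div]; congr 1; ring
      _ ≤ Q / (r * K) := by gcongr; linarith
  · refine le_trans ?_ hQr
    calc D / (a₂ * r * K) = D / a₂ / (r * K) := by rw [div_div, mul_assoc]
      _ ≤ Q / (r * K) := by gcongr; linarith

/-- The analysis asks for stepsize bounds at all times, but they are given only for k < K. Later
stepsizes are reset to the lower bound; this leaves the output unchanged because R ≤ K and the
iterate of index k uses only stepsizes before k. -/
theorem FindsStationary.of_isStationaryPoint
    {alg : (ℕ → ℝ) → (ℕ → Fin n → S) → ℕ → State n d} {passes K : ℕ} {a₁ a₂ ε N : ℝ}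
    (ha₁₂ : a₁ ≤ a₂)
    (hcongr : ∀ α α' s k, (∀ j < k, α j = α' j) → alg α s k = alg α' s k)
    (hsamples : ∀ α s k i, (alg α s k).samples i = k) (hN : (passes : ℝ) ≤ N)
    (hst : ∀ α : ℕ → ℝ,
      (∀ k, a₁ * √((n : ℝ) / K) ≤ α k ∧ α k ≤ a₂ * √((n : ℝ) / K)) →
      ∀ R : Ω → ℕ, IsUniformIndex μ ξ K R →
        IsStationaryPoint P L γ μ ε fun ω => (alg α (fun t j => ξ t j ω) (R ω)).x) :
    FindsStationary alg passes P L γ a₁ a₂ μ ξ ε K N where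
  batch_size α _ ω i k := by rw [hsamples, hsamples]
  samples_le α _ ω i := by rw [hsamples]; exact hN
  stationary α hα R hR := by
    let α' : ℕ → ℝ := fun k => if k < K then α k else a₁ * √((n : ℝ) / K)
    have hα' : ∀ k, a₁ * √((n : ℝ) / K) ≤ α' k ∧ α' k ≤ a₂ * √((n : ℝ) / K) := by
      intro k
      by_cases hk : k < K
      · simpa only [α', if_pos hk] using hα k hk
      · simp only [α', if_neg hk]
        exact ⟨le_rfl, by gcongr⟩
    refine (hst α' hα' R hR).congr ?_
    filter_upwards [hR.ae_mem] with ω hω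
    rw [hcongr α' α _ _ fun j hj => if_pos (hj.trans_le (Finset.mem_Icc.1 hω).2)]

end Complexity

end ProxDASA

/-! ### The complexity statement for both algorithms -/

open ProxDASA in
theorem corollary1 (c₁ c₂ a₁ a₂ b : ℝ) (hc₁ : 0 < c₁) (hc₁₂ : c₁ ≤ c₂) (ha₁ : 0 < a₁)
    (ha₁₂ : a₁ ≤ a₂) (hb : 0 < b) :
    -- `K₀` depends only on `n`, `L`, `ϱ(m)`, `γ`
    ∃ K₀ : ℕ → ℝ → ℝ → ℝ → ℕ,
    -- the constant `C` is independent of `n`, `d`, `m`, the network, `γ` and `ε`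
    ∀ (L : NNReal) (σ ν C₀ : ℝ), 0 < L → ∃ C : ℝ, 0 < C ∧
    ∀ (n d m : ℕ), 1 ≤ n → 1 ≤ m →
    ∀ (S : Type*) [MeasurableSpace S] (Ω : Type*) [MeasurableSpace Ω]
      (μ : MeasureTheory.Measure Ω) [MeasureTheory.IsProbabilityMeasure μ]
      (W : Matrix (Fin n) (Fin n) ℝ) (P : Problem n d S) (Φinf γ : ℝ) (σs : Fin n → ℝ)
      (ξ : ℕ → Fin n → Ω → S),
    IsGossip W → P.Regular → P.Smooth L → ClosedProperConvex P.Ψ →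
    (∀ x, (Φinf : EReal) ≤ P.Phi x) → P.initGap Φinf ≤ (C₀ : EReal) →
    Oracle P σs μ ξ → (n : ℝ)⁻¹ * ∑ i, σs i ^ 2 ≤ σ ^ 2 →
    c₁ / L ≤ γ → γ ≤ c₂ / L →
    ∀ (ϱ : ℝ) (K₀n : ℕ) (KT : ℝ), ϱ = varrho (rho W) m → K₀n = K₀ n L ϱ γ →
      KT = max (K₀n : ℝ) ((n : ℝ) ^ 3 * ϱ) →
    ∀ ε : ℝ, 0 < ε →
    -- Prox-DASA, under bounded gradient heterogeneity: loop over `k = 0, …, K - 1`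
    (P.BoundedHeterogeneity ν →
      (∀ K : ℕ, K₀n ≤ K → b * ((n : ℝ) ^ 3 * ϱ) ≤ K → C * ((n : ℝ)⁻¹ * (ε ^ 2)⁻¹) ≤ K →
        FindsStationary (dasa P W m γ) K P L γ a₁ a₂ μ ξ ε K K) ∧
      (∃ K : ℕ, K₀n ≤ K ∧ b * ((n : ℝ) ^ 3 * ϱ) ≤ K ∧
        FindsStationary (dasa P W m γ) K P L γ a₁ a₂ μ ξ ε K
          (C * max ((n : ℝ)⁻¹ * (ε ^ 2)⁻¹) KT))) ∧
    -- Prox-DASA-GT: loop over `k = 0, …, K`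
    ((∀ K : ℕ, K₀n ≤ K → b * ((n : ℝ) ^ 3 * ϱ) ≤ K → C * ((n : ℝ)⁻¹ * (ε ^ 2)⁻¹) ≤ K →
        FindsStationary (dasaGT P W m γ) (K + 1) P L γ a₁ a₂ μ ξ ε K (K + 1)) ∧
      (∃ K : ℕ, K₀n ≤ K ∧ b * ((n : ℝ) ^ 3 * ϱ) ≤ K ∧
        FindsStationary (dasaGT P W m γ) (K + 1) P L γ a₁ a₂ μ ξ ε K
          (C * max ((n : ℝ)⁻¹ * (ε ^ 2)⁻¹) KT))) := by
  have ha₂ : 0 < a₂ := ha₁.trans_le ha₁₂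
  choose K₀ hK₀1 hK₀ using fun (n : ℕ) (L ϱ γ : ℝ) => exists_smallStep n L ϱ γ ha₁ ha₂
  refine ⟨K₀, fun L σ ν C₀ hL => ?_⟩
  obtain ⟨Q, hQ⟩ : ∃ Q, Q = stationarityConst c₁ c₂ a₁ a₂ L σ ν C₀ := ⟨_, rfl⟩
  have hCmax : Q ^ 2 ≤ 3 * max 1 (max b (Q ^ 2 + 1)) := by
    have h1 : Q ^ 2 + 1 ≤ max 1 (max b (Q ^ 2 + 1)) :=
      (le_max_right _ _).trans (le_max_right _ _)
    linarith [sq_nonneg Q]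
  -- This value is dictated by the bound on K + 1 in `exists_iterations_le`; the first claim needs
  -- only C ≥ Q².
  refine ⟨3 * max 1 (max b (Q ^ 2 + 1)), by positivity, ?_⟩
  intro n d m hn hm S _ Ω _ μ _ W P Φinf γ σs ξ hW hR hS hΨ hΦ hgap hO hσ hγ₁ hγ₂
    ϱ K₀n KT hϱ hK₀n hKT ε hε
  have hL' : (0 : ℝ) < L := by exact_mod_cast hL
  have hγ : 0 < γ := (div_pos hc₁ hL').trans_le hγ₁
  obtain ⟨hϱ0, hρ⟩ := hW.rho_pow_le hm
  rw [← hϱ] at hϱ0 hρ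
  have hδ : 0 < 1 / (2 * (1 + ϱ)) := by positivity
  have hδ1 : 1 / (2 * (1 + ϱ)) ≤ 1 := by
    rw [div_le_one (by positivity)]; linarith
  obtain ⟨h0, hinit⟩ := Problem.initGap_le_iff hΨ hgap
  have hgrad0 : 0 ≤ (n : ℝ)⁻¹ * ∑ i, ‖gradient (P.locF i) 0‖ ^ 2 := by positivity
  have hval0 := Problem.le_of_le_Phi hΨ hΦ h0
  have hC₀ : 0 ≤ C₀ := by linarith
  have he : 0 ≤ (n : ℝ)⁻¹ * (ε ^ 2)⁻¹ := by positivity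
  have hn' : (0 : ℝ) < n := by positivity
  have hK₀n1 : 1 ≤ K₀n := hK₀n ▸ hK₀1 n L ϱ γ
  have hsmall : ∀ K : ℕ, K₀n ≤ K → SmallStep n L γ (1 / (2 * (1 + ϱ))) (a₁ / a₂)
      (2 * a₂ ^ 2 * n) (a₂ * √((n : ℝ) / K)) := fun K hK =>
    hK₀ n L ϱ γ hn hL' hγ K (hK₀n ▸ hK)
  have hα0 : ∀ K : ℕ, K₀n ≤ K → 0 < a₁ * √((n : ℝ) / K) := by
    intro K hK
    have : (0 : ℝ) < K := by exact_mod_cast hK₀n1.trans hK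
    positivity
  have hdasa : P.BoundedHeterogeneity ν → ∀ (K : ℕ) (N : ℝ), K₀n ≤ K →
      Q ^ 2 * ((n : ℝ)⁻¹ * (ε ^ 2)⁻¹) ≤ K → K ≤ N →
      FindsStationary (dasa P W m γ) K P L γ a₁ a₂ μ ξ ε K N := by
    intro hν K N hK hKε hN
    refine .of_isStationaryPoint ha₁₂ (fun α α' s k => dasa_congr) dasa_samples hN ?_
    intro α hα R hRi
    exact (isRun_dasa hO hS hR hΨ hγ).isStationaryPoint_of_le hW hO hS hR hΨ hn hL hσ hΦ hgap
      hC₀ hc₁ hc₁₂ hγ₁ hγ₂ ha₁ ha₁₂ (by positivity) le_rfl hδ hδ1 hρ hα (hsmall K hK)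
      (directionBound_dasa hO hS hR hΨ hn hγ hσ hC₀ hδ hδ1 hν) (hK₀n1.trans hK) hε
      (hQ ▸ hKε) hRi
  have hgt : ∀ (K : ℕ) (N : ℝ), K₀n ≤ K →
      Q ^ 2 * ((n : ℝ)⁻¹ * (ε ^ 2)⁻¹) ≤ K → K + 1 ≤ N →
      FindsStationary (dasaGT P W m γ) (K + 1) P L γ a₁ a₂ μ ξ ε K N := by
    intro K N hK hKε hN
    refine .of_isStationaryPoint ha₁₂
      (fun α α' s k hα => congrArg GTState.toState (dasaGTFull_congr hα)) dasaGT_samples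
      (by exact_mod_cast hN) ?_
    intro α hα R hRi
    exact (isRun_gt hW hO hS hR hΨ hγ).isStationaryPoint_of_le hW hO hS hR hΨ hn hL hσ hΦ hgap
      (ν := ν) hC₀ hc₁ hc₁₂ hγ₁ hγ₂ ha₁ ha₁₂ (sq_nonneg σ) (by linarith [sq_nonneg ν]) hδ hδ1 hρ
      hα (hsmall K hK)
      (directionBound_gt hW hO hS hR hΨ hn hγ hσ hC₀ (by linarith) hδ hδ1 hρ
        (fun k => (hα0 K hK).trans_le (hα k).1) fun k => (hα k).2) (hK₀n1.trans hK) hε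
      (hQ ▸ hKε) hRi
  obtain ⟨K₁, hK₁, hK₁b, hK₁ε, hK₁N⟩ := exists_iterations_le (b := b) (C := Q ^ 2 + 1) he
    (by positivity : 0 ≤ (n : ℝ) ^ 3 * ϱ) hK₀n1
  rw [← hKT] at hK₁N
  have hK₁Q : Q ^ 2 * ((n : ℝ)⁻¹ * (ε ^ 2)⁻¹) ≤ K₁ := by linarith
  refine ⟨fun hν => ⟨fun K hK _ hKε => hdasa hν K K hK
      ((mul_le_mul_of_nonneg_right hCmax he).trans hKε) le_rfl,
    K₁, hK₁, hK₁b, hdasa hν K₁ _ hK₁ hK₁Q (by linarith)⟩,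
    fun K hK _ hKε => hgt K _ hK ((mul_le_mul_of_nonneg_right hCmax he).trans hKε) le_rfl,
    K₁, hK₁, hK₁b, hgt K₁ _ hK₁ hK₁Q hK₁N⟩
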